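/- Let $n\ge 1$ and $k\ge 2$, and let ${\cal H}$ be a set of $n+k+1$ hyperplanes of ${\bf P}^n={\bf P}(V)$ over ${\bf C}$ with normal crossing. Let $\Omega(\log{\cal H})$ be the sheaf of rational differential $1$-forms on ${\bf P}^n$ with at most logarithmic poles over the hyperplanes of ${\cal H}$ (locally generated by the regular forms and the forms $df/f$, $f$ a local equation of a hyperplane in ${\cal H}$). A vector bundle $S$ on ${\bf P}^n$ is a Steiner bundle in ${\cal S}_{n,k}$ if there is an exact sequence $0\to S^*\to W\otimes{\cal O}\to I\otimes{\cal O}(1)\to 0$ with $\dim W=n+k$, $\dim I=k$. Its unstable hyperplanes are the points $H$ of the dual space ${\bf P}^{n\vee}$ with $h^0(S^*_{|H})\ne 0$; they form the closed subscheme $W(S)\subset{\bf P}^{n\vee}$ that is the degeneracy locus of the natural map $H^1(S^*(-1))\otimes{\cal O}\to H^1(S^*)\otimes{\cal O}(1)$, i.e. of the map $I\otimes{\cal O}\to((V\otimes I)/W)\otimes{\cal O}(1)$ given by the sequence. $S$ is a Schwarzenberger bundle if, in suitable linear coordinates $x_0,\dots,x_n$, it is the dual of the kernel of the map ${\cal O}^{n+k}\to{\cal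 O}(1)^k$ given by the $k\times(n+k)$ matrix whose $i$-th row ($1\le i\le k$) is $(0,\dots,0,x_0,x_1,\dots,x_n,0,\dots,0)$ with $i-1$ leading zeros. ${\cal H}$ osculates a rational normal curve $C\subset{\bf P}^n$ if every hyperplane in ${\cal H}$ meets $C$ at some point with multiplicity $n$. The hyperplanes with this property form the dual rational normal curve $C_n\subset{\bf P}^{n\vee}$. Then: 1. $\Omega(\log{\cal H})$ is a Steiner bundle in ${\cal S}_{n,k}$. 2. If ${\cal H}$ does not osculate any rational normal curve, then $W(\Omega(\log{\cal H}))={\cal H}$. 3. If ${\cal H}$ osculates a rational normal curve $C$, then $W(\Omega(\log{\cal H}))=C_n$, the dual curve of $C$. 4. ${\cal H}$ osculates a rational normal curve if and only if $\Omega(\log{\cal H})$ is a Schwarzenberger bundle. 5. (Torelli) If ${\cal H}'$ is another set of $n+k+1$ hyperplanes with normal crossing, and neither ${\cal H}$ nor ${\cal H}'$ osculates a rational normal curve, then ${\cal H}={\cal H}'$ if and only if $\Omega(\log{\cal H})\simeq\Omega(\log{\cal H}')$. In 2 and 3 the equalities hold as sets of closed points, and also as closed subschemes of ${\bf P}^{n\vee}$,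 with the reduced structure on the right-hand side. -/

import Mathlib

open scoped KaehlerDifferential

noncomputable section

namespace PnBundle

/-! ### Projective space, hyperplanes, rational functions -/

/-- The closed points of complex projective `n`-space. -/
abbrev Point (n : ℕ) : Type := Projectivization ℂ (Fin (n + 1) → ℂ)

/-- The hyperplanes of projective `n`-space, i.e. the points of the dual projective space: the class
of `v` is the hyperplane with equation `∑ i, v i * x i = 0`. -/
abbrev Hyperplane (n : ℕ) : Type := Projectivization ℂ (Fin (n + 1) → ℂ)

/-- Incidence of a point and a hyperplane. -/
def Lies {n : ℕ} (p : Point n) (H : Hyperplane n) : Prop := ∑ i, H.rep i * p.rep i = 0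

/-- Homogeneous coordinate ring. -/
abbrev Coord (n : ℕ) : Type := MvPolynomial (Fin (n + 1)) ℂ

/-- The linear form with coefficient vector `v`. -/
def linForm {n : ℕ} (v : Fin (n + 1) → ℂ) : Coord n := ∑ i, MvPolynomial.C (v i) * MvPolynomial.X i

/-- The fraction field of the homogeneous coordinate ring. -/
abbrev ConeField (n : ℕ) : Type := FractionRing (Coord n)

/-- `a`, seen in the fraction field. -/
abbrev toCone {n : ℕ} (a : Coord n) : ConeField n := algebraMap (Coord n) (ConeField n) a

/-- The subfield of the quotients of homogeneous polynomials of the same degree. -/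
def degreeZero (n : ℕ) : IntermediateField ℂ (ConeField n) where
  carrier := {f | ∃ (d : ℕ) (a b : Coord n), a.IsHomogeneous d ∧ b.IsHomogeneous d ∧ b ≠ 0 ∧
    f = toCone a / toCone b}
  mul_mem' := by
    rintro _ _ ⟨d, a, b, ha, hb, hb0, rfl⟩ ⟨e, a', b', ha', hb', hb0', rfl⟩
    refine ⟨d + e, a * a', b * b', ha.mul ha', hb.mul hb', mul_ne_zero hb0 hb0', ?_⟩
    simp only [toCone, map_mul]
    rw [div_mul_div_comm]
  add_mem' := by
    rintro _ _ ⟨d, a, b, ha, hb, hb0, rfl⟩ ⟨e, a', b', ha', hb', hb0', rfl⟩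
    refine ⟨d + e, a * b' + b * a', b * b', (ha.mul hb').add (hb.mul ha'), hb.mul hb',
      mul_ne_zero hb0 hb0', ?_⟩
    simp only [toCone, map_mul, map_add]
    rw [div_add_div]
    · simpa using hb0
    · simpa using hb0'
  algebraMap_mem' := by
    intro c
    refine ⟨0, MvPolynomial.C c, 1, MvPolynomial.isHomogeneous_C _ _,
      MvPolynomial.isHomogeneous_one _ _, one_ne_zero, ?_⟩
    simp only [toCone, map_one, div_one]
    rw [IsScalarTower.algebraMap_apply ℂ (Coord n) (ConeField n)]
    rfl
  inv_mem' := by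
    rintro _ ⟨d, a, b, ha, hb, hb0, rfl⟩
    by_cases h : a = 0
    · refine ⟨0, 0, 1, MvPolynomial.isHomogeneous_zero _ _ _,
        MvPolynomial.isHomogeneous_one _ _, one_ne_zero, ?_⟩
      simp [h]
    · exact ⟨d, b, a, hb, ha, h, by rw [inv_div]⟩

/-- The field of rational functions of projective `n`-space: quotients of homogeneous polynomials of
the same degree. -/
def FunField (n : ℕ) : Type := degreeZero n

instance (n : ℕ) : Field (FunField n) := inferInstanceAs (Field (degreeZero n))

instance (n : ℕ) : Algebra ℂ (FunField n) := inferInstanceAs (Algebra ℂ (degreeZero n))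

/-- A rational function of projective space, seen in the fraction field of the homogeneous
coordinate ring. -/
def FunField.val {n : ℕ} : FunField n →ₐ[ℂ] ConeField n := (degreeZero n).val

/-- The local ring of projective space at `p`: quotients of homogeneous polynomials of the same
degree whose denominator does not vanish at `p`. -/
def localRing {n : ℕ} (p : Point n) : Subalgebra ℂ (FunField n) where
  carrier := {f | ∃ (d : ℕ) (a b : Coord n), a.IsHomogeneous d ∧ b.IsHomogeneous d ∧
    MvPolynomial.eval p.rep b ≠ 0 ∧ f.val = toCone a / toCone b}
  mul_mem' := by
    rintro f g ⟨d, a, b, ha, hb, hb0, hf⟩ ⟨e, a', b', ha', hb', hb0', hg⟩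
    refine ⟨d + e, a * a', b * b', ha.mul ha', hb.mul hb', ?_, ?_⟩
    · rw [map_mul]; exact mul_ne_zero hb0 hb0'
    · rw [map_mul, hf, hg]
      simp only [toCone, map_mul]
      rw [div_mul_div_comm]
  add_mem' := by
    rintro f g ⟨d, a, b, ha, hb, hb0, hf⟩ ⟨e, a', b', ha', hb', hb0', hg⟩
    refine ⟨d + e, a * b' + b * a', b * b', (ha.mul hb').add (hb.mul ha'), hb.mul hb', ?_, ?_⟩
    · rw [map_mul]; exact mul_ne_zero hb0 hb0'
    · have h1 : b ≠ 0 := by rintro rfl; simp at hb0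
      have h2 : b' ≠ 0 := by rintro rfl; simp at hb0'
      rw [map_add, hf, hg]
      simp only [toCone, map_mul, map_add]
      rw [div_add_div]
      · simpa using h1
      · simpa using h2
  algebraMap_mem' := by
    intro c
    refine ⟨0, MvPolynomial.C c, 1, MvPolynomial.isHomogeneous_C _ _,
      MvPolynomial.isHomogeneous_one _ _, by simp, ?_⟩
    simp only [toCone, map_one, div_one]
    rw [AlgHom.commutes, IsScalarTower.algebraMap_apply ℂ (Coord n) (ConeField n)]
    rfl

/-- The local equations at `p` of the form `l / m`, where `l` is the linear equation of the
hyperplane `H` and `m` is a linear form that does not vanish at `p`. -/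
def localEquations {n : ℕ} (H : Hyperplane n) (p : Point n) : Set (localRing p) :=
  {f | ∃ m : Fin (n + 1) → ℂ, MvPolynomial.eval p.rep (linForm m) ≠ 0 ∧
    (f : FunField n).val = toCone (linForm H.rep) / toCone (linForm m)}

/-- The stalk at `p` of the ideal sheaf of the hyperplane `H`. -/
def idealAt {n : ℕ} (H : Hyperplane n) (p : Point n) : Ideal (localRing p) :=
  Ideal.span (localEquations H p)

/-! ### Sheaves, given by their stalks inside the generic stalk

A torsion free sheaf of modules on projective space is a subsheaf of a constant sheaf `M`, where
`M` is its generic stalk, a vector space over the function field. It is recorded by its stalks. -/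

/-- A subsheaf of the constant sheaf `M`: its section module over an open set `U` is
the intersection of the stalks at the points of `U`. -/
abbrev SubSheaf (n : ℕ) (M : Type) [AddCommGroup M] [Module (FunField n) M] : Type :=
  ∀ p : Point n, Submodule (localRing p) M

section Sheaves

variable {n : ℕ} {M M' : Type} [AddCommGroup M] [Module (FunField n) M] [AddCommGroup M']
  [Module (FunField n) M']

/-- Isomorphism of sheaves of modules: an isomorphism of the generic stalks that
identifies all the stalks. -/
def Iso (E : SubSheaf n M) (E' : SubSheaf n M') : Prop :=
  ∃ φ : M ≃ₗ[FunField n] M', ∀ (p : Point n) (e : M), e ∈ E p ↔ φ e ∈ E' p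

/-- `E` is locally free of finite rank, with generic stalk `M`: around every point there are a
Zariski open set `g ≠ 0` and a frame of `E` over it. -/
def IsVectorBundle (E : SubSheaf n M) : Prop :=
  ∀ p : Point n, ∃ (r : ℕ) (b : Module.Basis (Fin r) (FunField n) M) (d : ℕ) (g : Coord n),
    g.IsHomogeneous d ∧ MvPolynomial.eval p.rep g ≠ 0 ∧
    ∀ q : Point n, MvPolynomial.eval q.rep g ≠ 0 →
      E q = Submodule.span (localRing q) (Set.range b)

/-- The dual sheaf. -/
def dual (E : SubSheaf n M) : SubSheaf n (Module.Dual (FunField n) M) := fun p =>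
  { carrier := {φ | ∀ e ∈ E p, φ e ∈ localRing p}
    add_mem' := fun {φ ψ} hφ hψ e he => by
      rw [LinearMap.add_apply]; exact add_mem (hφ e he) (hψ e he)
    zero_mem' := fun e _ => by rw [LinearMap.zero_apply]; exact zero_mem _
    smul_mem' := fun c φ hφ e he => (localRing p).mul_mem c.2 (hφ e he) }

/-- The product of the stalk `E p` with the stalk of the ideal sheaf of `H`. -/
def idealMul (E : SubSheaf n M) (H : Hyperplane n) (p : Point n) : Submodule (localRing p) M :=
  idealAt H p • E p

variable [Module ℂ M] [IsScalarTower ℂ (FunField n) M]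

instance localRing_isScalarTower (p : Point n) : IsScalarTower ℂ (localRing p) M :=
  ⟨fun c f e => by
    change ((c • f : localRing p) : FunField n) • e = c • ((f : FunField n) • e)
    rw [← smul_assoc]
    rfl⟩

/-- The submodule `I_H E` at `p`, where `I_H` is the ideal sheaf of `H`; the stalk at `p ∈ H` of
the restriction of `E` to `H` is the quotient of `E p` by it. -/
def idealSMul (E : SubSheaf n M) (H : Hyperplane n) (p : Point n) : Submodule ℂ M :=
  Submodule.restrictScalars ℂ (idealMul E H p)

/-- The global sections of the restriction of `E` to the hyperplane `H`: families of germs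
`s p ∈ E p / I_H E p`, for `p ∈ H`, that are locally on `H` induced by a section of `E`. -/
def sectionsOn (E : SubSheaf n M) (H : Hyperplane n) :
    Submodule ℂ (∀ p : {p : Point n // Lies p H}, M ⧸ idealSMul E H p.1) where
  carrier := {s | ∀ p : {p : Point n // Lies p H}, ∃ (d : ℕ) (g : Coord n) (e : M),
    g.IsHomogeneous d ∧ MvPolynomial.eval p.1.rep g ≠ 0 ∧
    ∀ q : {q : Point n // Lies q H}, MvPolynomial.eval q.1.rep g ≠ 0 →
      e ∈ E q.1 ∧ s q = Submodule.Quotient.mk e}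
  add_mem' := by
    intro s t hs ht p
    obtain ⟨d, g, e, hg, hp, h⟩ := hs p
    obtain ⟨d', g', e', hg', hp', h'⟩ := ht p
    refine ⟨d + d', g * g', e + e', hg.mul hg', ?_, fun q hq => ?_⟩
    · rw [map_mul]; exact mul_ne_zero hp hp'
    · rw [map_mul] at hq
      have h1 := h q (left_ne_zero_of_mul hq)
      have h2 := h' q (right_ne_zero_of_mul hq)
      exact ⟨add_mem h1.1 h2.1, by rw [Pi.add_apply, h1.2, h2.2, Submodule.Quotient.mk_add]⟩
  zero_mem' := fun p => ⟨0, 1, 0, MvPolynomial.isHomogeneous_one _ _, by simp,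
    fun q _ => ⟨zero_mem _, rfl⟩⟩
  smul_mem' := by
    intro c s hs p
    obtain ⟨d, g, e, hg, hp, h⟩ := hs p
    refine ⟨d, g, c • e, hg, hp, fun q hq => ⟨?_, ?_⟩⟩
    · exact ((E q.1).restrictScalars ℂ).smul_mem c (h q hq).1
    · rw [Pi.smul_apply, (h q hq).2, Submodule.Quotient.mk_smul]

/-- The number `h⁰` of the restriction of `E` to `H`. -/
def h0On (E : SubSheaf n M) (H : Hyperplane n) : Cardinal := Module.rank ℂ (sectionsOn E H)

/-- The set `W(S)` of the unstable hyperplanes of `S`. -/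
def unstableHyperplanes (S : SubSheaf n M) : Set (Hyperplane n) := {H | h0On (dual S) H ≠ 0}

end Sheaves

/-! ### Steiner bundles and Schwarzenberger bundles -/

section Steiner

variable {n k : ℕ}

/-- The matrices of linear forms: the entry at `(a, j)` is the linear form with coefficient
vector `A a j`. -/
abbrev LinMatrix (n k : ℕ) : Type := Matrix (Fin k) (Fin (n + k)) (Fin (n + 1) → ℂ)

/-- The map `O^(n+k) → O(1)^k` given by `A` is surjective, i.e. `A` has rank `k` at every point. -/
def Nondegenerate (A : LinMatrix n k) : Prop :=
  ∀ p : Point n, (Matrix.of fun a j => ∑ i, A a j i * p.rep i).rank = k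

/-- The generic stalk of the kernel of the map `O^(n+k) → O(1)^k` given by `A`. -/
def kernelGeneric (A : LinMatrix n k) : Submodule (FunField n) (Fin (n + k) → FunField n) where
  carrier := {w | ∀ a, ∑ j, toCone (linForm (A a j)) * (w j).val = 0}
  add_mem' := by
    intro v w hv hw a
    simp [mul_add, Finset.sum_add_distrib, hv a, hw a]
  zero_mem' := by intro a; simp
  smul_mem' := by
    intro c w hw a
    have : ∀ j, toCone (linForm (A a j)) * ((c • w) j).val =
        c.val * (toCone (linForm (A a j)) * (w j).val) := by
      intro j
      simp only [Pi.smul_apply, smul_eq_mul, map_mul]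
      ring
    simp only [this, ← Finset.mul_sum, hw a, mul_zero]

/-- The kernel of the map `O^(n+k) → O(1)^k` given by `A`. -/
def kernelSheaf (A : LinMatrix n k) : SubSheaf n (kernelGeneric A) := fun p =>
  { carrier := {w | ∀ j, w.1 j ∈ localRing p}
    add_mem' := fun hv hw j => add_mem (hv j) (hw j)
    zero_mem' := fun _ => zero_mem _
    smul_mem' := fun c _ hw j => (localRing p).mul_mem c.2 (hw j) }

variable {M : Type} [AddCommGroup M] [Module (FunField n) M]

/-- The dual of `S` is the kernel in the exact sequence
`0 → S^* → W ⊗ O → I ⊗ O(1) → 0` given by `A`, where `W = ℂ^(n+k)` and `I = ℂ^k`. -/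
def IsSteinerMatrix (A : LinMatrix n k) (S : SubSheaf n M) : Prop :=
  Nondegenerate A ∧ Iso (dual S) (kernelSheaf A)

/-- `S` is a Steiner bundle in the class `S_{n,k}`. -/
def IsSteiner (k : ℕ) (S : SubSheaf n M) : Prop :=
  IsVectorBundle S ∧ ∃ A : LinMatrix n k, IsSteinerMatrix A S

/-- The `k × (n+k)` matrix whose row `a` is `a` zeros, then `L 0, …, L n`, then zeros. If the `L i`
are the basis of `V ≃ S^n U` dual to the monomials, it is the matrix of the map
`S^(n+k-1) U ⊗ O → S^(k-1) U ⊗ O(1)` that is dual to the multiplication of binary forms. -/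
def schwarzenbergerMatrix (k : ℕ) (L : Fin (n + 1) → Fin (n + 1) → ℂ) : LinMatrix n k :=
  Matrix.of fun a j =>
    if h : a.1 ≤ j.1 ∧ j.1 - a.1 < n + 1 then L ⟨j.1 - a.1, h.2⟩ else 0

/-- `S` is a Schwarzenberger bundle: in suitable linear coordinates it is the dual of the kernel of
the map above. -/
def IsSchwarzenberger (k : ℕ) (S : SubSheaf n M) : Prop :=
  ∃ L : Fin (n + 1) → Fin (n + 1) → ℂ, LinearIndependent ℂ L ∧
    Iso S (dual (kernelSheaf (schwarzenbergerMatrix k L)))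

/-! ### The scheme structure of `W(S)` -/

/-- The homogeneous ideal, in the coordinate ring of the dual projective space, of the degeneracy
locus of the map `I ⊗ O → ((V ⊗ I) / W) ⊗ O(1)`, the map `H¹(S^*(-1)) ⊗ O → H¹(S^*) ⊗ O(1)` of a
Steiner bundle with matrix `A`. The linear forms on `(V ⊗ I) / W` are the `ψ : I ⊗ V → ℂ` that
vanish on the columns of `A`, so the maximal minors of the map are spanned by the
determinants below. -/
def degeneracyIdeal (A : LinMatrix n k) : Ideal (Coord n) :=
  Ideal.span {f | ∃ ψ : Fin k → Fin k → Fin (n + 1) → ℂ,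
    (∀ c j, ∑ a, ∑ i, ψ c a i * A a j i = 0) ∧
    f = (Matrix.of fun c a => linForm (ψ c a)).det}

/-- The homogeneous ideal of the reduced subscheme with underlying set `Z`: all polynomials
vanishing on the cone over `Z`. -/
def reducedIdeal (Z : Set (Hyperplane n)) : Ideal (Coord n) :=
  MvPolynomial.vanishingIdeal ℂ {v | ∃ h : v ≠ 0, Projectivization.mk ℂ v h ∈ Z}

/-- Two homogeneous ideals define the same closed subscheme of projective space: they agree after
multiplication with a power of the irrelevant ideal. -/
def SameSubscheme (I J : Ideal (Coord n)) : Prop :=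
  ∃ N : ℕ, Ideal.span (Set.range MvPolynomial.X) ^ N * I ≤ J ∧
    Ideal.span (Set.range MvPolynomial.X) ^ N * J ≤ I

/-- `W(S) = Z` for the Steiner bundle `S`, where `Z` carries its reduced structure: equality of
point sets, and of closed subschemes of the dual projective space. -/
def UnstableSchemeEq [Module ℂ M] [IsScalarTower ℂ (FunField n) M]
    (k : ℕ) (S : SubSheaf n M) (Z : Set (Hyperplane n)) : Prop :=
  unstableHyperplanes S = Z ∧
    ∀ A : LinMatrix n k, IsSteinerMatrix A S →
      SameSubscheme (degeneracyIdeal A) (reducedIdeal Z)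

end Steiner

/-! ### Logarithmic bundles -/

section Logarithmic

variable {n : ℕ}

/-- The hyperplanes in `ℋ` have normal crossing: the equations of those
through any given point are linearly independent. -/
def NormalCrossing (ℋ : Finset (Hyperplane n)) : Prop :=
  ∀ p : Point n, LinearIndependent ℂ fun H : {H : Hyperplane n // H ∈ ℋ ∧ Lies p H} => H.1.rep

/-- The sheaf `Ω(log ℋ)` of rational differential forms on projective space with at most logarithmic
poles over the hyperplanes in `ℋ`: near `p` it is generated by the regular
differentials and by the `df / f`, where `f` is a local equation of a hyperplane in `ℋ`. -/
def logForms (ℋ : Finset (Hyperplane n)) : SubSheaf n (Ω[FunField n⁄ℂ]) := fun p =>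
  Submodule.span (localRing p)
    ({ω | ∃ f : localRing p, ω = KaehlerDifferential.D ℂ (FunField n) (f : FunField n)} ∪
     {ω | ∃ H ∈ ℋ, ∃ f ∈ localEquations H p,
        ω = (f : FunField n)⁻¹ • KaehlerDifferential.D ℂ (FunField n) (f : FunField n)})

/-! ### Rational normal curves -/

/-- A rational normal curve in projective `n`-space, i.e. a curve projectively equivalent to the
image of `[s : t] ↦ [s ^ n : s ^ (n - 1) * t : … : t ^ n]`, given by the linear change of
coordinates. -/
structure RationalNormalCurve (n : ℕ) where
  frame : Matrix.GeneralLinearGroup (Fin (n + 1)) ℂ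

/-- The parametrization of the curve. -/
def RationalNormalCurve.param (C : RationalNormalCurve n) (s t : ℂ) : Fin (n + 1) → ℂ :=
  (C.frame : Matrix (Fin (n + 1)) (Fin (n + 1)) ℂ).mulVec fun i => s ^ (n - i.1) * t ^ i.1

/-- The osculating hyperplanes of the curve: those that meet the curve at some point
`[s₀ : t₀]` with multiplicity `n`. They form the dual rational normal curve. -/
def RationalNormalCurve.osculating (C : RationalNormalCurve n) : Set (Hyperplane n) :=
  {H | ∃ s₀ t₀ c : ℂ, (s₀ ≠ 0 ∨ t₀ ≠ 0) ∧ c ≠ 0 ∧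
    ∀ s t : ℂ, ∑ i, H.rep i * C.param s t i = c * (t₀ * s - s₀ * t) ^ n}

/-- All hyperplanes in `ℋ` osculate the rational normal curve `C`. -/
def Osculates (ℋ : Finset (Hyperplane n)) (C : RationalNormalCurve n) : Prop :=
  ∀ H ∈ ℋ, H ∈ C.osculating

end Logarithmic

end PnBundle

end

open PnBundle

/-!
Let `f 0, …, f (n + k)` be the equations of the hyperplanes, and let `μ` be a basis of the linear
relations between them (their Gale dual, `IsGale`).

**The Steiner matrix.** A logarithmic vector field `θ` is determined by the functions
`θ (f j) / f j` up to a common summand, and these satisfy the `k` equations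
`∑ j, μ a j * f j * (θ (f j) / f j) = 0`. Normalizing the last function to zero, the dual of
`Ω(log ℋ)` is the kernel of the matrix with entries `μ a j * f j` (`logMatrix`,
`iso_dual_logForms_kernelSheaf`). Here `Ω(log ℋ)` has local frames of logarithmic differentials
(`lgBasis`), so it is a bundle, and the matrix has rank `k` everywhere because the hyperplanes have
normal crossing.

The scheme of unstable hyperplanes is defined by means of a Steiner matrix. This matrix is unique up
to invertible constant row and column operations (`matEquiv_of_isSteinerMatrix`): the coordinates of
any embedding of the dual into a trivial bundle are global logarithmic forms, and by a residue
argument (`exists_residues`) these are the constant combinations of the `d log (f j / f (n + k))`.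
Hence the scheme can be computed from a convenient matrix.

**Unstable hyperplanes.** A section of the kernel over a hyperplane `v` has constant coordinates, so
`v` is unstable if and only if the space of combinations of the columns, viewed as tensors in
`I ⊗ V`, contains a tensor `τ ⊗ v` of rank one (`mem_unstableHyperplanes_iff`). For the matrix of
`ℋ` this space is spanned by the tensors `μ j ⊗ f j`. In terms of a basis of `n + 1` of the `f j`,
any other tensor of rank one makes the coordinates of the remaining ones a Cauchy matrix; this means
that all the `f j` lie on a rational normal curve in the dual space, that is, that `ℋ` osculates a
rational normal curve (`IsGale.exists_eq_smul_or_exists_onCurve`). The same computation with tangent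
vectors to the variety of tensors of rank one (`IsGale.exists_eq_smul_or_exists_onCurve_of_tangent`)
shows that the degeneracy scheme is reduced at the points `f j` if `ℋ` does not osculate a rational
normal curve (`IsGale.map_linForm_eq_zero`).

**Osculating hyperplanes.** If the `f j` lie on the rational normal curve with coefficient vectors
`L`, the points with the same parameters on the rational normal curve of degree `n + k - 1` provide
a base change from the Schwarzenberger matrix of `L` to the matrix of `ℋ`
(`exists_matEquiv_schwarzenbergerMatrix`). A tensor of rank one in the column space of a
Schwarzenberger matrix is a Hankel matrix of rank one, and these are parametrized by the curve
(`onCurve_of_sum_smul_schwarzenbergerMatrix`). The relations between the entries of a Hankel matrix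
also show that, in the local ring of the degeneracy scheme at a point of the curve, the coordinates
are given by the parametrization of the curve (`exists_map_linForm_eq_mul_pow`), so that the scheme
is the reduced curve. In both cases the local statements are put together by the Nullstellensatz
(`exists_pow_mul_le`).

The remaining assertions follow: a Schwarzenberger bundle has infinitely many unstable hyperplanes,
whereas the bundle of a set `ℋ` that does not osculate a rational normal curve has only the elements
of `ℋ`; so such an `ℋ` is determined by its bundle.
-/

namespace PnBundle

noncomputable section

/-! ### Polynomials on linear subspaces -/

section Polynomials

variable {n : ℕ}

lemma aeval_mul_of_isHomogeneous {σ A : Type*} [CommRing A] [Algebra ℂ A] {a : MvPolynomial σ ℂ}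
    {d : ℕ} (ha : a.IsHomogeneous d) (t : A) (x : σ → A) :
    MvPolynomial.aeval (fun i => t * x i) a = t ^ d * MvPolynomial.aeval x a := by
  rw [MvPolynomial.aeval_def, MvPolynomial.aeval_def, MvPolynomial.eval₂_eq, MvPolynomial.eval₂_eq,
    Finset.mul_sum]
  refine Finset.sum_congr rfl fun m hm => ?_
  have hdeg : ∑ i ∈ m.support, m i = d := by
    have := ha.degree_eq_sum_deg_support hm
    simpa using this.symm
  rw [← hdeg]
  simp only [mul_pow, Finset.prod_mul_distrib, Finset.prod_pow_eq_pow_sum]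
  ring

lemma eval_smul_of_isHomogeneous {σ : Type*} {a : MvPolynomial σ ℂ} {d : ℕ}
    (ha : a.IsHomogeneous d) (t : ℂ) (v : σ → ℂ) :
    MvPolynomial.eval (t • v) a = t ^ d * MvPolynomial.eval v a := by
  have := aeval_mul_of_isHomogeneous ha t v
  simp only [MvPolynomial.aeval_eq_eval] at this
  exact this

/-- The restriction of a polynomial to a line is a polynomial in the parameter. -/
lemma exists_polynomial_on_line {σ : Type*} (P : MvPolynomial σ ℂ) (u w : σ → ℂ) :
    ∃ q : Polynomial ℂ, ∀ t : ℂ, q.eval t = MvPolynomial.eval (u + t • w) P := by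
  refine ⟨MvPolynomial.aeval (fun i => Polynomial.C (u i) + Polynomial.X * Polynomial.C (w i)) P,
    fun t => ?_⟩
  rw [← Polynomial.coe_evalRingHom, MvPolynomial.aeval_def, MvPolynomial.hom_eval₂]
  have : (Polynomial.evalRingHom t).comp (algebraMap ℂ (Polynomial ℂ)) = RingHom.id ℂ := by
    ext; simp
  rw [this, MvPolynomial.eval₂_id]
  congr 1
  congr 1
  ext i
  simp only [Polynomial.coe_evalRingHom, Polynomial.eval_add, Polynomial.eval_mul,
    Polynomial.eval_C, Polynomial.eval_X, Pi.add_apply, Pi.smul_apply, smul_eq_mul]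

/-- A polynomial that vanishes on the part of a linear space where another polynomial, not
identically zero there, does not vanish, is zero on the whole space. -/
lemma eval_eq_zero_of_mul {σ : Type*} {U : Submodule ℂ (σ → ℂ)} {P Q : MvPolynomial σ ℂ}
    (h : ∀ v ∈ U, MvPolynomial.eval v P * MvPolynomial.eval v Q = 0)
    {v₀ : σ → ℂ} (hv₀ : v₀ ∈ U) (hQ : MvPolynomial.eval v₀ Q ≠ 0) :
    ∀ v ∈ U, MvPolynomial.eval v P = 0 := by
  intro v hv
  obtain ⟨p, hp⟩ := exists_polynomial_on_line P v (v₀ - v)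
  obtain ⟨q, hq⟩ := exists_polynomial_on_line Q v (v₀ - v)
  have hpq : p * q = 0 := by
    refine Polynomial.funext fun t => ?_
    rw [Polynomial.eval_mul, hp, hq, Polynomial.eval_zero]
    exact h _ (U.add_mem hv (U.smul_mem t (U.sub_mem hv₀ hv)))
  have hq0 : q ≠ 0 := by
    rintro rfl
    have := hq 1
    simp at this
    exact hQ this.symm
  have hp0 : p = 0 := (mul_eq_zero.1 hpq).resolve_right hq0
  have := hp 0
  simpa [hp0] using this.symm

lemma eval_eq_zero_of_mul_prod {σ ι : Type*} {U : Submodule ℂ (σ → ℂ)} {P : MvPolynomial σ ℂ}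
    (s : Finset ι) (Q : ι → MvPolynomial σ ℂ)
    (h : ∀ v ∈ U, MvPolynomial.eval v P * ∏ i ∈ s, MvPolynomial.eval v (Q i) = 0)
    (hQ : ∀ i ∈ s, ∃ v ∈ U, MvPolynomial.eval v (Q i) ≠ 0) :
    ∀ v ∈ U, MvPolynomial.eval v P = 0 := by
  classical
  induction s using Finset.induction_on generalizing P with
  | empty => simpa using h
  | insert i s hi ih =>
    obtain ⟨v₀, hv₀, h₀⟩ := hQ i (Finset.mem_insert_self _ _)
    refine eval_eq_zero_of_mul (Q := Q i) ?_ hv₀ h₀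
    have := ih (P := P * Q i) ?_ (fun j hj => hQ j (Finset.mem_insert_of_mem hj))
    · simpa using this
    · intro v hv
      have := h v hv
      rw [Finset.prod_insert hi] at this
      rw [map_mul, mul_assoc]
      exact this

/-- Finitely many polynomials, none of which vanishes identically on a linear space, have a common
point of the space where they do not vanish. -/
lemma exists_forall_eval_ne_zero {σ ι : Type*} {U : Submodule ℂ (σ → ℂ)}
    (s : Finset ι) (Q : ι → MvPolynomial σ ℂ)
    (hQ : ∀ i ∈ s, ∃ v ∈ U, MvPolynomial.eval v (Q i) ≠ 0) :
    ∃ v ∈ U, ∀ i ∈ s, MvPolynomial.eval v (Q i) ≠ 0 := by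
  by_contra! hcon
  have := eval_eq_zero_of_mul_prod (U := U) (P := 1) s Q (fun v hv => by
    obtain ⟨i, hi, h0⟩ := hcon v hv
    rw [Finset.prod_eq_zero hi h0, mul_zero]) hQ 0 U.zero_mem
  simp at this

/-- `linForm` as a linear map. -/
def linFormHom (n : ℕ) : (Fin (n + 1) → ℂ) →ₗ[ℂ] Coord n where
  toFun := linForm
  map_add' a b := by simp [linForm, add_mul, Finset.sum_add_distrib]
  map_smul' c a := by
    simp [linForm, MvPolynomial.smul_eq_C_mul, Finset.mul_sum, mul_assoc]

lemma linFormHom_apply (v : Fin (n + 1) → ℂ) : linFormHom n v = linForm v := rfl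

lemma linForm_add (a b : Fin (n + 1) → ℂ) : linForm (a + b) = linForm a + linForm b :=
  (linFormHom n).map_add a b

lemma linForm_smul (c : ℂ) (a : Fin (n + 1) → ℂ) :
    linForm (c • a) = MvPolynomial.C c * linForm a := by
  rw [← linFormHom_apply, map_smul, MvPolynomial.smul_eq_C_mul]
  rfl

lemma linForm_sum {ι : Type*} (s : Finset ι) (a : ι → Fin (n + 1) → ℂ) :
    linForm (∑ i ∈ s, a i) = ∑ i ∈ s, linForm (a i) :=
  map_sum (linFormHom n) a s

@[simp] lemma linForm_zero : linForm (0 : Fin (n + 1) → ℂ) = 0 := (linFormHom n).map_zero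

lemma eval_linForm (v l : Fin (n + 1) → ℂ) :
    MvPolynomial.eval v (linForm l) = l ⬝ᵥ v := by
  simp [linForm, dotProduct]

lemma linForm_single (i : Fin (n + 1)) : linForm (Pi.single i 1) = MvPolynomial.X i := by
  classical
  rw [linForm, Finset.sum_eq_single i]
  · simp
  · intro j _ hj; simp [Pi.single_eq_of_ne hj]
  · simp

lemma isHomogeneous_linForm (l : Fin (n + 1) → ℂ) : (linForm l).IsHomogeneous 1 := by
  refine MvPolynomial.IsHomogeneous.sum _ _ _ fun i _ => ?_
  simpa using (MvPolynomial.isHomogeneous_C _ (l i)).mul (MvPolynomial.isHomogeneous_X ℂ i)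

lemma linForm_injective : Function.Injective (linForm (n := n)) := by
  intro a b h
  ext i
  have := congrArg (MvPolynomial.eval (Pi.single i 1)) h
  simpa [eval_linForm] using this

lemma linForm_ne_zero {l : Fin (n + 1) → ℂ} (hl : l ≠ 0) : linForm l ≠ 0 := by
  rw [← linForm_zero]
  exact fun h => hl (linForm_injective h)

lemma linForm_dvd_sub_aeval (l v₁ : Fin (n + 1) → ℂ) (G : Coord n) :
    linForm l ∣ G - MvPolynomial.aeval
      (fun i => MvPolynomial.X i - linForm l * MvPolynomial.C (v₁ i)) G := by
  rw [← Ideal.mem_span_singleton, ← Ideal.Quotient.eq]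
  have : (Ideal.Quotient.mkₐ ℂ (Ideal.span {linForm l})) =
      (Ideal.Quotient.mkₐ ℂ (Ideal.span {linForm l})).comp (MvPolynomial.aeval
      (fun i => MvPolynomial.X i - linForm l * MvPolynomial.C (v₁ i))) := by
    refine MvPolynomial.algHom_ext fun i => ?_
    simp only [AlgHom.comp_apply, MvPolynomial.aeval_X]
    refine Ideal.Quotient.eq.2 ?_
    rw [Ideal.mem_span_singleton]
    exact ⟨MvPolynomial.C (v₁ i), by ring⟩
  exact DFunLike.congr_fun this G

lemma eval_aeval_sub (l v₁ v : Fin (n + 1) → ℂ) (G : Coord n) :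
    MvPolynomial.eval v (MvPolynomial.aeval
      (fun i => MvPolynomial.X i - linForm l * MvPolynomial.C (v₁ i)) G) =
    MvPolynomial.eval (v - (l ⬝ᵥ v) • v₁) G := by
  rw [MvPolynomial.aeval_def, MvPolynomial.hom_eval₂]
  have : (MvPolynomial.eval v).comp (algebraMap ℂ (Coord n)) = RingHom.id ℂ := by
    ext; simp
  rw [this, MvPolynomial.eval₂_id]
  congr 1
  congr 1
  ext i
  simp [eval_linForm]

/-- A polynomial vanishing where the linear form `l` vanishes on a linear space is there a
multiple of `l`. -/
lemma exists_eval_eq_mul {U : Submodule ℂ (Fin (n + 1) → ℂ)} {l : Fin (n + 1) → ℂ} {G : Coord n}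
    (hl : ∃ v ∈ U, l ⬝ᵥ v ≠ 0) (hG : ∀ v ∈ U, l ⬝ᵥ v = 0 → MvPolynomial.eval v G = 0) :
    ∃ B : Coord n, ∀ v ∈ U, MvPolynomial.eval v G = (l ⬝ᵥ v) * MvPolynomial.eval v B := by
  obtain ⟨v₀, hv₀, h₀⟩ := hl
  -- the substitution `X ↦ X - l(X) v₁`, with `l(v₁) = 1`, moves `U` into the zero set of `l`
  set v₁ := (l ⬝ᵥ v₀)⁻¹ • v₀ with hv₁
  have h₁ : l ⬝ᵥ v₁ = 1 := by rw [hv₁, dotProduct_smul, smul_eq_mul, inv_mul_cancel₀ h₀]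
  obtain ⟨B, hB⟩ := linForm_dvd_sub_aeval l v₁ G
  refine ⟨B, fun v hv => ?_⟩
  have := congrArg (MvPolynomial.eval v) hB
  rw [map_sub, eval_aeval_sub, map_mul, eval_linForm, hG (v - (l ⬝ᵥ v) • v₁)
    (U.sub_mem hv (U.smul_mem _ (U.smul_mem _ hv₀))), sub_zero] at this
  · exact this
  · rw [dotProduct_sub, dotProduct_smul, h₁]; simp

/-- A polynomial vanishing on finitely many distinct hyperplanes of a linear space is there a
multiple of the product of their equations. -/
lemma exists_eval_eq_prod_mul {ι : Type*} {U : Submodule ℂ (Fin (n + 1) → ℂ)} (s : Finset ι)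
    (l : ι → Fin (n + 1) → ℂ) {G : Coord n} (hl : ∀ i ∈ s, ∃ v ∈ U, l i ⬝ᵥ v ≠ 0)
    (hll : ∀ i ∈ s, ∀ j ∈ s, i ≠ j → ∃ v ∈ U, l i ⬝ᵥ v = 0 ∧ l j ⬝ᵥ v ≠ 0)
    (hG : ∀ i ∈ s, ∀ v ∈ U, l i ⬝ᵥ v = 0 → MvPolynomial.eval v G = 0) :
    ∃ B : Coord n, ∀ v ∈ U,
      MvPolynomial.eval v G = (∏ i ∈ s, l i ⬝ᵥ v) * MvPolynomial.eval v B := by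
  classical
  induction s using Finset.induction_on with
  | empty => exact ⟨G, fun v _ => by simp⟩
  | insert i s hi ih =>
    obtain ⟨B, hB⟩ := ih (fun j hj => hl j (Finset.mem_insert_of_mem hj))
      (fun j hj j' hj' => hll j (Finset.mem_insert_of_mem hj) j' (Finset.mem_insert_of_mem hj'))
      (fun j hj => hG j (Finset.mem_insert_of_mem hj))
    have hvan : ∀ v ∈ U, l i ⬝ᵥ v = 0 → MvPolynomial.eval v B = 0 := by
      intro v hv hv0
      let K : Submodule ℂ (Fin (n + 1) → ℂ) :=
        U ⊓ LinearMap.ker (dotProductBilin ℂ ℂ (l i))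
      refine eval_eq_zero_of_mul_prod (U := K) s (fun j => linForm (l j)) (fun u hu => ?_)
        (fun j hj => ?_) v ⟨hv, by simpa using hv0⟩
      · have h1 := hG i (Finset.mem_insert_self _ _) u hu.1 (by simpa using hu.2)
        rw [hB u hu.1] at h1
        simpa [eval_linForm, mul_comm] using h1
      · obtain ⟨u, hu, h0, h1⟩ := hll i (Finset.mem_insert_self _ _) j
          (Finset.mem_insert_of_mem hj) (by rintro rfl; exact hi hj)
        exact ⟨u, ⟨hu, by simpa using h0⟩, by rwa [eval_linForm]⟩
    obtain ⟨B', hB'⟩ := exists_eval_eq_mul (hl i (Finset.mem_insert_self _ _)) hvan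
    exact ⟨B', fun v hv => by rw [hB v hv, hB' v hv, Finset.prod_insert hi]; ring⟩

/-- A polynomial of degree `k` on a linear space that vanishes wherever one of `k` pairwise
non-proportional linear forms vanishes is a constant multiple of the product of these forms. -/
lemma exists_eval_eq_const_mul_prod {ι : Type*} {U : Submodule ℂ (Fin (n + 1) → ℂ)} (s : Finset ι)
    (l : ι → Fin (n + 1) → ℂ) {G : Coord n} (hl : ∀ i ∈ s, ∃ v ∈ U, l i ⬝ᵥ v ≠ 0)
    (hll : ∀ i ∈ s, ∀ j ∈ s, i ≠ j → ∃ v ∈ U, l i ⬝ᵥ v = 0 ∧ l j ⬝ᵥ v ≠ 0)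
    (hG : ∀ i ∈ s, ∀ v ∈ U, l i ⬝ᵥ v = 0 → MvPolynomial.eval v G = 0)
    (hdeg : ∀ (t : ℂ), ∀ v ∈ U,
      MvPolynomial.eval (t • v) G = t ^ s.card * MvPolynomial.eval v G) :
    ∃ ε : ℂ, ∀ v ∈ U, MvPolynomial.eval v G = ε * ∏ i ∈ s, l i ⬝ᵥ v := by
  obtain ⟨B, hB⟩ := exists_eval_eq_prod_mul s l hl hll hG
  refine ⟨MvPolynomial.eval 0 B, fun v hv => ?_⟩
  by_cases h : ∏ i ∈ s, l i ⬝ᵥ v = 0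
  · rw [hB v hv, h]; simp
  · obtain ⟨q, hq⟩ := exists_polynomial_on_line B 0 v
    have hconst : Polynomial.X * (q - Polynomial.C (q.eval 1)) = 0 := by
      refine Polynomial.funext fun t => ?_
      by_cases ht : t = 0
      · simp [ht]
      have h1 := hdeg t v hv
      rw [hB v hv, hB _ (U.smul_mem t hv)] at h1
      simp only [dotProduct_smul, smul_eq_mul, Finset.prod_mul_distrib, Finset.prod_const,
        mul_assoc] at h1
      have h2 := mul_left_cancel₀ h (mul_left_cancel₀ (pow_ne_zero _ ht) h1)
      have h3 := hq t
      have h4 := hq 1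
      simp only [zero_add, one_smul] at h3 h4
      simp [h3, h4, h2]
    have hq' : q = Polynomial.C (q.eval 1) :=
      sub_eq_zero.1 ((mul_eq_zero.1 hconst).resolve_left Polynomial.X_ne_zero)
    have h0 := hq 0
    have h1 := hq 1
    simp only [zero_add, one_smul, zero_smul] at h0 h1
    rw [hq', Polynomial.eval_C, h1] at h0
    rw [hB v hv, h0, mul_comm]

/-- A polynomial in at least two variables whose only possible zero is the origin is constant. -/
lemma eq_C_of_forall_eval_ne_zero (hn : 1 ≤ n) {b : Coord n}
    (hb : ∀ v : Fin (n + 1) → ℂ, v ≠ 0 → MvPolynomial.eval v b ≠ 0) :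
    ∃ c : ℂ, c ≠ 0 ∧ b = MvPolynomial.C c := by
  -- on a line that misses the origin, `b` is a polynomial in one variable without roots
  have step : ∀ v w : Fin (n + 1) → ℂ, (∀ t : ℂ, v + t • w ≠ 0) →
      MvPolynomial.eval v b = MvPolynomial.eval (v + w) b := by
    intro v w h
    obtain ⟨q, hq⟩ := exists_polynomial_on_line b v w
    have hdeg : q.degree = 0 := by
      by_contra hd
      obtain ⟨t, ht⟩ := IsAlgClosed.exists_root q hd
      exact hb _ (h t) (by rw [← hq]; exact ht)
    rw [Polynomial.eq_C_of_degree_eq_zero hdeg] at hq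
    have h0 := hq 0
    have h1 := hq 1
    simp only [Polynomial.eval_C, zero_smul, add_zero, one_smul] at h0 h1
    rw [← h0, ← h1]
  have key : ∀ v w : Fin (n + 1) → ℂ, LinearIndependent ℂ ![v, w] →
      MvPolynomial.eval v b = MvPolynomial.eval w b := by
    intro v w h
    rw [LinearIndependent.pair_iff] at h
    rw [step v w, step w v, add_comm w v]
    · intro t ht
      have := h t 1 (by rw [one_smul, add_comm (t • v) w]; exact ht)
      simp at this
    · intro t ht
      have := h 1 t (by rw [one_smul]; exact ht)
      simp at this
  let e : Fin (n + 1) → Fin (n + 1) → ℂ := fun i => Pi.single i 1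
  have h01 : (0 : Fin (n + 1)) ≠ Fin.last n := by
    intro h
    have := congrArg Fin.val h
    simp at this
    omega
  have he : ∀ v : Fin (n + 1) → ℂ, v ≠ 0 → MvPolynomial.eval v b = MvPolynomial.eval (e 0) b := by
    intro v hv
    by_cases h : LinearIndependent ℂ ![v, e 0]
    · exact key _ _ h
    · have h1 : ∃ c : ℂ, v = c • e 0 := by
        rw [LinearIndependent.pair_iff] at h
        push Not at h
        obtain ⟨s, t, hst, h⟩ := h
        have hs : s ≠ 0 := by
          rintro rfl
          have h2 : t = 0 := by
            have := congrFun hst 0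
            simpa [e] using this
          exact h rfl h2
        refine ⟨-(s⁻¹ * t), ?_⟩
        have h3 : s • v = -(t • e 0) := eq_neg_of_add_eq_zero_left hst
        calc v = s⁻¹ • (s • v) := by rw [smul_smul, inv_mul_cancel₀ hs, one_smul]
          _ = _ := by rw [h3, smul_neg, smul_smul, neg_smul]
      obtain ⟨c, rfl⟩ := h1
      have hc : c ≠ 0 := by rintro rfl; simp at hv
      rw [key (c • e 0) (e (Fin.last n)), key (e 0) (e (Fin.last n))]
      · rw [LinearIndependent.pair_iff]
        intro s t hst
        have h0 := congrFun hst 0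
        have h1 := congrFun hst (Fin.last n)
        simp [e, h01, h01.symm] at h0 h1
        exact ⟨h0, h1⟩
      · rw [LinearIndependent.pair_iff]
        intro s t hst
        have h0 := congrFun hst 0
        have h1 := congrFun hst (Fin.last n)
        simp [e, h01, h01.symm, hc] at h0 h1
        exact ⟨h0, h1⟩
  refine ⟨MvPolynomial.eval (e 0) b, hb _ (by simp [e]), ?_⟩
  refine MvPolynomial.funext_set (fun _ => {0}ᶜ) (fun _ => (Set.finite_singleton _).infinite_compl)
    fun v hv => ?_
  rw [MvPolynomial.eval_C]
  refine he v ?_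
  rintro rfl
  exact hv 0 (Set.mem_univ _) rfl

end Polynomials

/-! ### Values and orders of homogeneous fractions -/

section Values

variable {n : ℕ}

/-- The rational function `x` on affine space is regular at `v`, with value `c` there. -/
def HasVal (v : Fin (n + 1) → ℂ) (x : ConeField n) (c : ℂ) : Prop :=
  ∃ a b : Coord n, MvPolynomial.eval v b ≠ 0 ∧ x * toCone b = toCone a ∧
    MvPolynomial.eval v a = c * MvPolynomial.eval v b

lemma toCone_injective : Function.Injective (toCone (n := n)) :=
  IsFractionRing.injective (Coord n) (ConeField n)

lemma toCone_ne_zero {a : Coord n} (ha : a ≠ 0) : toCone a ≠ 0 :=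
  fun h => ha (toCone_injective (by simpa using h))

lemma ne_zero_of_eval_ne_zero {v : Fin (n + 1) → ℂ} {a : Coord n}
    (h : MvPolynomial.eval v a ≠ 0) : a ≠ 0 := by
  rintro rfl
  simp at h

namespace HasVal

variable {v : Fin (n + 1) → ℂ} {x y : ConeField n} {c d : ℂ}

lemma unique (h : HasVal v x c) (h' : HasVal v x d) : c = d := by
  obtain ⟨a, b, hb, hx, hc⟩ := h
  obtain ⟨a', b', hb', hx', hc'⟩ := h'
  have : a * b' = a' * b := toCone_injective (by
    simp only [toCone, map_mul] at hx hx' ⊢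
    rw [← hx, ← hx']; ring)
  have h2 := congrArg (MvPolynomial.eval v) this
  rw [map_mul, map_mul, hc, hc'] at h2
  have : c * (MvPolynomial.eval v b * MvPolynomial.eval v b') =
      d * (MvPolynomial.eval v b * MvPolynomial.eval v b') := by linear_combination h2
  exact mul_right_cancel₀ (mul_ne_zero hb hb') this

lemma of_poly (v : Fin (n + 1) → ℂ) (a : Coord n) : HasVal v (toCone a) (MvPolynomial.eval v a) :=
  ⟨a, 1, by simp, by simp [toCone], by simp⟩

lemma linForm (v l : Fin (n + 1) → ℂ) : HasVal v (toCone (linForm l)) (l ⬝ᵥ v) := by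
  rw [← eval_linForm]; exact of_poly v _

lemma const (v : Fin (n + 1) → ℂ) (c : ℂ) : HasVal v (algebraMap ℂ (ConeField n) c) c := by
  have := of_poly v (MvPolynomial.C c)
  rw [MvPolynomial.eval_C] at this
  rwa [IsScalarTower.algebraMap_apply ℂ (Coord n) (ConeField n)]

lemma zero (v : Fin (n + 1) → ℂ) : HasVal v 0 0 := by simpa using const v 0

lemma add (h : HasVal v x c) (h' : HasVal v y d) : HasVal v (x + y) (c + d) := by
  obtain ⟨a, b, hb, hx, hc⟩ := h
  obtain ⟨a', b', hb', hx', hc'⟩ := h'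
  refine ⟨a * b' + a' * b, b * b', by rw [map_mul]; exact mul_ne_zero hb hb', ?_, ?_⟩
  · simp only [toCone, map_mul, map_add] at hx hx' ⊢
    rw [← hx, ← hx']; ring
  · simp only [map_mul, map_add, hc, hc']; ring

lemma mul (h : HasVal v x c) (h' : HasVal v y d) : HasVal v (x * y) (c * d) := by
  obtain ⟨a, b, hb, hx, hc⟩ := h
  obtain ⟨a', b', hb', hx', hc'⟩ := h'
  refine ⟨a * a', b * b', by rw [map_mul]; exact mul_ne_zero hb hb', ?_, ?_⟩
  · simp only [toCone, map_mul] at hx hx' ⊢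
    rw [← hx, ← hx']; ring
  · simp only [map_mul, hc, hc']; ring

lemma sum {ι : Type*} {s : Finset ι} {x : ι → ConeField n} {c : ι → ℂ}
    (h : ∀ i ∈ s, HasVal v (x i) (c i)) : HasVal v (∑ i ∈ s, x i) (∑ i ∈ s, c i) := by
  classical
  induction s using Finset.induction_on with
  | empty => simpa using zero v
  | insert i s hi ih =>
    rw [Finset.sum_insert hi, Finset.sum_insert hi]
    exact (h i (Finset.mem_insert_self _ _)).add (ih fun j hj => h j (Finset.mem_insert_of_mem hj))

lemma of_div {a b : Coord n} (hb : MvPolynomial.eval v b ≠ 0) :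
    HasVal v (toCone a / toCone b) (MvPolynomial.eval v a / MvPolynomial.eval v b) :=
  ⟨a, b, hb, div_mul_cancel₀ _ (toCone_ne_zero (ne_zero_of_eval_ne_zero hb)),
    (div_mul_cancel₀ _ hb).symm⟩

end HasVal

/-- The fraction `x` is a section of `O(d)` near the point `p`: it is a quotient of homogeneous
polynomials whose degrees differ by `d`, and the denominator does not vanish at `p`. -/
def RegAt (d : ℕ) (p : Point n) (x : ConeField n) : Prop :=
  ∃ (e : ℕ) (a b : Coord n), a.IsHomogeneous (e + d) ∧ b.IsHomogeneous e ∧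
    MvPolynomial.eval p.rep b ≠ 0 ∧ x = toCone a / toCone b

lemma mem_localRing_iff {p : Point n} {f : FunField n} :
    f ∈ localRing p ↔ RegAt 0 p f.val := Iff.rfl

namespace RegAt

variable {p : Point n} {x y : ConeField n} {d e : ℕ}

lemma of_isHomogeneous (p : Point n) {a : Coord n} (ha : a.IsHomogeneous d) :
    RegAt d p (toCone a) :=
  ⟨0, a, 1, by simpa using ha, MvPolynomial.isHomogeneous_one _ _, by simp, by simp [toCone]⟩

lemma linForm (p : Point n) (l : Fin (n + 1) → ℂ) : RegAt 1 p (toCone (linForm l)) :=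
  of_isHomogeneous p (isHomogeneous_linForm l)

lemma const (p : Point n) (c : ℂ) : RegAt 0 p (algebraMap ℂ (ConeField n) c) := by
  have := of_isHomogeneous p (MvPolynomial.isHomogeneous_C (Fin (n + 1)) c)
  rwa [IsScalarTower.algebraMap_apply ℂ (Coord n) (ConeField n)]

lemma zero (p : Point n) (d : ℕ) : RegAt d p 0 := by
  have := of_isHomogeneous p (MvPolynomial.isHomogeneous_zero (Fin (n + 1)) ℂ d)
  simpa [toCone] using this

lemma mul (hx : RegAt d p x) (hy : RegAt e p y) : RegAt (d + e) p (x * y) := by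
  obtain ⟨i, a, b, ha, hb, hp, rfl⟩ := hx
  obtain ⟨j, a', b', ha', hb', hp', rfl⟩ := hy
  refine ⟨i + j, a * a', b * b', ?_, hb.mul hb', by rw [map_mul]; exact mul_ne_zero hp hp', ?_⟩
  · convert ha.mul ha' using 1; ring
  · simp only [toCone, map_mul, div_mul_div_comm]

lemma add (hx : RegAt d p x) (hy : RegAt d p y) : RegAt d p (x + y) := by
  obtain ⟨i, a, b, ha, hb, hp, rfl⟩ := hx
  obtain ⟨j, a', b', ha', hb', hp', rfl⟩ := hy
  refine ⟨i + j, a * b' + b * a', b * b', ?_, hb.mul hb',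
    by rw [map_mul]; exact mul_ne_zero hp hp', ?_⟩
  · refine MvPolynomial.IsHomogeneous.add ?_ ?_
    · convert ha.mul hb' using 1; ring
    · convert hb.mul ha' using 1; ring
  · simp only [toCone, map_mul, map_add]
    rw [div_add_div _ _ (toCone_ne_zero (ne_zero_of_eval_ne_zero hp))
      (toCone_ne_zero (ne_zero_of_eval_ne_zero hp'))]

lemma sum {ι : Type*} {s : Finset ι} {x : ι → ConeField n}
    (h : ∀ i ∈ s, RegAt d p (x i)) : RegAt d p (∑ i ∈ s, x i) := by
  classical
  induction s using Finset.induction_on with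
  | empty => simpa using zero p d
  | insert i s hi ih =>
    rw [Finset.sum_insert hi]
    exact (h i (Finset.mem_insert_self _ _)).add (ih fun j hj => h j (Finset.mem_insert_of_mem hj))

lemma div_linForm {l : Fin (n + 1) → ℂ} (hx : RegAt (d + 1) p x) (hl : l ⬝ᵥ p.rep ≠ 0) :
    RegAt d p (x / toCone (PnBundle.linForm l)) := by
  obtain ⟨i, a, b, ha, hb, hp, rfl⟩ := hx
  refine ⟨i + 1, a, b * PnBundle.linForm l, ?_, hb.mul (isHomogeneous_linForm l), ?_, ?_⟩
  · convert ha using 1; ring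
  · rw [map_mul, eval_linForm]; exact mul_ne_zero hp hl
  · simp only [toCone, map_mul, div_div]

lemma exists_hasVal (hx : RegAt d p x) : ∃ c, HasVal p.rep x c := by
  obtain ⟨i, a, b, ha, hb, hp, rfl⟩ := hx
  exact ⟨_, HasVal.of_div hp⟩

end RegAt

lemma exists_smul_rep {v : Fin (n + 1) → ℂ} (hv : v ≠ 0) :
    ∃ p : Point n, ∃ c : ℂ, c ≠ 0 ∧ p.rep = c • v := by
  obtain ⟨a, ha⟩ := Projectivization.exists_smul_eq_mk_rep ℂ v hv
  exact ⟨Projectivization.mk ℂ v hv, a, a.ne_zero, ha.symm⟩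

/-- A section of `O(d)` over the whole projective space is a polynomial of degree `d`. -/
lemma exists_eq_toCone_of_regAt (hn : 1 ≤ n) {d : ℕ} {x : ConeField n} (h : ∀ p, RegAt d p x) :
    ∃ G : Coord n, x = toCone G ∧
      ∀ (t : ℂ) (v : Fin (n + 1) → ℂ),
        MvPolynomial.eval (t • v) G = t ^ d * MvPolynomial.eval v G := by
  obtain ⟨a, b, hrel, hab⟩ := IsFractionRing.exists_reduced_fraction (A := Coord n) x
  have hb0 : toCone (b : Coord n) ≠ 0 := toCone_ne_zero (nonZeroDivisors.ne_zero b.2)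
  have hxab : x * toCone (b : Coord n) = toCone a := by
    rw [← hab]; exact IsLocalization.mk'_spec _ _ _
  -- a zero of the reduced denominator is a zero of every denominator
  have hne : ∀ v : Fin (n + 1) → ℂ, v ≠ 0 → MvPolynomial.eval v (b : Coord n) ≠ 0 := by
    intro v hv h0
    obtain ⟨p, c, hc, hpc⟩ := exists_smul_rep hv
    obtain ⟨e, a', b', ha', hb', hp, hx⟩ := h p
    have hb0' := toCone_ne_zero (ne_zero_of_eval_ne_zero hp)
    have h1 : a * b' = a' * b := toCone_injective (by
      rw [hx] at hxab
      simp only [toCone, map_mul] at hxab ⊢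
      rw [← hxab]
      field_simp)
    have h2 : (b : Coord n) ∣ b' := hrel.symm.dvd_of_dvd_mul_left ⟨a', by rw [h1]; ring⟩
    obtain ⟨q, rfl⟩ := h2
    rw [hpc, eval_smul_of_isHomogeneous hb', map_mul, h0] at hp
    simp at hp
  obtain ⟨c, hc, hbc⟩ := eq_C_of_forall_eval_ne_zero hn hne
  obtain ⟨G, hG⟩ : ∃ G : Coord n, G = MvPolynomial.C c⁻¹ * a := ⟨_, rfl⟩
  have hxG : x = toCone G := by
    have h1 : toCone G * toCone (b : Coord n) = toCone a := by
      rw [hbc, hG]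
      simp only [toCone, ← map_mul]
      congr 1
      rw [mul_right_comm, ← MvPolynomial.C_mul, inv_mul_cancel₀ hc, MvPolynomial.C_1, one_mul]
    rw [← hxab] at h1
    exact (mul_right_cancel₀ hb0 h1).symm
  have hhom : ∀ (t : ℂ) (v : Fin (n + 1) → ℂ), t ≠ 0 → v ≠ 0 →
      MvPolynomial.eval (t • v) G = t ^ d * MvPolynomial.eval v G := by
    intro t v ht hv
    obtain ⟨p, c, hc, hpc⟩ := exists_smul_rep hv
    obtain ⟨e, a', b', ha', hb', hp, hx⟩ := h p
    have hb0' := toCone_ne_zero (ne_zero_of_eval_ne_zero hp)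
    have h1 : G * b' = a' := toCone_injective (by
      rw [hxG] at hx
      simp only [toCone, map_mul] at hx ⊢
      rw [hx, div_mul_cancel₀ _ hb0'])
    have hbv : MvPolynomial.eval v b' ≠ 0 := by
      rw [hpc, eval_smul_of_isHomogeneous hb'] at hp
      exact right_ne_zero_of_mul hp
    have h2 := congrArg (MvPolynomial.eval v) h1
    have h3 := congrArg (MvPolynomial.eval (t • v)) h1
    rw [map_mul] at h2
    rw [map_mul, eval_smul_of_isHomogeneous hb', eval_smul_of_isHomogeneous ha', ← h2,
      pow_add] at h3
    have h4 : (t ^ e * MvPolynomial.eval v b') * MvPolynomial.eval (t • v) G =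
        (t ^ e * MvPolynomial.eval v b') * (t ^ d * MvPolynomial.eval v G) := by
      linear_combination h3
    exact mul_left_cancel₀ (mul_ne_zero (pow_ne_zero _ ht) hbv) h4
  -- both sides are polynomials in `t`, so `t = 0` needs no separate argument
  have hhom' : ∀ (t : ℂ) (v : Fin (n + 1) → ℂ), v ≠ 0 →
      MvPolynomial.eval (t • v) G = t ^ d * MvPolynomial.eval v G := by
    intro t v hv
    obtain ⟨q, hq⟩ := exists_polynomial_on_line G 0 v
    have : Polynomial.X * (q - Polynomial.C (MvPolynomial.eval v G) * Polynomial.X ^ d) = 0 := by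
      refine Polynomial.funext fun s => ?_
      by_cases hs : s = 0
      · simp [hs]
      have := hhom s v hs hv
      have h2 := hq s
      rw [zero_add] at h2
      rw [Polynomial.eval_mul, Polynomial.eval_sub, h2, this]
      simp only [Polynomial.eval_X, Polynomial.eval_mul, Polynomial.eval_C, Polynomial.eval_pow,
        Polynomial.eval_zero]
      ring
    have := sub_eq_zero.1 ((mul_eq_zero.1 this).resolve_left Polynomial.X_ne_zero)
    have h2 := hq t
    rw [this, zero_add] at h2
    rw [← h2]
    simp only [Polynomial.eval_X, Polynomial.eval_mul, Polynomial.eval_C, Polynomial.eval_pow]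
    ring
  refine ⟨G, hxG, fun t v => ?_⟩
  by_cases hv : v = 0
  · subst hv
    rw [smul_zero]
    rcases Nat.eq_zero_or_pos d with rfl | hd
    · simp
    · have h1 := hhom' 0 (Pi.single 0 1) (by simp)
      rw [zero_smul, zero_pow hd.ne', zero_mul] at h1
      rw [h1, mul_zero]
  · exact hhom' t v hv

/-- A rational function that is regular everywhere is constant. -/
lemma exists_eq_const_of_regAt (hn : 1 ≤ n) {x : ConeField n} (h : ∀ p, RegAt 0 p x) :
    ∃ c : ℂ, x = algebraMap ℂ (ConeField n) c := by
  obtain ⟨G, rfl, hG⟩ := exists_eq_toCone_of_regAt hn h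
  refine ⟨MvPolynomial.eval 0 G, ?_⟩
  have : G = MvPolynomial.C (MvPolynomial.eval 0 G) := by
    refine MvPolynomial.funext fun v => ?_
    have := hG 0 v
    rw [zero_smul, pow_zero, one_mul] at this
    rw [MvPolynomial.eval_C, this]
  rw [IsScalarTower.algebraMap_apply ℂ (Coord n) (ConeField n)]
  exact congrArg toCone this

end Values

/-! ### Quotients of linear forms and their logarithmic differentials -/

section LogDifferentials

variable {n : ℕ}

lemma val_injective : Function.Injective (FunField.val (n := n)) := Subtype.val_injective

lemma div_linForm_mem (l m : Fin (n + 1) → ℂ) :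
    toCone (linForm l) / toCone (linForm m) ∈ degreeZero n := by
  by_cases hm : linForm m = 0
  · have : toCone (0 : Coord n) = 0 := map_zero _
    rw [hm, this, div_zero]; exact zero_mem _
  · exact ⟨1, _, _, isHomogeneous_linForm l, isHomogeneous_linForm m, hm, rfl⟩

/-- The rational function `l / m` for two linear forms `l`, `m`, given by their coefficients. -/
def lin (l m : Fin (n + 1) → ℂ) : FunField n :=
  (⟨toCone (linForm l) / toCone (linForm m), div_linForm_mem l m⟩ : degreeZero n)

lemma val_lin (l m : Fin (n + 1) → ℂ) :
    (lin l m).val = toCone (linForm l) / toCone (linForm m) := rfl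

lemma toCone_linForm_ne_zero {l : Fin (n + 1) → ℂ} (hl : l ≠ 0) : toCone (linForm l) ≠ 0 :=
  toCone_ne_zero (linForm_ne_zero hl)

lemma lin_mul_lin (l q : Fin (n + 1) → ℂ) {m : Fin (n + 1) → ℂ} (hm : m ≠ 0) :
    lin l m * lin m q = lin l q := by
  apply val_injective
  rw [map_mul, val_lin, val_lin, val_lin, div_mul_div_cancel₀ (toCone_linForm_ne_zero hm)]

lemma lin_self {m : Fin (n + 1) → ℂ} (hm : m ≠ 0) : lin m m = 1 := by
  apply val_injective
  rw [val_lin, map_one, div_self (toCone_linForm_ne_zero hm)]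

lemma lin_inv (l m : Fin (n + 1) → ℂ) : (lin l m)⁻¹ = lin m l := by
  apply val_injective
  rw [map_inv₀, val_lin, val_lin, inv_div]

lemma lin_ne_zero {l m : Fin (n + 1) → ℂ} (hl : l ≠ 0) (hm : m ≠ 0) : lin l m ≠ 0 := by
  intro h
  have := lin_mul_lin l l hm
  rw [h, zero_mul, lin_self hl] at this
  exact zero_ne_one this

/-- `l ↦ l / m` as a linear map. -/
def linHom (m : Fin (n + 1) → ℂ) : (Fin (n + 1) → ℂ) →ₗ[ℂ] FunField n where
  toFun l := lin l m
  map_add' a b := by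
    apply val_injective
    simp only [map_add, val_lin, linForm_add, toCone, add_div]
  map_smul' c a := by
    apply val_injective
    rw [RingHom.id_apply, map_smul, val_lin, val_lin, linForm_smul, toCone, map_mul, mul_div_assoc,
      Algebra.smul_def, IsScalarTower.algebraMap_apply ℂ (Coord n) (ConeField n)]
    rfl

lemma linHom_apply (l m : Fin (n + 1) → ℂ) : linHom m l = lin l m := rfl

lemma lin_mem_localRing (l : Fin (n + 1) → ℂ) {m : Fin (n + 1) → ℂ} {p : Point n}
    (hm : m ⬝ᵥ p.rep ≠ 0) : lin l m ∈ localRing p :=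
  (RegAt.linForm p l).div_linForm (d := 0) hm

/-- The logarithmic differential `df / f` of `f = l / m`. -/
def lg (l m : Fin (n + 1) → ℂ) : Ω[FunField n⁄ℂ] :=
  (lin l m)⁻¹ • KaehlerDifferential.D ℂ (FunField n) (lin l m)

lemma D_lin {l m : Fin (n + 1) → ℂ} (hl : l ≠ 0) (hm : m ≠ 0) :
    KaehlerDifferential.D ℂ (FunField n) (lin l m) = lin l m • lg l m := by
  rw [lg, smul_smul, mul_inv_cancel₀ (lin_ne_zero hl hm), one_smul]

lemma lg_add_lg {l m q : Fin (n + 1) → ℂ} (hl : l ≠ 0) (hm : m ≠ 0) (hq : q ≠ 0) :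
    lg l m + lg m q = lg l q := by
  have h1 := lin_ne_zero hl hm
  have h2 := lin_ne_zero hm hq
  rw [lg, lg, lg, ← lin_mul_lin l q hm, Derivation.leibniz, smul_add, smul_smul, smul_smul,
    add_comm]
  congr 2 <;> field_simp

lemma lg_self {l : Fin (n + 1) → ℂ} (hl : l ≠ 0) : lg l l = 0 := by
  rw [lg, lin_self hl, Derivation.map_one_eq_zero, smul_zero]

/-- The logarithmic differential of a sum of linear forms. -/
lemma lg_eq_sum {ι : Type*} (s : Finset ι) {x : ι → Fin (n + 1) → ℂ} (hx : ∀ i ∈ s, x i ≠ 0)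
    (c : ι → ℂ) {l m : Fin (n + 1) → ℂ} (hl : l = ∑ i ∈ s, c i • x i) (hm : m ≠ 0) :
    lg l m = ∑ i ∈ s, c i • (lin (x i) l • lg (x i) m) := by
  have h1 : lin l m = ∑ i ∈ s, c i • lin (x i) m := by
    rw [← linHom_apply, hl, map_sum]
    simp only [map_smul, linHom_apply]
  have h2 : KaehlerDifferential.D ℂ (FunField n) (lin l m) =
      ∑ i ∈ s, c i • (lin (x i) m • lg (x i) m) := by
    rw [h1, map_sum]
    refine Finset.sum_congr rfl fun i hi => ?_
    rw [Derivation.map_smul, D_lin (hx i hi) hm]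
  rw [lg, h2, lin_inv, Finset.smul_sum]
  refine Finset.sum_congr rfl fun i hi => ?_
  rw [smul_comm, smul_smul, mul_comm, lin_mul_lin _ _ hm]

end LogDifferentials

/-! ### Generators of the stalks of the sheaf of logarithmic differentials -/

section Stalks

variable {n : ℕ} {ι : Type*}

/-- The germs at `p` generated by the logarithmic differentials of the quotients `f i / f j`. -/
def lgSpan (f : ι → Fin (n + 1) → ℂ) (p : Point n) :
    Submodule (localRing p) (Ω[FunField n⁄ℂ]) :=
  Submodule.span (localRing p) (Set.range fun ij : ι × ι => lg (f ij.1) (f ij.2))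

lemma lg_mem_lgSpan (f : ι → Fin (n + 1) → ℂ) (p : Point n) (i j : ι) :
    lg (f i) (f j) ∈ lgSpan f p :=
  Submodule.subset_span ⟨(i, j), rfl⟩

lemma smul_mem_of_mem_localRing {p : Point n} {M : Type*} [AddCommGroup M] [Module (FunField n) M]
    (N : Submodule (localRing p) M) {f : FunField n} (hf : f ∈ localRing p) {x : M} (hx : x ∈ N) :
    f • x ∈ N :=
  N.smul_mem ⟨f, hf⟩ hx

lemma complex_smul_mem {p : Point n} {M : Type*} [AddCommGroup M] [Module (FunField n) M]
    [Module ℂ M] [IsScalarTower ℂ (FunField n) M]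
    (N : Submodule (localRing p) M) (c : ℂ) {x : M} (hx : x ∈ N) : c • x ∈ N := by
  rw [← algebraMap_smul (FunField n) c x]
  exact smul_mem_of_mem_localRing N ((localRing p).algebraMap_mem c) hx

/-- The regular functions at `p` whose differentials lie in a module of germs of differentials. -/
def regularWithDifferentialIn (p : Point n) (N : Submodule (localRing p) (Ω[FunField n⁄ℂ])) :
    Subalgebra ℂ (FunField n) where
  carrier := {f | f ∈ localRing p ∧ KaehlerDifferential.D ℂ (FunField n) f ∈ N}
  mul_mem' := by
    rintro f g ⟨hf, hf'⟩ ⟨hg, hg'⟩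
    refine ⟨mul_mem hf hg, ?_⟩
    rw [Derivation.leibniz]
    exact add_mem (smul_mem_of_mem_localRing N hf hg') (smul_mem_of_mem_localRing N hg hf')
  add_mem' := by
    rintro f g ⟨hf, hf'⟩ ⟨hg, hg'⟩
    refine ⟨add_mem hf hg, ?_⟩
    rw [map_add]
    exact add_mem hf' hg'
  algebraMap_mem' c := by
    refine ⟨(localRing p).algebraMap_mem c, ?_⟩
    rw [Derivation.map_algebraMap]
    exact zero_mem _

lemma inv_mem_regularWithDifferentialIn {p : Point n}
    {N : Submodule (localRing p) (Ω[FunField n⁄ℂ])} {f : FunField n}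
    (hf : f ∈ regularWithDifferentialIn p N) (hf' : f⁻¹ ∈ localRing p) :
    f⁻¹ ∈ regularWithDifferentialIn p N := by
  refine ⟨hf', ?_⟩
  rw [Derivation.leibniz_inv]
  exact smul_mem_of_mem_localRing N (neg_mem (pow_mem hf' 2)) hf.2

lemma val_aeval_lin {a : Coord n} {d : ℕ} (ha : a.IsHomogeneous d) {m : Fin (n + 1) → ℂ}
    (hm : m ≠ 0) :
    (MvPolynomial.aeval (fun i => lin (Pi.single i 1) m) a).val =
      toCone a / toCone (linForm m) ^ d := by
  have h := aeval_mul_of_isHomogeneous ha (toCone (linForm m))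
    (fun i => (lin (Pi.single i 1) m).val)
  have h1 : (fun i => toCone (linForm m) * (lin (Pi.single i 1) m).val) =
      fun i => algebraMap (Coord n) (ConeField n) (MvPolynomial.X i) := by
    funext i
    rw [val_lin, mul_div_cancel₀ _ (toCone_linForm_ne_zero hm), linForm_single]
  have h2 : MvPolynomial.aeval (fun i => algebraMap (Coord n) (ConeField n) (MvPolynomial.X i)) a =
      toCone a := by
    have := MvPolynomial.aeval_algebraMap_apply (ConeField n)
      (MvPolynomial.X : Fin (n + 1) → Coord n) a
    rw [MvPolynomial.aeval_X_left_apply] at this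
    exact this
  rw [h1, h2] at h
  rw [h, mul_div_cancel_left₀ _ (pow_ne_zero _ (toCone_linForm_ne_zero hm))]
  exact (MvPolynomial.map_aeval _ _ _).trans (by
    rw [MvPolynomial.aeval_def, MvPolynomial.coe_eval₂Hom]
    congr 1)

lemma exists_dotProduct_ne_zero {f : ι → Fin (n + 1) → ℂ}
    (hspan : Submodule.span ℂ (Set.range f) = ⊤) {v : Fin (n + 1) → ℂ} (hv : v ≠ 0) :
    ∃ i, f i ⬝ᵥ v ≠ 0 := by
  by_contra! h
  have : ∀ l ∈ Submodule.span ℂ (Set.range f), l ⬝ᵥ v = 0 := by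
    intro l hl
    induction hl using Submodule.span_induction with
    | mem x hx => obtain ⟨i, rfl⟩ := hx; exact h i
    | zero => simp
    | add x y _ _ hx hy => rw [add_dotProduct, hx, hy, add_zero]
    | smul c x _ hx => rw [smul_dotProduct, hx, smul_zero]
  rw [hspan] at this
  refine hv (funext fun i => ?_)
  simpa using this (Pi.single i 1) trivial

/-- The differential of a regular function is a combination of the logarithmic differentials: a
regular function is a quotient of polynomials in the quotients of linear forms. -/
lemma D_mem_lgSpan {f : ι → Fin (n + 1) → ℂ} (hf : ∀ i, f i ≠ 0)
    (hspan : Submodule.span ℂ (Set.range f) = ⊤) {p : Point n} {u : FunField n}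
    (hu : u ∈ localRing p) : KaehlerDifferential.D ℂ (FunField n) u ∈ lgSpan f p := by
  obtain ⟨o, ho⟩ := exists_dotProduct_ne_zero hspan p.rep_nonzero
  set T := regularWithDifferentialIn p (lgSpan f p) with hT
  have hlin : ∀ l, lin l (f o) ∈ T := by
    intro l
    have hl : l ∈ Submodule.span ℂ (Set.range f) := by rw [hspan]; trivial
    induction hl using Submodule.span_induction with
    | mem x hx =>
      obtain ⟨i, rfl⟩ := hx
      refine ⟨lin_mem_localRing _ ho, ?_⟩
      rw [D_lin (hf i) (hf o)]
      exact smul_mem_of_mem_localRing _ (lin_mem_localRing _ ho) (lg_mem_lgSpan f p i o)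
    | zero => rw [← linHom_apply, map_zero]; exact zero_mem _
    | add x y _ _ hx hy => rw [← linHom_apply, map_add]; exact add_mem hx hy
    | smul c x _ hx => rw [← linHom_apply, map_smul]; exact T.smul_mem hx c
  have haev : ∀ a : Coord n, MvPolynomial.aeval (fun i => lin (Pi.single i 1) (f o)) a ∈ T := by
    intro a
    have h1 : MvPolynomial.aeval (fun i => lin (Pi.single i 1) (f o)) a ∈
        Algebra.adjoin ℂ (Set.range fun i => lin (Pi.single i 1) (f o)) := by
      rw [← MvPolynomial.aeval_range]
      exact ⟨a, rfl⟩
    refine Algebra.adjoin_le ?_ h1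
    rintro _ ⟨i, rfl⟩
    exact hlin _
  obtain ⟨d, a, b, ha, hb, hp, huv⟩ := hu
  have hm := toCone_linForm_ne_zero (hf o)
  have hb0 := toCone_ne_zero (ne_zero_of_eval_ne_zero hp)
  have hB : (MvPolynomial.aeval (fun i => lin (Pi.single i 1) (f o)) b)⁻¹ ∈ T := by
    refine inv_mem_regularWithDifferentialIn (haev b) ⟨d, linForm (f o) ^ d, b, ?_, hb, hp, ?_⟩
    · simpa using (isHomogeneous_linForm (f o)).pow d
    · have : toCone (linForm (f o) ^ d) = toCone (linForm (f o)) ^ d := map_pow _ _ _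
      rw [map_inv₀, val_aeval_lin hb (hf o), inv_div, this]
  have : u = MvPolynomial.aeval (fun i => lin (Pi.single i 1) (f o)) a *
      (MvPolynomial.aeval (fun i => lin (Pi.single i 1) (f o)) b)⁻¹ := by
    apply val_injective
    rw [map_mul, map_inv₀, val_aeval_lin ha (hf o), val_aeval_lin hb (hf o), huv]
    field_simp
  rw [this]
  exact (mul_mem (haev a) hB).2

/-- The stalks of `Ω(log ℋ)` are generated by the differentials `d log (f i / f j)`, where the
`f i` are the equations of the hyperplanes in `ℋ`. -/
lemma logForms_eq_lgSpan {ℋ : Finset (Hyperplane n)} {f : ι → Fin (n + 1) → ℂ}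
    (h1 : ∀ H ∈ ℋ, ∃ i, H.rep = f i) (h2 : ∀ i, ∃ H ∈ ℋ, Projectivization.rep H = f i)
    (hspan : Submodule.span ℂ (Set.range f) = ⊤) (p : Point n) :
    logForms ℋ p = lgSpan f p := by
  have hf : ∀ i, f i ≠ 0 := by
    intro i
    obtain ⟨H, _, h⟩ := h2 i
    rw [← h]; exact H.rep_nonzero
  obtain ⟨o, ho⟩ := exists_dotProduct_ne_zero hspan p.rep_nonzero
  refine le_antisymm (Submodule.span_le.2 ?_) (Submodule.span_le.2 ?_)
  · rintro ω (⟨u, rfl⟩ | ⟨H, hH, u, ⟨m, hm, hu⟩, rfl⟩)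
    · exact D_mem_lgSpan hf hspan u.2
    · obtain ⟨i, hi⟩ := h1 H hH
      rw [eval_linForm] at hm
      have hm0 : m ≠ 0 := by rintro rfl; simp at hm
      have : (u : FunField n) = lin (f i) m := val_injective (by rw [hu, hi, val_lin])
      rw [this]
      change lg (f i) m ∈ lgSpan f p
      rw [← lg_add_lg (hf i) (hf o) hm0]
      refine add_mem (lg_mem_lgSpan _ _ _ _) ?_
      rw [lg, lin_inv]
      exact smul_mem_of_mem_localRing _ (lin_mem_localRing _ ho)
        (D_mem_lgSpan hf hspan (lin_mem_localRing _ hm))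
  · rintro _ ⟨⟨i, j⟩, rfl⟩
    have key : ∀ i, lg (f i) (f o) ∈ logForms ℋ p := by
      intro i
      obtain ⟨H, hH, hi⟩ := h2 i
      refine Submodule.subset_span (Or.inr ⟨H, hH, ⟨lin (f i) (f o), lin_mem_localRing _ ho⟩,
        ⟨f o, by rwa [eval_linForm], ?_⟩, rfl⟩)
      rw [hi]; rfl
    have h3 := lg_add_lg (hf i) (hf j) (hf o)
    change lg (f i) (f j) ∈ logForms ℋ p
    rw [← eq_sub_iff_add_eq] at h3
    rw [h3]
    exact sub_mem (key i) (key j)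

end Stalks

/-! ### A basis of the rational differentials -/

section Basis

variable {n : ℕ}

instance : Algebra (FunField n) (ConeField n) := inferInstanceAs (Algebra (degreeZero n) _)

instance : IsScalarTower ℂ (FunField n) (ConeField n) :=
  inferInstanceAs (IsScalarTower ℂ (degreeZero n) _)

lemma funField_smul_def (f : FunField n) (x : ConeField n) : f • x = f.val * x := rfl

/-- The derivative in the direction of the constant vector `e`, on rational functions on affine
space. -/
lemma exists_derivation (e : Fin (n + 1) → ℂ) :
    ∃ δ : Derivation ℂ (ConeField n) (ConeField n), ∀ l : Fin (n + 1) → ℂ,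
      δ (toCone (linForm l)) = algebraMap ℂ (ConeField n) (l ⬝ᵥ e) := by
  have : Algebra.FormallyEtale (Coord n) (ConeField n) :=
    Algebra.FormallyEtale.of_isLocalization (nonZeroDivisors (Coord n))
  let d : Derivation ℂ (Coord n) (ConeField n) :=
    MvPolynomial.mkDerivation ℂ fun i => algebraMap ℂ (ConeField n) (e i)
  let L : Ω[ConeField n⁄ℂ] →ₗ[ConeField n] ConeField n :=
    (LinearMap.liftBaseChange (ConeField n) d.liftKaehlerDifferential) ∘ₗ
    (KaehlerDifferential.tensorKaehlerEquivOfFormallyEtale ℂ (Coord n) (ConeField n)).symm.toLinearMap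
  refine ⟨L.compDer (KaehlerDifferential.D ℂ (ConeField n)), fun l => ?_⟩
  have h1 : L (KaehlerDifferential.D ℂ (ConeField n) (toCone (linForm l))) = d (linForm l) := by
    simp only [L, LinearMap.comp_apply, LinearEquiv.coe_coe, toCone]
    rw [KaehlerDifferential.tensorKaehlerEquivOfFormallyEtale_symm_D_algebraMap]
    simp
  refine h1.trans ?_
  rw [linForm, map_sum, dotProduct, map_sum]
  refine Finset.sum_congr rfl fun i _ => ?_
  rw [← MvPolynomial.smul_eq_C_mul, Derivation.map_smul, MvPolynomial.mkDerivation_X, map_mul,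
    Algebra.smul_def]

lemma exists_dotProduct_eq_of_linearIndependent {ι : Type*} {x : ι → Fin (n + 1) → ℂ}
    (hx : LinearIndependent ℂ x) (c : ι → ℂ) : ∃ e : Fin (n + 1) → ℂ, ∀ j, x j ⬝ᵥ e = c j := by
  obtain ⟨g, hg⟩ := LinearMap.exists_leftInverse_of_injective
    (Finsupp.linearCombination ℂ x) (LinearMap.ker_eq_bot.2 hx)
  let φ : (Fin (n + 1) → ℂ) →ₗ[ℂ] ℂ := Finsupp.linearCombination ℂ c ∘ₗ g
  have hφ : ∀ j, φ (x j) = c j := by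
    intro j
    have := LinearMap.congr_fun hg (Finsupp.single j 1)
    simp only [LinearMap.comp_apply, Finsupp.linearCombination_single, one_smul,
      LinearMap.id_apply] at this
    simp [φ, this]
  refine ⟨fun i => φ (Pi.single i 1), fun j => ?_⟩
  rw [← hφ, φ.pi_apply_eq_sum_univ (x j), dotProduct]
  refine Finset.sum_congr rfl fun i _ => ?_
  rw [smul_eq_mul]
  congr 2
  ext l
  simp [Pi.single_apply, eq_comm]

/-- The dual vectors of the `x i` give derivations that separate the logarithmic differentials. -/
lemma linearIndependent_lg {x : Fin (n + 1) → Fin (n + 1) → ℂ} (hx : LinearIndependent ℂ x) :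
    LinearIndependent (FunField n) fun i : Fin n => lg (x i.succ) (x 0) := by
  rw [Fintype.linearIndependent_iff]
  intro g hg i
  obtain ⟨e, he⟩ := exists_dotProduct_eq_of_linearIndependent hx (Pi.single i.succ 1)
  obtain ⟨δ, hδ⟩ := exists_derivation e
  let δ' : Derivation ℂ (FunField n) (ConeField n) := δ.compAlgebraMap (FunField n)
  have hx0 : ∀ j, toCone (linForm (x j)) ≠ 0 := fun j => toCone_linForm_ne_zero (hx.ne_zero j)
  have h1 : ∀ j : Fin n, δ'.liftKaehlerDifferential (lg (x j.succ) (x 0)) =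
      algebraMap ℂ (ConeField n) ((Pi.single i.succ 1 : Fin (n + 1) → ℂ) j.succ) /
        toCone (linForm (x j.succ)) := by
    intro j
    rw [lg, map_smul, Derivation.liftKaehlerDifferential_comp_D, funField_smul_def, map_inv₀]
    change _ * δ ((lin (x j.succ) (x 0)).val) = _
    rw [val_lin, Derivation.leibniz_div, hδ, hδ, he, he]
    have h0 := hx0 0
    have hj := hx0 j.succ
    have : (Pi.single i.succ 1 : Fin (n + 1) → ℂ) 0 = 0 :=
      Pi.single_eq_of_ne (Fin.succ_ne_zero i).symm _
    rw [this, map_zero, smul_zero, sub_zero, smul_eq_mul, smul_eq_mul]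
    field_simp
  have h2 := congrArg δ'.liftKaehlerDifferential hg
  rw [map_sum, map_zero, Finset.sum_eq_single i] at h2
  · rw [map_smul, h1, funField_smul_def, Pi.single_eq_same, map_one] at h2
    have := (mul_eq_zero.1 h2).resolve_right (one_div_ne_zero (hx0 _))
    exact val_injective (by rw [this, map_zero])
  · intro j _ hj
    rw [map_smul, h1, Pi.single_eq_of_ne (fun h => hj (Fin.succ_injective _ h)), map_zero, zero_div,
      smul_zero]
  · simp

lemma exists_mem_localRing (f : FunField n) : ∃ p : Point n, f ∈ localRing p := by
  obtain ⟨d, a, b, ha, hb, hb0, hf⟩ := f.2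
  have : ∃ v, MvPolynomial.eval v (b * MvPolynomial.X 0) ≠ 0 := by
    by_contra! h
    exact mul_ne_zero hb0 (MvPolynomial.X_ne_zero 0)
      (MvPolynomial.funext fun v => by rw [h v, map_zero])
  obtain ⟨v, hv⟩ := this
  rw [map_mul, MvPolynomial.eval_X] at hv
  have hv0 : v ≠ 0 := by rintro rfl; simp at hv
  obtain ⟨p, c, hc, hp⟩ := exists_smul_rep hv0
  refine ⟨p, d, a, b, ha, hb, ?_, hf⟩
  rw [hp, eval_smul_of_isHomogeneous hb]
  exact mul_ne_zero (pow_ne_zero _ hc) (left_ne_zero_of_mul hv)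

lemma span_range_eq_top {x : Fin (n + 1) → Fin (n + 1) → ℂ} (hx : LinearIndependent ℂ x) :
    Submodule.span ℂ (Set.range x) = ⊤ :=
  hx.span_eq_top_of_card_eq_finrank (by simp)

lemma span_lg_eq_top {x : Fin (n + 1) → Fin (n + 1) → ℂ} (hx : LinearIndependent ℂ x) :
    ⊤ ≤ Submodule.span (FunField n) (Set.range fun i : Fin n => lg (x i.succ) (x 0)) := by
  rw [← KaehlerDifferential.span_range_derivation, Submodule.span_le]
  rintro _ ⟨f, rfl⟩
  set N := Submodule.span (FunField n) (Set.range fun i : Fin n => lg (x i.succ) (x 0))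
  obtain ⟨p, hp⟩ := exists_mem_localRing f
  have h1 := D_mem_lgSpan hx.ne_zero (span_range_eq_top hx) hp
  have h2 : lgSpan x p ≤ N.restrictScalars (localRing p) := by
    refine Submodule.span_le.2 ?_
    have key : ∀ i, lg (x i) (x 0) ∈ N := by
      intro i
      refine Fin.cases ?_ (fun i => ?_) i
      · rw [lg_self (hx.ne_zero 0)]; exact zero_mem _
      · exact Submodule.subset_span ⟨i, rfl⟩
    rintro _ ⟨⟨i, j⟩, rfl⟩
    have h3 := lg_add_lg (hx.ne_zero i) (hx.ne_zero j) (hx.ne_zero 0)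
    rw [← eq_sub_iff_add_eq] at h3
    change lg (x i) (x j) ∈ N
    rw [h3]
    exact sub_mem (key i) (key j)
  exact h2 h1

/-- If `x 0, …, x n` are linearly independent linear forms, the logarithmic differentials of the
`x i / x 0` form a basis of the rational differentials. -/
def lgBasis {x : Fin (n + 1) → Fin (n + 1) → ℂ} (hx : LinearIndependent ℂ x) :
    Module.Basis (Fin n) (FunField n) (Ω[FunField n⁄ℂ]) :=
  Module.Basis.mk (linearIndependent_lg hx) (span_lg_eq_top hx)

lemma lgBasis_apply {x : Fin (n + 1) → Fin (n + 1) → ℂ} (hx : LinearIndependent ℂ x) (i : Fin n) :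
    lgBasis hx i = lg (x i.succ) (x 0) := by
  rw [lgBasis, Module.Basis.mk_apply]

end Basis

/-! ### General position and Gale duality -/

section GeneralPosition

variable {n k : ℕ} {ι : Type*}

/-- Linear forms in general position: a linear relation between at most `n + 1` of the `f i` is
trivial. -/
def GenPos [Fintype ι] (f : ι → Fin (n + 1) → ℂ) : Prop :=
  ∀ c : ι → ℂ, ∑ i, c i • f i = 0 → ∀ s : Finset ι, s.card ≤ n + 1 → (∀ i ∉ s, c i = 0) →
    ∀ i, c i = 0

namespace GenPos

variable [Fintype ι] {f : ι → Fin (n + 1) → ℂ}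

lemma comp_injective {κ : Type*} [Fintype κ] (hf : GenPos f) {g : κ → ι}
    (hg : Function.Injective g) : GenPos (f ∘ g) := by
  classical
  intro c hc s hs h i
  have h1 : ∀ i j, (if g j = g i then c j else 0) = if j = i then c j else 0 := by
    intro i j; simp [hg.eq_iff]
  have := hf (fun i => ∑ j, if g j = i then c j else 0) ?_ (s.map ⟨g, hg⟩) (by simpa) ?_ (g i)
  · simpa [h1] using this
  · rw [← hc]
    simp only [Finset.sum_smul]
    rw [Finset.sum_comm]
    refine Finset.sum_congr rfl fun j _ => ?_
    rw [Finset.sum_eq_single (g j)]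
    · simp
    · intro i _ hi; rw [if_neg hi.symm, zero_smul]
    · simp
  · intro i hi
    refine Finset.sum_eq_zero fun j _ => ?_
    split_ifs with hj
    · refine h j fun hjs => hi ?_
      rw [← hj]
      exact Finset.mem_map_of_mem _ hjs
    · rfl

lemma ne_zero (hf : GenPos f) (i : ι) : f i ≠ 0 := by
  classical
  intro h
  have := hf (Pi.single i 1) (by
    rw [Finset.sum_eq_single i]
    · rw [h, smul_zero]
    · intro j _ hj; rw [Pi.single_eq_of_ne hj, zero_smul]
    · simp) {i} (by simp) (fun j hj => Pi.single_eq_of_ne (by simpa using hj) _) i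
  simp at this

lemma linearIndependent (hf : GenPos f) {m : ℕ} (hm : m ≤ n + 1) {b : Fin m → ι}
    (hb : Function.Injective b) : LinearIndependent ℂ (f ∘ b) := by
  rw [Fintype.linearIndependent_iff]
  intro g hg
  exact hf.comp_injective hb g hg Finset.univ (by simpa) (fun i hi => absurd (Finset.mem_univ i) hi)

lemma card_filter_le (hf : GenPos f) {v : Fin (n + 1) → ℂ} (hv : v ≠ 0) :
    (Finset.univ.filter fun i => f i ⬝ᵥ v = 0).card ≤ n := by
  by_contra! h
  obtain ⟨T, hT, hcard⟩ := Finset.exists_subset_card_eq (Nat.succ_le_of_lt h)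
  let b : Fin (n + 1) → ι := fun i => ((T.equivFinOfCardEq hcard).symm i : ι)
  have hb : Function.Injective b :=
    Subtype.val_injective.comp (T.equivFinOfCardEq hcard).symm.injective
  obtain ⟨i, hi⟩ := exists_dotProduct_ne_zero
    (span_range_eq_top (hf.linearIndependent le_rfl hb)) hv
  have := hT ((T.equivFinOfCardEq hcard).symm i).2
  exact hi (Finset.mem_filter.1 this).2

end GenPos

/-- A basis `μ` of the space of linear relations between `n + k + 1` linear forms `f` in general
position (the Gale dual of `f`). -/
structure IsGale (f : Fin (n + k + 1) → Fin (n + 1) → ℂ) (μ : Fin k → Fin (n + k + 1) → ℂ) :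
    Prop where
  genPos : GenPos f
  rel : ∀ a, ∑ j, μ a j • f j = 0
  indep : LinearIndependent ℂ μ

namespace IsGale

variable {f : Fin (n + k + 1) → Fin (n + 1) → ℂ} {μ : Fin k → Fin (n + k + 1) → ℂ}

lemma comb_rel (h : IsGale f μ) (u : Fin k → ℂ) : ∑ j, (∑ a, u a * μ a j) • f j = 0 := by
  simp only [Finset.sum_smul, mul_smul]
  rw [Finset.sum_comm]
  refine Finset.sum_eq_zero fun a _ => ?_
  rw [← Finset.smul_sum, h.rel, smul_zero]

lemma comb_eq_zero (h : IsGale f μ) {u : Fin k → ℂ} {s : Finset (Fin (n + k + 1))}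
    (hs : s.card ≤ n + 1) (hu : ∀ j ∉ s, ∑ a, u a * μ a j = 0) : u = 0 := by
  have h1 := h.genPos _ (h.comb_rel u) s hs hu
  have h2 := Fintype.linearIndependent_iff.1 h.indep u (by
    ext j
    simpa using h1 j)
  exact funext h2

/-- Any `k` columns of the matrix of relations are linearly independent. -/
lemma exists_comb (h : IsGale f μ) {T : Finset (Fin (n + k + 1))} (hT : T.card = k)
    (c : Fin (n + k + 1) → ℂ) : ∃ u : Fin k → ℂ, ∀ j ∈ T, ∑ a, u a * μ a j = c j := by
  let L : (Fin k → ℂ) →ₗ[ℂ] (T → ℂ) :=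
    { toFun := fun u j => ∑ a, u a * μ a j
      map_add' := fun u v => by ext j; simp [add_mul, Finset.sum_add_distrib]
      map_smul' := fun r u => by ext j; simp [Finset.mul_sum, mul_assoc] }
  have hinj : Function.Injective L := by
    rw [injective_iff_map_eq_zero]
    intro u hu
    refine h.comb_eq_zero (s := Tᶜ) ?_ fun j hj => ?_
    · rw [Finset.card_compl, hT, Fintype.card_fin]; omega
    · have hj' : j ∈ T := by simpa using hj
      exact congrFun hu ⟨j, hj'⟩
  have hsurj : Function.Surjective L :=
    (LinearMap.injective_iff_surjective_of_finrank_eq_finrank (by simp [hT])).1 hinj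
  obtain ⟨u, hu⟩ := hsurj fun j => c j
  exact ⟨u, fun j hj => congrFun hu ⟨j, hj⟩⟩

lemma exists_eq_comb (h : IsGale f μ) {c : Fin (n + k + 1) → ℂ} (hc : ∑ j, c j • f j = 0) :
    ∃ u : Fin k → ℂ, ∀ j, c j = ∑ a, u a * μ a j := by
  obtain ⟨T, -, hT⟩ := Finset.exists_subset_card_eq (s := (Finset.univ : Finset (Fin (n + k + 1))))
    (n := k) (by simp; omega)
  obtain ⟨u, hu⟩ := h.exists_comb hT c
  refine ⟨u, fun j => sub_eq_zero.1 ?_⟩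
  refine h.genPos (fun j => c j - ∑ a, u a * μ a j) ?_ Tᶜ ?_ (fun i hi => ?_) j
  · simp only [sub_smul, Finset.sum_sub_distrib, hc, h.comb_rel, sub_zero]
  · rw [Finset.card_compl, hT, Fintype.card_fin]; omega
  · rw [hu i (by simpa using hi), sub_self]

end IsGale

/-- The space of linear relations between `n + k + 1` vectors that span has dimension `k`. -/
lemma exists_isGale {f : Fin (n + k + 1) → Fin (n + 1) → ℂ} (hf : GenPos f) :
    ∃ μ, IsGale (n := n) (k := k) f μ := by
  let L : (Fin (n + k + 1) → ℂ) →ₗ[ℂ] (Fin (n + 1) → ℂ) := Fintype.linearCombination ℂ f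
  have hinj : Function.Injective (fun i : Fin (n + 1) => (⟨i, by omega⟩ : Fin (n + k + 1))) := by
    intro i j h
    simpa [Fin.ext_iff] using h
  have hspan := span_range_eq_top (hf.linearIndependent le_rfl hinj)
  have hsurj : LinearMap.range L = ⊤ := by
    rw [Fintype.range_linearCombination, eq_top_iff, ← hspan]
    exact Submodule.span_mono (Set.range_comp_subset_range _ _)
  have hdim : Module.finrank ℂ (LinearMap.ker L) = k := by
    have := L.finrank_range_add_finrank_ker
    rw [hsurj, finrank_top] at this
    simp at this
    omega
  let b := Module.finBasisOfFinrankEq ℂ (LinearMap.ker L) hdim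
  refine ⟨fun a => (b a : Fin (n + k + 1) → ℂ), hf, fun a => ?_, ?_⟩
  · have h1 := LinearMap.mem_ker.1 (b a).2
    rwa [Fintype.linearCombination_apply] at h1
  · exact b.linearIndependent.map' (LinearMap.ker L).subtype (Submodule.ker_subtype _)

lemma lies_iff {p : Point n} {H : Hyperplane n} : Lies p H ↔ H.rep ⬝ᵥ p.rep = 0 := Iff.rfl

/-- Hyperplanes with normal crossing are in general position. -/
lemma genPos_of_normalCrossing {ℋ : Finset (Hyperplane n)} (h : NormalCrossing ℋ) [Fintype ι]
    (e : ι ≃ ℋ) : GenPos fun i => (e i).1.rep := by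
  classical
  intro c hc s hs hcs
  by_contra! hne
  obtain ⟨i₀, hi₀⟩ := hne
  have hi₀s : i₀ ∈ s := by
    by_contra hi
    exact hi₀ (hcs _ hi)
  let f : ι → Fin (n + 1) → ℂ := fun i => (e i).1.rep
  -- a relation among at most `n + 1` equations yields a point on all these hyperplanes
  let L : (Fin (n + 1) → ℂ) →ₗ[ℂ] (s.erase i₀ → ℂ) :=
    LinearMap.pi fun j => dotProductBilin ℂ ℂ (f j)
  have hker : LinearMap.ker L ≠ ⊥ := by
    refine LinearMap.ker_ne_bot_of_finrank_lt ?_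
    have := Finset.card_erase_lt_of_mem hi₀s
    simp only [Module.finrank_fintype_fun_eq_card, Fintype.card_coe, Fintype.card_fin]
    omega
  obtain ⟨v, hv, hv0⟩ := Submodule.exists_mem_ne_zero_of_ne_bot hker
  have hv1 : ∀ j ∈ s, j ≠ i₀ → f j ⬝ᵥ v = 0 := by
    intro j hj hj0
    exact congrFun (LinearMap.mem_ker.1 hv) ⟨j, Finset.mem_erase.2 ⟨hj0, hj⟩⟩
  have hv2 : f i₀ ⬝ᵥ v = 0 := by
    have h1 := congrArg (fun x => x ⬝ᵥ v) hc
    simp only [sum_dotProduct, smul_dotProduct, zero_dotProduct] at h1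
    rw [Finset.sum_eq_single i₀] at h1
    · exact (mul_eq_zero.1 h1).resolve_left hi₀
    · intro j _ hj
      by_cases hjs : j ∈ s
      · have := hv1 j hjs hj
        simp only [f] at this
        rw [this, smul_zero]
      · rw [hcs j hjs, zero_smul]
    · simp
  obtain ⟨p, r, hr, hp⟩ := exists_smul_rep hv0
  have hlies : ∀ j ∈ s, Lies p (e j).1 := by
    intro j hj
    rw [lies_iff, hp, dotProduct_smul]
    by_cases hj0 : j = i₀
    · subst hj0
      simp only [f] at hv2
      rw [hv2, smul_zero]
    · have := hv1 j hj hj0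
      simp only [f] at this
      rw [this, smul_zero]
  have hLI := (h p).comp
    (fun j : s => (⟨(e j).1, (e j).2, hlies j j.2⟩ : {H : Hyperplane n // H ∈ ℋ ∧ Lies p H}))
    (by
      intro i j hij
      have h1 := congrArg Subtype.val hij
      exact Subtype.ext (e.injective (Subtype.ext h1)))
  rw [Fintype.linearIndependent_iff] at hLI
  refine hi₀ (hLI (fun j => c j) ?_ ⟨i₀, hi₀s⟩)
  rw [← hc, ← Finset.sum_subset (Finset.subset_univ s)]
  · exact Finset.sum_coe_sort s fun j => c j • (e j).1.rep
  · intro j _ hj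
    rw [hcs j hj, zero_smul]

end GeneralPosition

/-! ### Isomorphisms and duals -/

section Iso

variable {n : ℕ} {M M' M'' : Type} [AddCommGroup M] [Module (FunField n) M] [AddCommGroup M']
  [Module (FunField n) M'] [AddCommGroup M''] [Module (FunField n) M'']
  {E : SubSheaf n M} {E' : SubSheaf n M'} {E'' : SubSheaf n M''}

lemma Iso.refl (E : SubSheaf n M) : Iso E E := ⟨LinearEquiv.refl _ _, fun _ _ => Iff.rfl⟩

lemma Iso.symm : Iso E E' → Iso E' E := by
  rintro ⟨φ, h⟩
  refine ⟨φ.symm, fun p e => ?_⟩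
  rw [h, φ.apply_symm_apply]

lemma Iso.trans : Iso E E' → Iso E' E'' → Iso E E'' := by
  rintro ⟨φ, h⟩ ⟨ψ, h'⟩
  exact ⟨φ.trans ψ, fun p e => by rw [h, h']; rfl⟩

lemma Iso.dual : Iso E E' → Iso (PnBundle.dual E) (PnBundle.dual E') := by
  rintro ⟨φ, h⟩
  refine ⟨φ.symm.dualMap, fun p _ => ⟨fun hψ e he => ?_, fun hψ e he => ?_⟩⟩
  · refine hψ _ ?_
    rw [h]
    rwa [LinearEquiv.coe_coe, φ.apply_symm_apply]
  · have := hψ (φ e) ((h p e).1 he)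
    simpa using this

/-- A sheaf that is locally cut out by linear functionals is reflexive. -/
lemma iso_dual_dual [FiniteDimensional (FunField n) M]
    (h : ∀ p e, (∀ φ ∈ PnBundle.dual E p, φ e ∈ localRing p) → e ∈ E p) :
    Iso E (PnBundle.dual (PnBundle.dual E)) :=
  ⟨Module.evalEquiv (FunField n) M, fun p e => ⟨fun he _ hφ => hφ e he, fun he => h p e he⟩⟩

lemma mem_of_forall_dual {p : Point n} {ι : Type*} [Fintype ι]
    (b : Module.Basis ι (FunField n) M)
    (hb : E p = Submodule.span (localRing p) (Set.range b)) {e : M}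
    (he : ∀ φ ∈ PnBundle.dual E p, φ e ∈ localRing p) : e ∈ E p := by
  classical
  rw [← b.sum_repr e]
  refine sum_mem fun i _ => smul_mem_of_mem_localRing _ (he (b.coord i) ?_) ?_
  · intro x hx
    rw [hb] at hx
    induction hx using Submodule.span_induction with
    | mem x hx =>
      obtain ⟨j, rfl⟩ := hx
      rw [b.coord_apply, b.repr_self, Finsupp.single_apply]
      split_ifs
      exacts [one_mem _, zero_mem _]
    | zero => rw [map_zero]; exact zero_mem _
    | add x y _ _ hx hy => rw [map_add]; exact add_mem hx hy
    | smul c x _ hx =>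
      change b.coord i ((c : FunField n) • x) ∈ _
      rw [map_smul]
      exact mul_mem c.2 hx
  · rw [hb]; exact Submodule.subset_span ⟨i, rfl⟩

lemma iso_dual_dual_kernelSheaf {k : ℕ} (A : LinMatrix n k) :
    Iso (kernelSheaf A) (PnBundle.dual (PnBundle.dual (kernelSheaf A))) := by
  refine iso_dual_dual fun p e he j => ?_
  exact he ((LinearMap.proj j).comp (kernelGeneric A).subtype) fun w hw => hw j

end Iso

/-! ### The bundle of logarithmic forms is a Steiner bundle -/

section LogIsSteiner

variable {n k : ℕ}

/-- The Steiner matrix of `Ω(log ℋ)`: a logarithmic vector field `θ` is determined by the functions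
`θ(f j) / f j`, up to a common summand; they are subject to the relations
`∑ j, μ a j * f j * (θ(f j) / f j) = 0`. The common summand is fixed by requiring the last of these
functions to vanish. -/
def logMatrix (f : Fin (n + k + 1) → Fin (n + 1) → ℂ) (μ : Fin k → Fin (n + k + 1) → ℂ) :
    LinMatrix n k :=
  Matrix.of fun a j => μ a j.castSucc • f j.castSucc

variable {f : Fin (n + k + 1) → Fin (n + 1) → ℂ} {μ : Fin k → Fin (n + k + 1) → ℂ}

lemma sum_mul_eq_zero_of_mem_kernelGeneric {A : LinMatrix n k} {w : Fin (n + k) → FunField n}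
    (hw : w ∈ kernelGeneric A) (u : Fin k → ℂ) :
    ∑ j, toCone (linForm (∑ a, u a • A a j)) * (w j).val = 0 := by
  have h1 : ∀ j, toCone (linForm (∑ a, u a • A a j)) * (w j).val =
      ∑ a, toCone (MvPolynomial.C (u a)) * (toCone (linForm (A a j)) * (w j).val) := by
    intro j
    rw [linForm_sum, toCone, map_sum, Finset.sum_mul]
    refine Finset.sum_congr rfl fun a _ => ?_
    rw [linForm_smul, map_mul, mul_assoc]
  simp only [h1]
  rw [Finset.sum_comm]
  refine Finset.sum_eq_zero fun a _ => ?_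
  rw [← Finset.mul_sum, hw a, mul_zero]

lemma sum_logMatrix (u : Fin k → ℂ) (j : Fin (n + k)) :
    ∑ a, u a • logMatrix f μ a j = (∑ a, u a * μ a j.castSucc) • f j.castSucc := by
  simp only [logMatrix, Matrix.of_apply, smul_smul, Finset.sum_smul]

/-- At most `n` of the `f j` vanish at a point, so a combination of the rows of the matrix that
vanishes there is a relation between at most `n + 1` of the `f j`. -/
lemma nondegenerate_logMatrix (h : IsGale f μ) : Nondegenerate (logMatrix f μ) := by
  classical
  intro p
  rw [LinearIndependent.rank_matrix, Fintype.card_fin]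
  rw [Fintype.linearIndependent_iff]
  intro u hu
  refine congrFun (h.comb_eq_zero
    (s := insert (Fin.last _) (Finset.univ.filter fun j => f j ⬝ᵥ p.rep = 0)) ?_ ?_)
  · refine (Finset.card_insert_le _ _).trans ?_
    exact Nat.succ_le_succ (h.genPos.card_filter_le p.rep_nonzero)
  · intro j hj
    rw [Finset.mem_insert, not_or, Finset.mem_filter, not_and] at hj
    obtain ⟨j, rfl⟩ := Fin.exists_castSucc_eq.2 hj.1
    have h1 : _ = (0 : ℂ) := congrFun hu j
    have h2 : (∑ a, u a * μ a j.castSucc) * (f j.castSucc ⬝ᵥ p.rep) = 0 := by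
      rw [← h1, Finset.sum_apply, Finset.sum_mul]
      refine Finset.sum_congr rfl fun a _ => ?_
      simp [logMatrix, dotProduct, Finset.mul_sum, mul_assoc]
    exact (mul_eq_zero.1 h2).resolve_right (hj.2 (Finset.mem_univ _))

/-- The indices `last, 0, …, n - 1`. -/
def lastCons (n k : ℕ) : Fin (n + 1) → Fin (n + k + 1) :=
  Fin.cons (Fin.last _) fun i => (Fin.castAdd k i).castSucc

lemma lastCons_injective (n k : ℕ) : Function.Injective (lastCons n k) := by
  rw [lastCons, Fin.cons_injective_iff]
  constructor
  · rintro ⟨i, hi⟩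
    exact (Fin.castSucc_lt_last _).ne hi
  · intro i j h
    simpa [Fin.ext_iff] using h

lemma exists_eq_castSucc (j : Fin (n + k)) :
    (∃ i : Fin n, j = Fin.castAdd k i) ∨ ∃ a : Fin k, j = Fin.natAdd n a := by
  refine Fin.addCases (fun i => Or.inl ⟨i, rfl⟩) (fun a => Or.inr ⟨a, rfl⟩) j

lemma eq_zero_of_mem_kernelGeneric_logMatrix (h : IsGale f μ) {w : Fin (n + k) → FunField n}
    (hw : w ∈ kernelGeneric (logMatrix f μ)) (hw0 : ∀ i, w (Fin.castAdd k i) = 0) : w = 0 := by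
  classical
  have key : ∀ a : Fin k, w (Fin.natAdd n a) = 0 := by
    intro a
    obtain ⟨u, hu⟩ := h.exists_comb
      (T := Finset.univ.map ⟨fun a : Fin k => (Fin.natAdd n a).castSucc, by
        intro i j hij
        simpa [Fin.ext_iff] using hij⟩) (by simp)
      (Pi.single (Fin.natAdd n a).castSucc 1)
    have h1 := sum_mul_eq_zero_of_mem_kernelGeneric hw u
    rw [Finset.sum_eq_single (Fin.natAdd n a)] at h1
    · rw [sum_logMatrix, hu _ (by simp), Pi.single_eq_same, one_smul] at h1
      have h2 := (mul_eq_zero.1 h1).resolve_left (toCone_linForm_ne_zero (h.genPos.ne_zero _))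
      exact val_injective (by rw [h2, map_zero])
    · intro j _ hj
      rcases exists_eq_castSucc j with ⟨i, rfl⟩ | ⟨b, rfl⟩
      · rw [hw0, map_zero, mul_zero]
      · have hne : (Fin.natAdd n b).castSucc ≠ (Fin.natAdd n a).castSucc := fun h' =>
          hj (Fin.castSucc_injective _ h')
        rw [sum_logMatrix, hu _ (by simp), Pi.single_eq_of_ne hne, zero_smul, linForm_zero, toCone,
          map_zero, zero_mul]
    · simp
  ext j
  rcases exists_eq_castSucc j with ⟨i, rfl⟩ | ⟨b, rfl⟩
  · rw [hw0]; rfl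
  · rw [key]; rfl

lemma sum_smul_lg_eq_zero {ι : Type*} (s : Finset ι) {x : ι → Fin (n + 1) → ℂ}
    (hx : ∀ i ∈ s, x i ≠ 0) (c : ι → ℂ) (hl : ∑ i ∈ s, c i • x i = 0) {m : Fin (n + 1) → ℂ}
    (hm : m ≠ 0) : ∑ i ∈ s, c i • (lin (x i) m • lg (x i) m) = 0 := by
  have h1 : ∑ i ∈ s, c i • lin (x i) m = 0 := by
    simp only [← linHom_apply, ← map_smul]
    rw [← map_sum, hl, map_zero]
  rw [← (KaehlerDifferential.D ℂ (FunField n)).map_zero, ← h1, map_sum]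
  refine Finset.sum_congr rfl fun i hi => ?_
  rw [Derivation.map_smul, D_lin (hx i hi) hm]

/-- Evaluation of a vector field on the logarithmic differentials. -/
def evalLg (h : IsGale f μ) :
    Module.Dual (FunField n) (Ω[FunField n⁄ℂ]) →ₗ[FunField n] kernelGeneric (logMatrix f μ) where
  toFun φ := ⟨fun j => φ (lg (f j.castSucc) (f (Fin.last _))), by
    intro a
    have h1 := sum_smul_lg_eq_zero Finset.univ (fun i _ => h.genPos.ne_zero i) (μ a) (h.rel a)
      (h.genPos.ne_zero (Fin.last _))
    rw [Fin.sum_univ_castSucc, lg_self (h.genPos.ne_zero _), smul_zero, smul_zero, add_zero] at h1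
    have h2 := congrArg (fun ω => (φ ω).val * toCone (linForm (f (Fin.last _)))) h1
    simp only [map_sum, map_zero, zero_mul, Finset.sum_mul] at h2
    rw [← h2]
    refine Finset.sum_congr rfl fun j _ => ?_
    have h3 : φ (μ a j.castSucc • (lin (f j.castSucc) (f (Fin.last _)) •
        lg (f j.castSucc) (f (Fin.last _)))) = μ a j.castSucc •
        (lin (f j.castSucc) (f (Fin.last _)) * φ (lg (f j.castSucc) (f (Fin.last _)))) := by
      rw [LinearMap.map_smul_of_tower, map_smul, smul_eq_mul]
    have h4 := toCone_linForm_ne_zero (h.genPos.ne_zero (Fin.last _))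
    rw [h3, map_smul, map_mul, val_lin, logMatrix, Matrix.of_apply, linForm_smul, toCone, map_mul,
      Algebra.smul_def, IsScalarTower.algebraMap_apply ℂ (Coord n) (ConeField n)]
    change _ = algebraMap (Coord n) (ConeField n) (MvPolynomial.C _) * _ * _
    field_simp⟩
  map_add' φ ψ := by ext; rfl
  map_smul' c φ := by ext; rfl

lemma evalLg_apply (h : IsGale f μ) (φ : Module.Dual (FunField n) (Ω[FunField n⁄ℂ]))
    (j : Fin (n + k)) :
    (evalLg h φ).1 j = φ (lg (f j.castSucc) (f (Fin.last _))) := rfl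

/-- The basis of the rational differentials given by the first `n` of the equations, divided by
the last one. -/
def lgBasisLast (hf : GenPos f) : Module.Basis (Fin n) (FunField n) (Ω[FunField n⁄ℂ]) :=
  lgBasis (hf.linearIndependent le_rfl (lastCons_injective n k))

lemma lgBasisLast_apply (hf : GenPos f) (i : Fin n) :
    lgBasisLast hf i = lg (f (Fin.castAdd k i).castSucc) (f (Fin.last _)) :=
  lgBasis_apply _ i

/-- A vector in the kernel is determined by its first `n` coordinates, which are arbitrary: they are
the values of the vector field on a basis of the differentials. -/
lemma evalLg_bijective (h : IsGale f μ) : Function.Bijective (evalLg h) := by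
  constructor
  · rw [injective_iff_map_eq_zero]
    intro φ hφ
    refine (lgBasisLast h.genPos).ext fun i => ?_
    rw [lgBasisLast_apply, ← evalLg_apply h, hφ]
    rfl
  · intro w
    let φ : Module.Dual (FunField n) (Ω[FunField n⁄ℂ]) :=
      (lgBasisLast h.genPos).constr ℂ fun i => w.1 (Fin.castAdd k i)
    refine ⟨φ, ?_⟩
    rw [← sub_eq_zero]
    refine Subtype.ext (eq_zero_of_mem_kernelGeneric_logMatrix h (evalLg h φ - w).2 fun i => ?_)
    have h1 : φ (lgBasisLast h.genPos i) = w.1 (Fin.castAdd k i) :=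
      Module.Basis.constr_basis _ _ _ i
    rw [lgBasisLast_apply] at h1
    exact sub_eq_zero.2 h1

variable {ℋ : Finset (Hyperplane n)}

/-- The vectors `f` are the equations of the hyperplanes in `ℋ`. -/
structure IsEquations {ι : Type*} (f : ι → Fin (n + 1) → ℂ) (ℋ : Finset (Hyperplane n)) :
    Prop where
  exists_index : ∀ H ∈ ℋ, ∃ i, H.rep = f i
  exists_hyperplane : ∀ i, ∃ H ∈ ℋ, Projectivization.rep H = f i

lemma GenPos.span_eq_top (hf : GenPos f) : Submodule.span ℂ (Set.range f) = ⊤ := by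
  rw [eq_top_iff, ← span_range_eq_top (hf.linearIndependent le_rfl (lastCons_injective n k))]
  exact Submodule.span_mono (Set.range_comp_subset_range _ _)

/-- Evaluation on the logarithmic differentials identifies the logarithmic vector fields with the
kernel of the matrix `logMatrix f μ`. -/
lemma iso_dual_logForms_kernelSheaf (h : IsGale f μ) (hℋ : IsEquations f ℋ) :
    Iso (dual (logForms ℋ)) (kernelSheaf (logMatrix f μ)) := by
  refine ⟨LinearEquiv.ofBijective _ (evalLg_bijective h), fun p φ => ?_⟩
  have hS := logForms_eq_lgSpan hℋ.exists_index hℋ.exists_hyperplane h.genPos.span_eq_top p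
  constructor
  · intro hφ j
    refine hφ _ ?_
    rw [hS]
    exact lg_mem_lgSpan _ _ _ _
  · intro hφ e he
    rw [hS] at he
    have key : ∀ i, φ (lg (f i) (f (Fin.last _))) ∈ localRing p := by
      intro i
      refine Fin.lastCases ?_ (fun j => hφ j) i
      rw [lg_self (h.genPos.ne_zero _), map_zero]
      exact zero_mem _
    induction he using Submodule.span_induction with
    | mem x hx =>
      obtain ⟨⟨i, j⟩, rfl⟩ := hx
      have h3 := lg_add_lg (h.genPos.ne_zero i) (h.genPos.ne_zero j)
        (h.genPos.ne_zero (Fin.last _))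
      rw [← eq_sub_iff_add_eq] at h3
      change φ (lg (f i) (f j)) ∈ localRing p
      rw [h3, map_sub]
      exact sub_mem (key i) (key j)
    | zero => rw [map_zero]; exact zero_mem _
    | add x y _ _ hx hy => rw [map_add]; exact add_mem hx hy
    | smul c x _ hx =>
      change φ ((c : FunField n) • x) ∈ _
      rw [map_smul]
      exact mul_mem c.2 hx

lemma exists_injective_of_card_le {ι : Type*} [Fintype ι] {Z : Finset ι} {m : ℕ} (hZ : Z.card ≤ m)
    (hm : m ≤ Fintype.card ι) : ∃ b : Fin m → ι, Function.Injective b ∧ ∀ i ∈ Z, ∃ j, b j = i := by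
  classical
  obtain ⟨T, hZT, hcard⟩ := Finset.exists_superset_card_eq hZ hm
  refine ⟨fun i => ((T.equivFinOfCardEq hcard).symm i : ι),
    Subtype.val_injective.comp (T.equivFinOfCardEq hcard).symm.injective, fun i hi => ?_⟩
  exact ⟨T.equivFinOfCardEq hcard ⟨i, hZT hi⟩, by simp⟩

/-- Where the equations outside a set of `n + 1` of them do not vanish, the logarithmic
differentials of these `n + 1` equations are a frame. -/
lemma lgSpan_eq_span_lgBasis (hf : GenPos f) {b : Fin (n + 1) → Fin (n + k + 1)}
    (hb : Function.Injective b) {q : Point n} (hq : ∀ i, (∀ j, b j ≠ i) → f i ⬝ᵥ q.rep ≠ 0) :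
    lgSpan f q = Submodule.span (localRing q)
      (Set.range (lgBasis (hf.linearIndependent le_rfl hb))) := by
  set B := lgBasis (hf.linearIndependent le_rfl hb) with hB
  refine le_antisymm (Submodule.span_le.2 ?_) (Submodule.span_le.2 ?_)
  · set N := Submodule.span (localRing q) (Set.range B)
    have hbase : ∀ j, lg (f (b j)) (f (b 0)) ∈ N := by
      intro j
      refine Fin.cases ?_ (fun i => ?_) j
      · rw [lg_self (hf.ne_zero _)]; exact zero_mem _
      · exact Submodule.subset_span ⟨i, lgBasis_apply _ i⟩
    have key : ∀ i, lg (f i) (f (b 0)) ∈ N := by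
      intro i
      by_cases hi : ∃ j, b j = i
      · obtain ⟨j, rfl⟩ := hi
        exact hbase j
      · push Not at hi
        have h1 : f i ∈ Submodule.span ℂ (Set.range (f ∘ b)) := by
          rw [span_range_eq_top (hf.linearIndependent le_rfl hb)]; trivial
        obtain ⟨c, hc⟩ := (Submodule.mem_span_range_iff_exists_fun ℂ).1 h1
        rw [lg_eq_sum Finset.univ (fun j _ => hf.ne_zero (b j)) c hc.symm (hf.ne_zero _)]
        refine sum_mem fun j _ => complex_smul_mem _ _ ?_
        exact smul_mem_of_mem_localRing _ (lin_mem_localRing _ (hq i hi)) (hbase j)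
    rintro _ ⟨⟨i, j⟩, rfl⟩
    have h3 := lg_add_lg (hf.ne_zero i) (hf.ne_zero j) (hf.ne_zero (b 0))
    rw [← eq_sub_iff_add_eq] at h3
    change lg (f i) (f j) ∈ N
    rw [h3]
    exact sub_mem (key i) (key j)
  · rintro _ ⟨i, rfl⟩
    rw [hB, lgBasis_apply]
    exact lg_mem_lgSpan _ _ _ _

/-- At most `n` equations vanish at a point, so `n + 1` of them can be chosen such that the other
ones are invertible there. -/
lemma exists_frame (hf : GenPos f) {v : Fin (n + 1) → ℂ} (hv : v ≠ 0) :
    ∃ b : Fin (n + 1) → Fin (n + k + 1), Function.Injective b ∧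
      ∀ i, (∀ j, b j ≠ i) → f i ⬝ᵥ v ≠ 0 := by
  obtain ⟨b, hb, hbZ⟩ := exists_injective_of_card_le (m := n + 1)
    ((hf.card_filter_le hv).trans (Nat.le_succ n)) (by simp)
  refine ⟨b, hb, fun i hi h0 => ?_⟩
  obtain ⟨j, hj⟩ := hbZ i (by simpa using h0)
  exact hi j hj

lemma isVectorBundle_logForms (hf : GenPos f) (hℋ : IsEquations f ℋ) :
    IsVectorBundle (logForms ℋ) := by
  classical
  intro p
  obtain ⟨b, hb, hbp⟩ := exists_frame hf p.rep_nonzero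
  refine ⟨n, lgBasis (hf.linearIndependent le_rfl hb),
    ∑ i ∈ Finset.univ.filter fun i => ∀ j, b j ≠ i, 1,
    ∏ i ∈ Finset.univ.filter fun i => ∀ j, b j ≠ i, linForm (f i),
    MvPolynomial.IsHomogeneous.prod _ _ _ fun i _ => isHomogeneous_linForm _, ?_, ?_⟩
  · rw [map_prod, Finset.prod_ne_zero_iff]
    intro i hi
    rw [eval_linForm]
    exact hbp i (Finset.mem_filter.1 hi).2
  · intro q hq
    rw [map_prod, Finset.prod_ne_zero_iff] at hq
    rw [logForms_eq_lgSpan hℋ.exists_index hℋ.exists_hyperplane hf.span_eq_top]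
    refine lgSpan_eq_span_lgBasis hf hb fun i hi => ?_
    have := hq i (Finset.mem_filter.2 ⟨Finset.mem_univ _, hi⟩)
    rwa [eval_linForm] at this

/-- The sheaf of logarithmic forms is reflexive, as it is locally free. -/
lemma mem_logForms_of_forall_dual (hf : GenPos f) (hℋ : IsEquations f ℋ) {p : Point n}
    {ω : Ω[FunField n⁄ℂ]} (hω : ∀ φ ∈ dual (logForms ℋ) p, φ ω ∈ localRing p) :
    ω ∈ logForms ℋ p := by
  obtain ⟨b, hb, hbp⟩ := exists_frame hf p.rep_nonzero
  refine mem_of_forall_dual (lgBasis (hf.linearIndependent le_rfl hb)) ?_ hω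
  rw [logForms_eq_lgSpan hℋ.exists_index hℋ.exists_hyperplane hf.span_eq_top]
  exact lgSpan_eq_span_lgBasis hf hb hbp

lemma isSteiner_logForms (h : IsGale f μ) (hℋ : IsEquations f ℋ) : IsSteiner k (logForms ℋ) :=
  ⟨isVectorBundle_logForms h.genPos hℋ, logMatrix f μ, nondegenerate_logMatrix h,
    iso_dual_logForms_kernelSheaf h hℋ⟩

end LogIsSteiner

/-! ### Global logarithmic forms -/

section GlobalSections

variable {n k : ℕ}

lemma GenPos.exists_dotProduct_eq {ι : Type*} [Fintype ι] {f : ι → Fin (n + 1) → ℂ}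
    (hf : GenPos f) {m : ℕ} (hm : m ≤ n + 1) {b : Fin m → ι} (hb : Function.Injective b)
    (c : Fin m → ℂ) : ∃ v : Fin (n + 1) → ℂ, ∀ j, f (b j) ⬝ᵥ v = c j :=
  exists_dotProduct_eq_of_linearIndependent (hf.linearIndependent hm hb) c

/-- The hyperplane with equation `l`, as a linear space. -/
def hyperplaneSpace (l : Fin (n + 1) → ℂ) : Submodule ℂ (Fin (n + 1) → ℂ) :=
  LinearMap.ker (dotProductBilin ℂ ℂ l)

lemma mem_hyperplaneSpace {l v : Fin (n + 1) → ℂ} : v ∈ hyperplaneSpace l ↔ l ⬝ᵥ v = 0 := by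
  simp [hyperplaneSpace]

/-- On a hyperplane of a family in general position, a polynomial of degree `k` that vanishes on `k`
other hyperplanes of the family is a multiple of the product of their equations. -/
lemma GenPos.exists_eval_eq_const_mul_prod_on {ι κ : Type*} [Fintype ι] [Fintype κ]
    {f : ι → Fin (n + 1) → ℂ} (hf : GenPos f) (hn : 1 ≤ n) {b : κ → ι} (hb : Function.Injective b)
    {i₀ : ι} (hi₀ : ∀ j, b j ≠ i₀) {G : Coord n}
    (hG : ∀ j v, f i₀ ⬝ᵥ v = 0 → f (b j) ⬝ᵥ v = 0 → MvPolynomial.eval v G = 0)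
    (hdeg : ∀ (t : ℂ) v,
      MvPolynomial.eval (t • v) G = t ^ Fintype.card κ * MvPolynomial.eval v G) :
    ∃ ε : ℂ, ∀ v, f i₀ ⬝ᵥ v = 0 → MvPolynomial.eval v G = ε * ∏ j, f (b j) ⬝ᵥ v := by
  have hl : ∀ j, ∃ v, f i₀ ⬝ᵥ v = 0 ∧ f (b j) ⬝ᵥ v ≠ 0 := by
    intro j
    obtain ⟨v, hv⟩ := hf.exists_dotProduct_eq (m := 2) (by omega) (b := ![i₀, b j]) (by
      intro s t hst
      fin_cases s <;> fin_cases t <;> simp_all [(hi₀ _).symm]) ![0, 1]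
    have h0 := hv 0
    have h1 := hv 1
    simp at h0 h1
    exact ⟨v, h0, by rw [h1]; exact one_ne_zero⟩
  rcases eq_or_lt_of_le hn with rfl | hn2
  · -- on the projective line the hyperplane is a point, where the product does not vanish
    obtain ⟨v₁, hv₁⟩ : ∃ v₁ : Fin 2 → ℂ, v₁ = ![f i₀ 1, -f i₀ 0] := ⟨_, rfl⟩
    have hspan : ∀ v : Fin 2 → ℂ, f i₀ ⬝ᵥ v = 0 → ∃ t : ℂ, v = t • v₁ := by
      intro v hv
      have h0 := hf.ne_zero i₀
      rw [dotProduct, Fin.sum_univ_two] at hv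
      by_cases h1 : f i₀ 1 = 0
      · have h00 : f i₀ 0 ≠ 0 := by
          intro h00
          exact h0 (by ext i; fin_cases i; exacts [h00, h1])
        rw [h1, zero_mul, add_zero] at hv
        have hv0 := (mul_eq_zero.1 hv).resolve_left h00
        refine ⟨-(v 1 / f i₀ 0), ?_⟩
        ext i
        fin_cases i
        · simp [hv₁, h1, hv0]
        · simp [hv₁]; field_simp
      · refine ⟨v 0 / f i₀ 1, ?_⟩
        ext i
        fin_cases i
        · simp [hv₁]; field_simp
        · simp [hv₁]; field_simp; linear_combination hv
    have hQ : ∏ j, f (b j) ⬝ᵥ v₁ ≠ 0 := by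
      rw [Finset.prod_ne_zero_iff]
      intro j _ h0
      obtain ⟨v, hv, hv'⟩ := hl j
      obtain ⟨t, rfl⟩ := hspan v hv
      rw [dotProduct_smul, h0, smul_zero] at hv'
      exact hv' rfl
    refine ⟨MvPolynomial.eval v₁ G / ∏ j, f (b j) ⬝ᵥ v₁, fun v hv => ?_⟩
    obtain ⟨t, rfl⟩ := hspan v hv
    rw [hdeg]
    simp only [dotProduct_smul, smul_eq_mul, Finset.prod_mul_distrib, Finset.prod_const]
    rw [Finset.card_univ]
    field_simp
  · have hmain := exists_eval_eq_const_mul_prod (U := hyperplaneSpace (f i₀))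
      (Finset.univ : Finset κ) (fun j => f (b j)) (G := G) ?_ ?_ ?_ ?_
    · obtain ⟨ε, hε⟩ := hmain
      exact ⟨ε, fun v hv => hε v (mem_hyperplaneSpace.2 hv)⟩
    · intro j _
      obtain ⟨v, hv⟩ := hl j
      exact ⟨v, mem_hyperplaneSpace.2 hv.1, hv.2⟩
    · intro i _ j _ hij
      have hij' : b i ≠ b j := fun h => hij (hb h)
      obtain ⟨v, hv⟩ := hf.exists_dotProduct_eq (m := 3) (by omega) (b := ![i₀, b i, b j]) (by
        intro s t hst
        fin_cases s <;> fin_cases t <;> simp_all [(hi₀ _).symm, hij'.symm]) ![0, 0, 1]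
      have h0 := hv 0
      have h1 := hv 1
      have h2 := hv 2
      simp at h0 h1 h2
      exact ⟨v, mem_hyperplaneSpace.2 h0, h1, by rw [h2]; exact one_ne_zero⟩
    · intro j _ v hv h
      exact hG j v (mem_hyperplaneSpace.1 hv) h
    · intro t v _
      rw [Finset.card_univ]
      exact hdeg t v

/-- The polynomial form of the residue theorem: numerators of the coefficients of a logarithmic
form are determined by constant residues `ε` along the polar hyperplanes `y b`, up to constants. -/
lemma exists_residues {z : Fin n → Fin (n + 1) → ℂ} {y : Fin k → Fin (n + 1) → ℂ}
    (hf : GenPos (Sum.elim z y)) (hn : 1 ≤ n) (hk : 1 ≤ k) (B : Fin k → Fin n → ℂ)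
    (G : Fin n → Coord n)
    (hdeg : ∀ i (t : ℂ) v, MvPolynomial.eval (t • v) (G i) = t ^ k * MvPolynomial.eval v (G i))
    (hloc : ∀ v : Fin (n + 1) → ℂ, v ≠ 0 → ∃ (α : Fin n → ℂ) (β : Fin k → ℂ), ∀ i,
      MvPolynomial.eval v (G i) = α i * ∏ b, y b ⬝ᵥ v +
        ∑ b, β b * B b i * (z i ⬝ᵥ v) * ∏ b' ∈ Finset.univ.erase b, y b' ⬝ᵥ v) :
    ∃ (a : Fin n → ℂ) (ε : Fin k → ℂ), ∀ i v,
      MvPolynomial.eval v (G i) = a i * ∏ b, y b ⬝ᵥ v +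
        ∑ b, ε b * B b i * (z i ⬝ᵥ v) * ∏ b' ∈ Finset.univ.erase b, y b' ⬝ᵥ v := by
  classical
  -- on the hyperplane `y b = 0` only one term survives
  have hterm : ∀ b v, y b ⬝ᵥ v = 0 → ∀ (α : Fin n → ℂ) (β : Fin k → ℂ) (i : Fin n),
      α i * ∏ b, y b ⬝ᵥ v +
        ∑ b, β b * B b i * (z i ⬝ᵥ v) * ∏ b' ∈ Finset.univ.erase b, y b' ⬝ᵥ v =
      β b * B b i * ((z i ⬝ᵥ v) * ∏ b' ∈ Finset.univ.erase b, y b' ⬝ᵥ v) := by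
    intro b v hv α β i
    rw [Finset.prod_eq_zero (Finset.mem_univ b) hv, mul_zero, zero_add, Finset.sum_eq_single b]
    · rw [mul_assoc]
    · intro b' _ hb'
      rw [Finset.prod_eq_zero (i := b) (by simpa using hb'.symm) hv, mul_zero]
    · simp
  have hzero : ∀ i, MvPolynomial.eval 0 (G i) = 0 := by
    intro i
    have := hdeg i 0 0
    rwa [smul_zero, zero_pow (by omega), zero_mul] at this
  let l : Fin n → Fin k → Fin k → Fin n ⊕ Fin k := fun i b b' =>
    if b' = b then Sum.inl i else Sum.inr b'
  have hprod : ∀ i b v, ∏ b', Sum.elim z y (l i b b') ⬝ᵥ v =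
      (z i ⬝ᵥ v) * ∏ b' ∈ Finset.univ.erase b, y b' ⬝ᵥ v := by
    intro i b v
    rw [← Finset.mul_prod_erase _ _ (Finset.mem_univ b)]
    congr 1
    · simp [l]
    · refine Finset.prod_congr rfl fun b' hb' => ?_
      simp [l, Finset.ne_of_mem_erase hb']
  -- so `G i` vanishes there on the `k` hyperplanes of `l i b`, and has degree `k`
  have hres : ∀ i b, ∃ ε : ℂ, ∀ v, y b ⬝ᵥ v = 0 → MvPolynomial.eval v (G i) =
      ε * ((z i ⬝ᵥ v) * ∏ b' ∈ Finset.univ.erase b, y b' ⬝ᵥ v) := by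
    intro i b
    have hmain := hf.exists_eval_eq_const_mul_prod_on hn (b := l i b) ?_ (i₀ := Sum.inr b) ?_
      (G := G i) ?_ (by simpa using hdeg i)
    · obtain ⟨ε, hε⟩ := hmain
      refine ⟨ε, fun v hv => ?_⟩
      rw [hε v hv, hprod]
    · intro b₁ b₂ h
      simp only [l] at h
      split_ifs at h with h1 h2 h2
      · rw [h1, h2]
      · exact Sum.inr_injective h
    · intro b' h
      simp only [l] at h
      split_ifs at h with h1
      exact h1 (Sum.inr_injective h)
    · intro j v hv hj
      by_cases hv0 : v = 0
      · rw [hv0, hzero]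
      · obtain ⟨α, β, h⟩ := hloc v hv0
        rw [h, hterm b v hv, ← hprod, Finset.prod_eq_zero (Finset.mem_univ j) hj, mul_zero]
  choose ε' hε' using hres
  have hgen : ∀ b, ∃ v, y b ⬝ᵥ v = 0 ∧ ∀ i, (z i ⬝ᵥ v) *
      ∏ b' ∈ Finset.univ.erase b, y b' ⬝ᵥ v ≠ 0 := by
    intro b
    obtain ⟨v, hv, h⟩ := exists_forall_eval_ne_zero (U := hyperplaneSpace (y b))
      (Finset.univ.erase (Sum.inr b)) (fun i => linForm (Sum.elim z y i)) (by
        intro i hi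
        have hi' := Finset.ne_of_mem_erase hi
        obtain ⟨v, hv⟩ := hf.exists_dotProduct_eq (m := 2) (by omega) (b := ![Sum.inr b, i]) (by
          intro s t hst
          fin_cases s <;> fin_cases t <;> simp_all [hi'.symm]) ![0, 1]
        have h0 := hv 0
        have h1 := hv 1
        simp at h0 h1
        exact ⟨v, mem_hyperplaneSpace.2 h0, by rw [eval_linForm, h1]; exact one_ne_zero⟩)
    refine ⟨v, mem_hyperplaneSpace.1 hv, fun i => mul_ne_zero ?_ ?_⟩
    · have := h (Sum.inl i) (by simp)
      rwa [eval_linForm] at this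
    · rw [Finset.prod_ne_zero_iff]
      intro b' hb'
      have := h (Sum.inr b') (by simpa using hb')
      rwa [eval_linForm] at this
  -- at one general point of `y b = 0`, the residues for all `i` come from the same number `β b`
  have hres' : ∃ ε : Fin k → ℂ, ∀ b i v, y b ⬝ᵥ v = 0 → MvPolynomial.eval v (G i) =
      ε b * B b i * ((z i ⬝ᵥ v) * ∏ b' ∈ Finset.univ.erase b, y b' ⬝ᵥ v) := by
    have : ∀ b, ∃ εb : ℂ, ∀ i, ε' i b = εb * B b i := by
      intro b
      obtain ⟨v, hv, hne⟩ := hgen b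
      have hv0 : v ≠ 0 := by
        rintro rfl
        have := hne ⟨0, hn⟩
        simp at this
      obtain ⟨α, β, h⟩ := hloc v hv0
      refine ⟨β b, fun i => ?_⟩
      have h1 := h i
      rw [hterm b v hv, hε' i b v hv] at h1
      exact mul_right_cancel₀ (hne i) h1
    choose ε hε using this
    exact ⟨ε, fun b i v hv => by rw [hε' i b v hv, hε]⟩
  obtain ⟨ε, hε⟩ := hres'
  -- what remains after subtracting the polar parts vanishes on all the polar hyperplanes
  have hconst : ∀ i, ∃ a : ℂ, ∀ v, MvPolynomial.eval v (G i) = a * ∏ b, y b ⬝ᵥ v +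
        ∑ b, ε b * B b i * (z i ⬝ᵥ v) * ∏ b' ∈ Finset.univ.erase b, y b' ⬝ᵥ v := by
    intro i
    let G' : Coord n := G i - ∑ b, MvPolynomial.C (ε b * B b i) * linForm (z i) *
      ∏ b' ∈ Finset.univ.erase b, linForm (y b')
    have hG' : ∀ v, MvPolynomial.eval v G' = MvPolynomial.eval v (G i) -
        ∑ b, ε b * B b i * (z i ⬝ᵥ v) * ∏ b' ∈ Finset.univ.erase b, y b' ⬝ᵥ v := by
      intro v
      simp only [G', map_sub, map_sum, map_mul, MvPolynomial.eval_C, eval_linForm, map_prod]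
    have hmain := exists_eval_eq_const_mul_prod (U := ⊤) Finset.univ y (G := G') ?_ ?_ ?_ ?_
    · obtain ⟨a, ha⟩ := hmain
      refine ⟨a, fun v => ?_⟩
      rw [← ha v trivial, hG']
      ring
    · intro b _
      obtain ⟨v, hv⟩ := hf.exists_dotProduct_eq (m := 1) (by omega) (b := ![Sum.inr b])
        (Function.injective_of_subsingleton _) ![1]
      have := hv 0
      simp at this
      exact ⟨v, trivial, by rw [this]; exact one_ne_zero⟩
    · intro b _ b' _ hbb'
      obtain ⟨v, hv⟩ := hf.exists_dotProduct_eq (m := 2) (by omega)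
        (b := ![Sum.inr b, Sum.inr b']) (by
          intro s t hst
          fin_cases s <;> fin_cases t <;> simp_all [hbb'.symm]) ![0, 1]
      have h0 := hv 0
      have h1 := hv 1
      simp at h0 h1
      exact ⟨v, trivial, h0, by rw [h1]; exact one_ne_zero⟩
    · intro b _ v _ hv
      have := hterm b v hv 0 ε i
      simp only [Pi.zero_apply, zero_mul, zero_add] at this
      rw [hG', this, hε b i v hv, sub_self]
    · intro t v _
      rw [hG', hG', hdeg, mul_sub, Finset.card_univ, Fintype.card_fin, Finset.mul_sum]
      congr 1
      refine Finset.sum_congr rfl fun b _ => ?_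
      simp only [dotProduct_smul, smul_eq_mul, Finset.prod_mul_distrib, Finset.prod_const]
      rw [Finset.card_erase_of_mem (Finset.mem_univ b), Finset.card_univ, Fintype.card_fin]
      obtain ⟨k, rfl⟩ : ∃ k', k = k' + 1 := ⟨k - 1, by omega⟩
      rw [Nat.add_sub_cancel]
      ring
  choose a ha using hconst
  exact ⟨a, ε, fun i v => ha i v⟩

variable {f : Fin (n + k + 1) → Fin (n + 1) → ℂ}

lemma exists_coeff_of_mem_lgSpan (hf : GenPos f) {p : Point n} {ω : Ω[FunField n⁄ℂ]}
    (hω : ω ∈ lgSpan f p) : ∃ u : Fin (n + k) → FunField n, (∀ j, u j ∈ localRing p) ∧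
      ω = ∑ j, u j • lg (f j.castSucc) (f (Fin.last _)) := by
  have h1 : lgSpan f p ≤ Submodule.span (localRing p)
      (Set.range fun j : Fin (n + k) => lg (f j.castSucc) (f (Fin.last _))) := by
    refine Submodule.span_le.2 ?_
    have key : ∀ i, lg (f i) (f (Fin.last _)) ∈ Submodule.span (localRing p)
      (Set.range fun j : Fin (n + k) => lg (f j.castSucc) (f (Fin.last _))) := by
      intro i
      refine Fin.lastCases ?_ (fun j => Submodule.subset_span ⟨j, rfl⟩) i
      rw [lg_self (hf.ne_zero _)]
      exact zero_mem _
    rintro _ ⟨⟨i, j⟩, rfl⟩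
    have h3 := lg_add_lg (hf.ne_zero i) (hf.ne_zero j) (hf.ne_zero (Fin.last _))
    rw [← eq_sub_iff_add_eq] at h3
    dsimp only
    rw [h3]
    exact sub_mem (key i) (key j)
  obtain ⟨c, hc⟩ := (Submodule.mem_span_range_iff_exists_fun _).1 (h1 hω)
  exact ⟨fun j => c j, fun j => (c j).2, hc.symm⟩

/-- The global sections of the bundle of logarithmic forms are the constant combinations of the
logarithmic differentials of the equations. -/
lemma exists_const_of_forall_mem_lgSpan (hf : GenPos f) (hn : 1 ≤ n) (hk : 1 ≤ k)
    {ω : Ω[FunField n⁄ℂ]} (hω : ∀ p, ω ∈ lgSpan f p) :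
    ∃ a : Fin (n + k) → ℂ, ω = ∑ j, a j • lg (f j.castSucc) (f (Fin.last _)) := by
  classical
  set o := f (Fin.last (n + k)) with ho
  set z : Fin n → Fin (n + 1) → ℂ := fun i => f (Fin.castAdd k i).castSucc with hz
  set y : Fin k → Fin (n + 1) → ℂ := fun a => f (Fin.natAdd n a).castSucc with hy
  have ho0 : o ≠ 0 := hf.ne_zero _
  have hy0 : ∀ b, y b ≠ 0 := fun b => hf.ne_zero _
  have hyc : ∀ b, toCone (linForm (y b)) ≠ 0 := fun b => toCone_linForm_ne_zero (hy0 b)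
  have hzy : GenPos (Sum.elim z y) := by
    have h := hf.comp_injective (g := Fin.castSucc ∘ finSumFinEquiv)
      ((Fin.castSucc_injective _).comp finSumFinEquiv.injective)
    have h' : f ∘ Fin.castSucc ∘ finSumFinEquiv = Sum.elim z y := by
      funext i
      rcases i with i | i <;> rfl
    rwa [h'] at h
  -- the equations `y b` in terms of the other ones
  have hB : ∃ B : Fin k → Fin n → ℂ, ∀ b,
      lg (y b) o = ∑ i, B b i • (lin (z i) (y b) • lg (z i) o) := by
    have : ∀ b, ∃ B : Fin n → ℂ, lg (y b) o = ∑ i, B i • (lin (z i) (y b) • lg (z i) o) := by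
      intro b
      have h1 : y b ∈ Submodule.span ℂ (Set.range (f ∘ lastCons n k)) := by
        rw [span_range_eq_top (hf.linearIndependent le_rfl (lastCons_injective n k))]; trivial
      obtain ⟨c, hc⟩ := (Submodule.mem_span_range_iff_exists_fun ℂ).1 h1
      refine ⟨fun i => c i.succ, ?_⟩
      rw [lg_eq_sum Finset.univ (fun j _ => hf.ne_zero (lastCons n k j)) c hc.symm ho0,
        Fin.sum_univ_succ]
      have : lastCons n k 0 = Fin.last _ := rfl
      rw [this, ← ho, lg_self ho0, smul_zero, smul_zero, zero_add]
      rfl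
    choose B hB using this
    exact ⟨B, hB⟩
  obtain ⟨B, hB⟩ := hB
  have hbasis : ∀ i, lgBasisLast hf i = lg (z i) o := lgBasisLast_apply hf
  have hrepr : ∀ (α : Fin n → FunField n) (β : Fin k → FunField n) (i : Fin n),
      (lgBasisLast hf).repr (∑ i, α i • lg (z i) o + ∑ b, β b • lg (y b) o) i =
      α i + ∑ b, β b * (B b i • lin (z i) (y b)) := by
    intro α β i
    have h1 : ∑ i, α i • lg (z i) o + ∑ b, β b • lg (y b) o =
        ∑ i, (α i + ∑ b, β b * (B b i • lin (z i) (y b))) • lgBasisLast hf i := by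
      simp only [add_smul, Finset.sum_add_distrib, hbasis, Finset.sum_smul, hB, Finset.smul_sum]
      congr 1
      rw [Finset.sum_comm]
      refine Finset.sum_congr rfl fun i _ => Finset.sum_congr rfl fun b _ => ?_
      rw [← smul_assoc (B b i), smul_smul]
    rw [h1, Module.Basis.repr_sum_self]
  let D : Coord n := ∏ b, linForm (y b)
  have hD0 : toCone D ≠ 0 := by
    simp only [D, toCone, map_prod]
    exact Finset.prod_ne_zero_iff.2 fun b _ => hyc b
  have hD : ∀ b, toCone D = toCone (linForm (y b)) *
      toCone (∏ b' ∈ Finset.univ.erase b, linForm (y b')) := by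
    intro b
    have h1 := Finset.mul_prod_erase Finset.univ (fun b => linForm (y b)) (Finset.mem_univ b)
    simp only [D, toCone]
    rw [← map_mul, h1]
  have hnum : ∀ (α : Fin n → FunField n) (β : Fin k → FunField n) (i : Fin n),
      (α i + ∑ b, β b * (B b i • lin (z i) (y b))).val * toCone D =
      (α i).val * toCone D + ∑ b, (β b).val * algebraMap ℂ (ConeField n) (B b i) *
        toCone (linForm (z i)) * toCone (∏ b' ∈ Finset.univ.erase b, linForm (y b')) := by
    intro α β i
    rw [map_add, add_mul, map_sum, Finset.sum_mul]
    congr 1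
    refine Finset.sum_congr rfl fun b _ => ?_
    rw [map_mul, map_smul, val_lin, hD b, Algebra.smul_def]
    have := hyc b
    field_simp
  -- the coefficients of `ω`, multiplied with the product of the `y b`, are polynomials
  have hloc : ∀ p : Point n, ∃ (α : Fin n → FunField n) (β : Fin k → FunField n),
      (∀ i, α i ∈ localRing p) ∧ (∀ b, β b ∈ localRing p) ∧
      ω = ∑ i, α i • lg (z i) o + ∑ b, β b • lg (y b) o := by
    intro p
    obtain ⟨u, hu, h⟩ := exists_coeff_of_mem_lgSpan hf (hω p)
    refine ⟨fun i => u (Fin.castAdd k i), fun b => u (Fin.natAdd n b), fun i => hu _,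
      fun b => hu _, ?_⟩
    rw [h, Fin.sum_univ_add]
  have hDhom : ∀ b, (∏ b' ∈ Finset.univ.erase b, linForm (y b')).IsHomogeneous (k - 1) := by
    intro b
    have := MvPolynomial.IsHomogeneous.prod (Finset.univ.erase b) (fun b' => linForm (y b'))
      (fun _ => 1) fun b' _ => isHomogeneous_linForm _
    simpa using this
  have hDhom' : D.IsHomogeneous k := by
    have := MvPolynomial.IsHomogeneous.prod Finset.univ (fun b' => linForm (y b'))
      (fun _ => 1) fun b' _ => isHomogeneous_linForm _
    simpa using this
  have hreg : ∀ i p, RegAt k p (((lgBasisLast hf).repr ω i).val * toCone D) := by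
    intro i p
    obtain ⟨α, β, hα, hβ, rfl⟩ := hloc p
    rw [hrepr, hnum]
    refine RegAt.add ?_ (RegAt.sum fun b _ => ?_)
    · have := RegAt.mul (mem_localRing_iff.1 (hα i)) (RegAt.of_isHomogeneous p hDhom')
      rwa [zero_add] at this
    · have := (((mem_localRing_iff.1 (hβ b)).mul (RegAt.const p (B b i))).mul
        (RegAt.linForm p (z i))).mul (RegAt.of_isHomogeneous p (hDhom b))
      have hk' : 0 + 0 + 1 + (k - 1) = k := by omega
      rwa [hk'] at this
  have hpoly := fun i => exists_eq_toCone_of_regAt hn (hreg i)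
  choose G hG hGdeg using hpoly
  obtain ⟨a, ε, hres⟩ := exists_residues hzy hn hk B G hGdeg (by
    intro v hv
    obtain ⟨p, c, hc, hp⟩ := exists_smul_rep hv
    obtain ⟨α, β, hα, hβ, hω'⟩ := hloc p
    choose α' hα' using fun i => (mem_localRing_iff.1 (hα i)).exists_hasVal
    choose β' hβ' using fun b => (mem_localRing_iff.1 (hβ b)).exists_hasVal
    refine ⟨α', β', fun i => ?_⟩
    have h1 : HasVal p.rep (toCone (G i)) (α' i * ∏ b, y b ⬝ᵥ p.rep +
        ∑ b, β' b * B b i * (z i ⬝ᵥ p.rep) *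
          ∏ b' ∈ Finset.univ.erase b, y b' ⬝ᵥ p.rep) := by
      rw [← hG i, hω', hrepr, hnum]
      refine HasVal.add ((hα' i).mul ?_) (HasVal.sum fun b _ =>
        (((hβ' b).mul (HasVal.const _ _)).mul (HasVal.linForm _ _)).mul ?_)
      · have := HasVal.of_poly p.rep D
        simpa only [D, map_prod, eval_linForm] using this
      · have := HasVal.of_poly p.rep (∏ b' ∈ Finset.univ.erase b, linForm (y b'))
        simpa only [map_prod, eval_linForm] using this
    have h2 := (HasVal.of_poly p.rep (G i)).unique h1
    rw [hp, hGdeg] at h2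
    simp only [dotProduct_smul, smul_eq_mul, Finset.prod_mul_distrib, Finset.prod_const,
      Finset.card_erase_of_mem (Finset.mem_univ _), Finset.card_univ, Fintype.card_fin] at h2
    have h3 : c ^ k = c * c ^ (k - 1) := by
      rw [← pow_succ', Nat.sub_add_cancel hk]
    refine mul_left_cancel₀ (pow_ne_zero k hc) (h2.trans ?_)
    rw [mul_add, Finset.mul_sum]
    congr 1
    · ring
    · refine Finset.sum_congr rfl fun b _ => ?_
      rw [h3]; ring)
  refine ⟨fun j => Fin.addCases a ε j, ?_⟩
  rw [Fin.sum_univ_add]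
  simp only [Fin.addCases_left, Fin.addCases_right]
  have hfin : ω = ∑ i, (algebraMap ℂ (FunField n) (a i)) • lg (z i) o +
      ∑ b, (algebraMap ℂ (FunField n) (ε b)) • lg (y b) o := by
    apply (lgBasisLast hf).ext_elem
    intro i
    rw [hrepr]
    apply val_injective
    refine mul_right_cancel₀ hD0 ?_
    rw [hG]
    refine Eq.trans ?_ (hnum (fun i => algebraMap ℂ (FunField n) (a i))
      (fun b => algebraMap ℂ (FunField n) (ε b)) i).symm
    have hGi : G i = MvPolynomial.C (a i) * D + ∑ b, MvPolynomial.C (ε b) *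
        MvPolynomial.C (B b i) * linForm (z i) * ∏ b' ∈ Finset.univ.erase b, linForm (y b') := by
      refine MvPolynomial.funext fun v => ?_
      rw [hres]
      simp only [D, map_add, map_mul, map_sum, map_prod, MvPolynomial.eval_C, eval_linForm]
    rw [hGi]
    simp only [toCone, map_add, map_mul, map_sum, AlgHom.commutes,
      IsScalarTower.algebraMap_apply ℂ (Coord n) (ConeField n), MvPolynomial.algebraMap_eq]
  rw [hfin]
  simp only [algebraMap_smul]
  rfl

end GlobalSections

/-! ### Uniqueness of the Steiner matrix -/

section SteinerUnique

variable {n k : ℕ}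

lemma isHomogeneous_det {M : Matrix (Fin k) (Fin k) (Coord n)}
    (h : ∀ a b, (M a b).IsHomogeneous 1) : M.det.IsHomogeneous k := by
  rw [Matrix.det_apply]
  refine MvPolynomial.IsHomogeneous.sum _ _ _ fun σ _ => ?_
  have h1 : (∏ i, M (σ i) i).IsHomogeneous k := by
    have := MvPolynomial.IsHomogeneous.prod Finset.univ (fun i => M (σ i) i) (fun _ => 1)
      fun i _ => h _ _
    simpa using this
  rcases Int.units_eq_one_or (Equiv.Perm.sign σ) with h2 | h2 <;> rw [h2]
  · simpa using h1
  · simpa using h1.neg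

lemma isHomogeneous_cramer {M : Matrix (Fin k) (Fin k) (Coord n)}
    (h : ∀ a b, (M a b).IsHomogeneous 1) {r : Fin k → Coord n} (hr : ∀ a, (r a).IsHomogeneous 1)
    (b : Fin k) : (M.cramer r b).IsHomogeneous k := by
  rw [Matrix.cramer_apply]
  refine isHomogeneous_det fun a c => ?_
  rw [Matrix.updateCol_apply]
  split_ifs
  exacts [hr a, h a c]

/-- Cramer's rule for a system of equations with polynomial coefficients. -/
lemma cramer_solve {M : Matrix (Fin k) (Fin k) (Coord n)} (hM : M.det ≠ 0) (r : Fin k → Coord n)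
    (x : Fin k → ConeField n) :
    (∀ a, ∑ b, toCone (M a b) * x b = toCone (r a)) ↔
      ∀ b, x b = toCone (M.cramer r b) / toCone M.det := by
  have hM' := toCone_ne_zero hM
  have hsol : ∀ a, ∑ b, toCone (M a b) * (toCone (M.cramer r b) / toCone M.det) =
      toCone (r a) := by
    intro a
    have h1 := congrArg toCone (congrFun (Matrix.mulVec_cramer M r) a)
    simp only [Matrix.mulVec, dotProduct, Pi.smul_apply, smul_eq_mul, toCone, map_sum,
      map_mul] at h1
    simp only [← mul_div_assoc]
    rw [← Finset.sum_div, div_eq_iff hM', mul_comm _ (toCone M.det)]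
    exact h1
  constructor
  · intro h
    have hdet : (M.map (algebraMap (Coord n) (ConeField n))).det ≠ 0 := by
      rw [← RingHom.mapMatrix_apply, ← RingHom.map_det]
      exact hM'
    have := Matrix.eq_zero_of_mulVec_eq_zero hdet
      (v := fun b => x b - toCone (M.cramer r b) / toCone M.det) (by
        ext a
        simp only [Matrix.mulVec, dotProduct, Matrix.map_apply, mul_sub, Finset.sum_sub_distrib]
        exact sub_eq_zero.2 ((h a).trans (hsol a).symm))
    exact fun b => sub_eq_zero.1 (congrFun this b)
  · intro h a
    simp only [h]
    exact hsol a

/-- The square submatrix of a matrix of linear forms with the columns `J b`. -/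
def minorMatrix (A : LinMatrix n k) (J : Fin k → Fin (n + k)) :
    Matrix (Fin k) (Fin k) (Coord n) :=
  Matrix.of fun a b => linForm (A a (J b))

lemma isHomogeneous_minorMatrix (A : LinMatrix n k) (J : Fin k → Fin (n + k)) (a b : Fin k) :
    (minorMatrix A J a b).IsHomogeneous 1 := isHomogeneous_linForm _

lemma eval_det {v : Fin (n + 1) → ℂ} (M : Matrix (Fin k) (Fin k) (Coord n)) :
    MvPolynomial.eval v M.det = (Matrix.of fun a b => MvPolynomial.eval v (M a b)).det := by
  rw [RingHom.map_det]
  rfl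

lemma Nondegenerate.exists_minor {A : LinMatrix n k} (hA : Nondegenerate A) (p : Point n) :
    ∃ J : Fin k → Fin (n + k), MvPolynomial.eval p.rep (minorMatrix A J).det ≠ 0 := by
  have hrank := hA p
  rw [Matrix.rank_eq_finrank_span_cols] at hrank
  set M : Matrix (Fin k) (Fin (n + k)) ℂ := Matrix.of fun a j => ∑ i, A a j i * p.rep i with hM
  obtain ⟨g, hg, -, hLI⟩ := Submodule.exists_fun_fin_finrank_span_eq ℂ (Set.range M.col)
  choose J hJ using hg
  have hLI' : LinearIndependent ℂ fun b : Fin k => M.col (J (Fin.cast hrank.symm b)) := by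
    have h1 : (fun b : Fin k => M.col (J (Fin.cast hrank.symm b))) = g ∘ Fin.cast hrank.symm :=
      funext fun b => hJ _
    rw [h1]
    exact hLI.comp (Fin.cast hrank.symm) (Fin.cast_injective _)
  refine ⟨fun b => J (Fin.cast hrank.symm b), ?_⟩
  rw [eval_det]
  have h1 : (Matrix.of fun a b => MvPolynomial.eval p.rep
      (minorMatrix A (fun b => J (Fin.cast hrank.symm b)) a b)).col =
      fun b : Fin k => M.col (J (Fin.cast hrank.symm b)) := by
    ext b a
    simp [minorMatrix, eval_linForm, hM, dotProduct]
  rw [← h1, Matrix.linearIndependent_cols_iff_isUnit, Matrix.isUnit_iff_isUnit_det] at hLI'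
  exact hLI'.ne_zero

lemma Nondegenerate.eq_zero_of_comb {A : LinMatrix n k} (hA : Nondegenerate A)
    {v : Fin (n + 1) → ℂ} (hv : v ≠ 0) {u : Fin k → ℂ} (hu : ∀ j, ∑ a, u a * (A a j ⬝ᵥ v) = 0) :
    u = 0 := by
  obtain ⟨p, c, hc, hp⟩ := exists_smul_rep hv
  obtain ⟨J, hJ⟩ := hA.exists_minor p
  rw [eval_det] at hJ
  refine Matrix.eq_zero_of_vecMul_eq_zero hJ ?_
  ext b
  have := hu (J b)
  simp only [Matrix.vecMul, dotProduct, Matrix.of_apply, minorMatrix, eval_linForm, Pi.zero_apply]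
  rw [hp]
  have h1 : ∀ a, u a * ∑ i, A a (J b) i * (c • v) i = c * (u a * (A a (J b) ⬝ᵥ v)) := by
    intro a
    have : ∑ i, A a (J b) i * (c • v) i = A a (J b) ⬝ᵥ (c • v) := rfl
    rw [this, dotProduct_smul, smul_eq_mul]
    ring
  simp only [h1]
  rw [← Finset.mul_sum, this, mul_zero]

lemma val_smul (c : ℂ) (x : FunField n) :
    (c • x).val = algebraMap ℂ (ConeField n) c * x.val := by
  rw [← Algebra.smul_def]
  exact map_smul FunField.val c x

lemma exists_val_eq_div {a b : Coord n} {d : ℕ} (ha : a.IsHomogeneous d) (hb : b.IsHomogeneous d)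
    (hb0 : b ≠ 0) : ∃ x : FunField n, x.val = toCone a / toCone b :=
  ⟨(⟨toCone a / toCone b, d, a, b, ha, hb, hb0, rfl⟩ : degreeZero n), rfl⟩

/-- No nonzero constant functional vanishes on the kernel of a nondegenerate matrix: it would be a
combination of the rows with coefficients in `H⁰(O(-1)) = 0`. -/
lemma Nondegenerate.eq_zero_of_forall_kernelGeneric {A : LinMatrix n k} (hA : Nondegenerate A)
    (hn : 1 ≤ n) {c : Fin (n + k) → ℂ} (hc : ∀ w ∈ kernelGeneric A, ∑ l, c l • w l = 0) :
    c = 0 := by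
  classical
  -- every column of `A` is a combination of the columns of a nonzero minor
  have hcol : ∀ (J : Fin k → Fin (n + k)), (minorMatrix A J).det ≠ 0 → ∀ l,
      ∃ q : Fin k → FunField n, (∀ a, ∑ b, toCone (minorMatrix A J a b) * (q b).val =
        toCone (linForm (A a l))) ∧ algebraMap ℂ (FunField n) (c l) = ∑ b, c (J b) • q b := by
    intro J hJ l
    choose q hq using fun b => exists_val_eq_div (isHomogeneous_cramer
      (isHomogeneous_minorMatrix A J) (fun a => isHomogeneous_linForm (A a l)) b)
      (isHomogeneous_det (isHomogeneous_minorMatrix A J)) hJ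
    have h1 := (cramer_solve hJ (fun a => linForm (A a l)) fun b => (q b).val).2 hq
    refine ⟨q, h1, ?_⟩
    let w : Fin (n + k) → FunField n :=
      fun j => (if j = l then 1 else 0) - ∑ b, if J b = j then q b else 0
    have hw : w ∈ kernelGeneric A := by
      intro a
      simp only [w, map_sub, mul_sub, Finset.sum_sub_distrib, map_sum, Finset.mul_sum,
        apply_ite FunField.val, map_one, map_zero, mul_ite, mul_one, mul_zero,
        Finset.sum_ite_eq', Finset.mem_univ, if_true]
      rw [Finset.sum_comm]
      simp only [Finset.sum_ite_eq, Finset.mem_univ, if_true]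
      exact sub_eq_zero.2 (h1 a).symm
    have := hc w hw
    simp only [w, smul_sub, Finset.sum_sub_distrib, Finset.smul_sum, smul_ite, smul_zero,
      Finset.sum_ite_eq', Finset.mem_univ, if_true] at this
    rw [Finset.sum_comm] at this
    simp only [Finset.sum_ite_eq, Finset.mem_univ, if_true] at this
    rw [Algebra.algebraMap_eq_smul_one]
    exact sub_eq_zero.1 this
  have hone : (Pi.single 0 1 : Fin (n + 1) → ℂ) ≠ 0 := by simp
  obtain ⟨p₀, _⟩ := exists_smul_rep hone
  obtain ⟨J₀, hJ₀⟩ := hA.exists_minor p₀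
  let rhs : (Fin k → Fin (n + k)) → Fin k → Coord n :=
    fun J b => linForm (c (J b) • (Pi.single 0 1 : Fin (n + 1) → ℂ))
  have hΔ₀ := ne_zero_of_eval_ne_zero hJ₀
  have hsolve : ∀ (J : Fin k → Fin (n + k)), (minorMatrix A J).det ≠ 0 →
      ∀ x : Fin k → ConeField n, (∀ b, ∑ a, toCone (minorMatrix A J a b) * x a =
        toCone (rhs J b)) ↔ ∀ a, x a = toCone ((minorMatrix A J).transpose.cramer (rhs J) a) /
          toCone (minorMatrix A J).det := by
    intro J hJ x
    have := cramer_solve (M := (minorMatrix A J).transpose) (by rwa [Matrix.det_transpose])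
      (rhs J) x
    rw [Matrix.det_transpose] at this
    exact this
  -- the coefficients `g`, multiplied with a coordinate so that they have degree zero
  obtain ⟨g, hg⟩ : ∃ g : Fin k → ConeField n,
      ∀ b, ∑ a, toCone (minorMatrix A J₀ a b) * g a = toCone (rhs J₀ b) :=
    ⟨_, (hsolve J₀ hΔ₀ _).2 fun a => rfl⟩
  have hrhs : ∀ J b, toCone (rhs J b) = algebraMap ℂ (ConeField n) (c (J b)) *
      toCone (linForm (Pi.single 0 1)) := by
    intro J b
    simp only [rhs, linForm_smul, toCone, map_mul,
      IsScalarTower.algebraMap_apply ℂ (Coord n) (ConeField n), MvPolynomial.algebraMap_eq]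
  have hgl : ∀ l, ∑ a, toCone (linForm (A a l)) * g a =
      algebraMap ℂ (ConeField n) (c l) * toCone (linForm (Pi.single 0 1)) := by
    intro l
    obtain ⟨q, hq, hq'⟩ := hcol J₀ hΔ₀ l
    have h1 : algebraMap ℂ (ConeField n) (c l) =
        ∑ b, algebraMap ℂ (ConeField n) (c (J₀ b)) * (q b).val := by
      have := congrArg FunField.val hq'
      simpa only [map_sum, val_smul, AlgHom.commutes] using this
    rw [h1, Finset.sum_mul]
    have h2 : ∀ b, algebraMap ℂ (ConeField n) (c (J₀ b)) * (q b).val *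
        toCone (linForm (Pi.single 0 1)) =
        ∑ a, toCone (minorMatrix A J₀ a b) * g a * (q b).val := by
      intro b
      rw [← Finset.sum_mul, hg, hrhs]
      ring
    simp only [h2, ← hq, Finset.sum_mul]
    rw [Finset.sum_comm]
    refine Finset.sum_congr rfl fun b _ => Finset.sum_congr rfl fun a _ => ?_
    ring
  -- computed with a minor that does not vanish at `p`, the coefficients are regular at `p`
  have hreg : ∀ a p, RegAt 0 p (g a) := by
    intro a p
    obtain ⟨J, hJ⟩ := hA.exists_minor p
    have h1 := (hsolve J (ne_zero_of_eval_ne_zero hJ) g).1 fun b => by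
      rw [hrhs]; exact hgl (J b)
    refine ⟨k, _, _, ?_, isHomogeneous_det (isHomogeneous_minorMatrix A J), hJ, h1 a⟩
    exact isHomogeneous_cramer (fun a b => isHomogeneous_minorMatrix A J b a)
      (fun b => isHomogeneous_linForm _) a
  choose γ hγ using fun a => exists_eq_const_of_regAt hn (hreg a)
  have hlin : ∀ l, ∑ a, γ a • A a l = c l • (Pi.single 0 1 : Fin (n + 1) → ℂ) := by
    intro l
    apply linForm_injective
    apply toCone_injective
    rw [linForm_sum, linForm_smul]
    have := hgl l
    simp only [hγ] at this
    simp only [linForm_smul, toCone, map_sum, map_mul]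
    simp only [IsScalarTower.algebraMap_apply ℂ (Coord n) (ConeField n),
      MvPolynomial.algebraMap_eq] at this
    rw [← this]
    refine Finset.sum_congr rfl fun a _ => ?_
    ring
  have h01 : Fin.last n ≠ (0 : Fin (n + 1)) := by
    intro h
    have := congrArg Fin.val h
    simp at this
    omega
  have hγ0 : γ = 0 := by
    refine hA.eq_zero_of_comb (v := Pi.single (Fin.last n) 1) (by simp) fun j => ?_
    have := congrFun (hlin j) (Fin.last n)
    simpa [h01] using this
  ext l
  have := congrFun (hlin l) 0
  simpa [hγ0] using this.symm

/-- The matrices of the coefficients of the `i`-th variable. -/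
def slice (A : LinMatrix n k) (i : Fin (n + 1)) : Matrix (Fin k) (Fin (n + k)) ℂ :=
  Matrix.of fun a j => A a j i

/-- Equivalence of matrices of linear forms under invertible constant row and column operations. -/
def MatEquiv (A A' : LinMatrix n k) : Prop :=
  ∃ (P : Matrix (Fin k) (Fin k) ℂ) (Q : Matrix (Fin (n + k)) (Fin (n + k)) ℂ),
    IsUnit P.det ∧ IsUnit Q.det ∧ ∀ i, slice A i * Q = P * slice A' i

lemma MatEquiv.symm {A A' : LinMatrix n k} : MatEquiv A A' → MatEquiv A' A := by
  rintro ⟨P, Q, hP, hQ, h⟩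
  refine ⟨P⁻¹, Q⁻¹, P.isUnit_nonsing_inv_det hP, Q.isUnit_nonsing_inv_det hQ, fun i => ?_⟩
  have : slice A i = P * slice A' i * Q⁻¹ := by
    rw [← h, Matrix.mul_nonsing_inv_cancel_right _ _ hQ]
  rw [this, Matrix.mul_assoc, Matrix.nonsing_inv_mul_cancel_left _ _ hP]

lemma degeneracyIdeal_le_of_matEquiv {A A' : LinMatrix n k} (h : MatEquiv A A') :
    degeneracyIdeal A ≤ degeneracyIdeal A' := by
  obtain ⟨P, Q, hP, hQ, h⟩ := h
  refine Ideal.span_le.2 ?_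
  rintro _ ⟨ψ, hψ, rfl⟩
  let ψ' : Fin k → Fin k → Fin (n + 1) → ℂ := fun c b => ∑ a, P a b • ψ c a
  have hψ' : ∀ c j, ∑ b, ∑ i, ψ' c b i * A' b j i = 0 := by
    intro c j
    have h1 : ∀ i, ∑ b, ψ' c b i * A' b j i = ∑ a, ψ c a i * ∑ l, A a l i * Q l j := by
      intro i
      have h2 : ∀ a, ∑ l, A a l i * Q l j = ∑ b, P a b * A' b j i :=
        fun a => congrFun (congrFun (h i) a) j
      simp only [h2, ψ', Finset.sum_apply, Pi.smul_apply, smul_eq_mul, Finset.sum_mul,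
        Finset.mul_sum]
      rw [Finset.sum_comm]
      refine Finset.sum_congr rfl fun a _ => Finset.sum_congr rfl fun b _ => ?_
      ring
    rw [Finset.sum_comm]
    simp only [h1, Finset.mul_sum]
    rw [Finset.sum_comm' (t' := Finset.univ) (s' := fun _ => Finset.univ) (by simp)]
    have h3 : ∀ a, ∑ i, ∑ l, ψ c a i * (A a l i * Q l j) =
        ∑ l, Q l j * ∑ i, ψ c a i * A a l i := by
      intro a
      rw [Finset.sum_comm]
      refine Finset.sum_congr rfl fun l _ => ?_
      rw [Finset.mul_sum]
      refine Finset.sum_congr rfl fun i _ => ?_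
      ring
    simp only [h3]
    rw [Finset.sum_comm]
    refine Finset.sum_eq_zero fun l _ => ?_
    rw [← Finset.mul_sum, hψ, mul_zero]
  have hdet : (Matrix.of fun c b => linForm (ψ' c b)).det =
      (Matrix.of fun c a => linForm (ψ c a)).det * MvPolynomial.C P.det := by
    have : (Matrix.of fun c b => linForm (ψ' c b)) =
        (Matrix.of fun c a => linForm (ψ c a)) * P.map MvPolynomial.C := by
      ext1 c b
      simp only [Matrix.mul_apply, Matrix.of_apply, Matrix.map_apply, ψ', linForm_sum, linForm_smul]
      refine Finset.sum_congr rfl fun a _ => ?_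
      ring
    rw [this, Matrix.det_mul, RingHom.map_det, RingHom.mapMatrix_apply]
  have h1 : (Matrix.of fun c a => linForm (ψ c a)).det =
      MvPolynomial.C (P.det)⁻¹ * (Matrix.of fun c b => linForm (ψ' c b)).det := by
    rw [hdet, mul_comm, mul_assoc, ← MvPolynomial.C_mul, mul_inv_cancel₀ hP.ne_zero,
      MvPolynomial.C_1, mul_one]
  rw [SetLike.mem_coe, h1]
  exact Ideal.mul_mem_left _ _ (Ideal.subset_span ⟨ψ', hψ', rfl⟩)

lemma degeneracyIdeal_eq_of_matEquiv {A A' : LinMatrix n k} (h : MatEquiv A A') :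
    degeneracyIdeal A = degeneracyIdeal A' :=
  le_antisymm (degeneracyIdeal_le_of_matEquiv h) (degeneracyIdeal_le_of_matEquiv h.symm)

lemma toCone_linForm_eq_sum (l : Fin (n + 1) → ℂ) :
    toCone (linForm l) = ∑ i, algebraMap ℂ (ConeField n) (l i) * toCone (MvPolynomial.X i) := by
  simp only [linForm, toCone, map_sum, map_mul, MvPolynomial.algebraMap_eq,
    IsScalarTower.algebraMap_apply ℂ (Coord n) (ConeField n)]

lemma toCone_linForm_smul (c : ℂ) (l : Fin (n + 1) → ℂ) :
    toCone (linForm (c • l)) = algebraMap ℂ (ConeField n) c * toCone (linForm l) := by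
  simp only [linForm_smul, toCone, map_mul,
    IsScalarTower.algebraMap_apply ℂ (Coord n) (ConeField n), MvPolynomial.algebraMap_eq]

lemma sum_mul_comb {A A' : LinMatrix n k} {P : Matrix (Fin k) (Fin k) ℂ}
    {Q : Matrix (Fin (n + k)) (Fin (n + k)) ℂ} (h : ∀ i, slice A i * Q = P * slice A' i)
    (w : Fin (n + k) → FunField n) (a : Fin k) :
    ∑ l, toCone (linForm (A a l)) * (∑ j, Q l j • w j).val =
      ∑ b, algebraMap ℂ (ConeField n) (P a b) * ∑ j, toCone (linForm (A' b j)) * (w j).val := by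
  have h1 : ∀ i j, ∑ l, algebraMap ℂ (ConeField n) (A a l i) * algebraMap ℂ (ConeField n) (Q l j) =
      ∑ b, algebraMap ℂ (ConeField n) (P a b) * algebraMap ℂ (ConeField n) (A' b j i) := by
    intro i j
    have : ∑ l, A a l i * Q l j = ∑ b, P a b * A' b j i := congrFun (congrFun (h i) a) j
    simpa only [map_sum, map_mul] using congrArg (algebraMap ℂ (ConeField n)) this
  have h2 : ∀ j, ∑ l, toCone (linForm (A a l)) * algebraMap ℂ (ConeField n) (Q l j) =
      ∑ b, algebraMap ℂ (ConeField n) (P a b) * toCone (linForm (A' b j)) := by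
    intro j
    simp only [toCone_linForm_eq_sum, Finset.sum_mul, Finset.mul_sum]
    rw [Finset.sum_comm]
    rw [Finset.sum_comm (γ := Fin k)]
    refine Finset.sum_congr rfl fun i _ => ?_
    have := congrArg (· * toCone (MvPolynomial.X i)) (h1 i j)
    simp only [Finset.sum_mul] at this
    refine Eq.trans ?_ (this.trans ?_)
    · exact Finset.sum_congr rfl fun l _ => by ring
    · exact Finset.sum_congr rfl fun l _ => by ring
  simp only [map_sum, val_smul, Finset.mul_sum]
  rw [Finset.sum_comm, Finset.sum_comm (γ := Fin k)]
  refine Finset.sum_congr rfl fun j _ => ?_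
  have := congrArg (· * (w j).val) (h2 j)
  simp only [Finset.sum_mul] at this
  refine Eq.trans ?_ (this.trans ?_)
  · exact Finset.sum_congr rfl fun l _ => by ring
  · exact Finset.sum_congr rfl fun l _ => by ring

lemma mem_kernelGeneric_of_matEquiv {A A' : LinMatrix n k} {P : Matrix (Fin k) (Fin k) ℂ}
    {Q : Matrix (Fin (n + k)) (Fin (n + k)) ℂ} (h : ∀ i, slice A i * Q = P * slice A' i)
    {w : Fin (n + k) → FunField n} (hw : w ∈ kernelGeneric A') :
    (fun l => ∑ j, Q l j • w j) ∈ kernelGeneric A := by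
  intro a
  rw [sum_mul_comb h]
  refine Finset.sum_eq_zero fun b _ => ?_
  rw [hw b, mul_zero]

lemma iso_kernelSheaf_of_matEquiv {A A' : LinMatrix n k} (hAA' : MatEquiv A A') :
    Iso (kernelSheaf A) (kernelSheaf A') := by
  obtain ⟨P, Q, hP, hQ, h⟩ := hAA'
  have h' : ∀ i, slice A' i * Q⁻¹ = P⁻¹ * slice A i := by
    intro i
    have : slice A i = P * slice A' i * Q⁻¹ := by
      rw [← h, Matrix.mul_nonsing_inv_cancel_right _ _ hQ]
    rw [this, Matrix.mul_assoc, Matrix.nonsing_inv_mul_cancel_left _ _ hP]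
  have hcomp : ∀ (R S : Matrix (Fin (n + k)) (Fin (n + k)) ℂ), R * S = 1 →
      ∀ (w : Fin (n + k) → FunField n) l, ∑ j, R l j • ∑ i, S j i • w i = w l := by
    intro R S hRS w l
    have h1 : ∀ i, ∑ j, R l j * S j i = (1 : Matrix (Fin (n + k)) (Fin (n + k)) ℂ) l i :=
      fun i => congrFun (congrFun hRS l) i
    simp only [Finset.smul_sum, smul_smul]
    rw [Finset.sum_comm]
    simp only [← Finset.sum_smul, h1]
    rw [Finset.sum_eq_single l]
    · rw [Matrix.one_apply_eq, one_smul]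
    · intro i _ hi; rw [Matrix.one_apply_ne hi.symm, zero_smul]
    · simp
  let φ : kernelGeneric A ≃ₗ[FunField n] kernelGeneric A' :=
    { toFun := fun w => ⟨fun l => ∑ j, Q⁻¹ l j • w.1 j, mem_kernelGeneric_of_matEquiv h' w.2⟩
      invFun := fun w => ⟨fun l => ∑ j, Q l j • w.1 j, mem_kernelGeneric_of_matEquiv h w.2⟩
      left_inv := fun w => Subtype.ext (funext fun l => hcomp _ _ (Matrix.mul_nonsing_inv _ hQ) _ l)
      right_inv := fun w =>
        Subtype.ext (funext fun l => hcomp _ _ (Matrix.nonsing_inv_mul _ hQ) _ l)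
      map_add' := fun v w => by
        ext l
        simp [smul_add, Finset.sum_add_distrib]
      map_smul' := fun c w => by
        ext l
        simp only [Submodule.coe_smul, Pi.smul_apply, RingHom.id_apply, Finset.smul_sum]
        exact Finset.sum_congr rfl fun j _ => smul_comm _ _ _ }
  have hmem : ∀ (R : Matrix (Fin (n + k)) (Fin (n + k)) ℂ) (p : Point n)
      (w : Fin (n + k) → FunField n), (∀ j, w j ∈ localRing p) →
      ∀ l, ∑ j, R l j • w j ∈ localRing p :=
    fun R p w hw l => sum_mem fun j _ => (localRing p).smul_mem (hw j) _
  refine ⟨φ, fun p w => ⟨fun hw => hmem Q⁻¹ p w.1 hw, fun hw => ?_⟩⟩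
  have h1 := hmem Q p (φ w).1 hw
  have h2 : φ.symm (φ w) = w := φ.symm_apply_apply w
  intro l
  have h3 := h1 l
  have h4 : ∑ j, Q l j • (φ w).1 j = (φ.symm (φ w)).1 l := rfl
  rw [h4, h2] at h3
  exact h3

variable {f : Fin (n + k + 1) → Fin (n + 1) → ℂ} {μ : Fin k → Fin (n + k + 1) → ℂ}
  {ℋ : Finset (Hyperplane n)}

/-- Any `n` coordinates of a vector in the kernel can be prescribed. -/
lemma exists_mem_kernelGeneric_logMatrix (h : IsGale f μ) {e : Fin n → Fin (n + k)}
    (he : Function.Injective e) (i : Fin n) :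
    ∃ w ∈ kernelGeneric (logMatrix f μ), ∀ i', w (e i') = if i' = i then 1 else 0 := by
  have hb : Function.Injective (Fin.cons (Fin.last _) fun i => (e i).castSucc :
      Fin (n + 1) → Fin (n + k + 1)) := by
    rw [Fin.cons_injective_iff]
    refine ⟨?_, (Fin.castSucc_injective _).comp he⟩
    rintro ⟨i, hi⟩
    exact (Fin.castSucc_lt_last _).ne hi
  let B := lgBasis (h.genPos.linearIndependent le_rfl hb)
  refine ⟨(evalLg h (B.coord i)).1, (evalLg h (B.coord i)).2, fun i' => ?_⟩
  have h1 : B i' = lg (f (e i').castSucc) (f (Fin.last _)) := lgBasis_apply _ i'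
  rw [evalLg_apply, ← h1, Module.Basis.coord_apply, Module.Basis.repr_self, Finsupp.single_apply]

/-- Linear forms `r j` whose combination vanishes on the kernel of the matrix are constant
combinations of its rows. -/
lemma exists_comb_of_forall_kernelGeneric (h : IsGale f μ) (hn : 1 ≤ n)
    {r : Fin (n + k) → Fin (n + 1) → ℂ}
    (hr : ∀ w ∈ kernelGeneric (logMatrix f μ), ∑ j, toCone (linForm (r j)) * (w j).val = 0) :
    ∃ P : Fin k → ℂ, ∀ j, r j = ∑ b, P b • logMatrix f μ b j := by
  classical
  have hf0 : ∀ j, toCone (linForm (f j)) ≠ 0 := fun j => toCone_linForm_ne_zero (h.genPos.ne_zero j)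
  let R : Fin (n + k) → ConeField n := fun j =>
    toCone (linForm (r j)) / toCone (linForm (f j.castSucc))
  -- the quotients `R j` are determined by any `k` of them
  have hT : ∀ T : Finset (Fin (n + k)), T.card = k → ∃ u : Fin (n + k) → Fin k → ℂ,
      ∀ j₀, R j₀ = ∑ j ∈ T, algebraMap ℂ (ConeField n) (∑ b, u j b * μ b j₀.castSucc) * R j := by
    intro T hTc
    choose u hu using fun j : Fin (n + k) =>
      h.exists_comb (T := T.map Fin.castSuccEmb) (by rwa [Finset.card_map])
        (Pi.single j.castSucc 1)
    have hu' : ∀ j, ∀ j' ∈ T, ∑ b, u j b * μ b j'.castSucc = if j' = j then 1 else 0 := by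
      intro j j' hj'
      rw [hu j j'.castSucc (Finset.mem_map_of_mem Fin.castSuccEmb hj'), Pi.single_apply]
      simp
    refine ⟨u, ?_⟩
    let y : Fin (n + k) → ConeField n := fun j₀ => toCone (linForm (r j₀)) -
      (∑ j ∈ T, algebraMap ℂ (ConeField n) (∑ b, u j b * μ b j₀.castSucc) * R j) *
        toCone (linForm (f j₀.castSucc))
    have hyT : ∀ j ∈ T, y j = 0 := by
      intro j hj
      simp only [y]
      rw [Finset.sum_eq_single j]
      · rw [hu' j j hj, if_pos rfl, map_one, one_mul, div_mul_cancel₀ _ (hf0 _), sub_self]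
      · intro j' _ hj'
        rw [hu' j' j hj, if_neg hj'.symm, map_zero, zero_mul]
      · intro h; exact absurd hj h
    have hyw : ∀ w ∈ kernelGeneric (logMatrix f μ), ∑ j, y j * (w j).val = 0 := by
      intro w hw
      simp only [y, sub_mul, Finset.sum_sub_distrib, hr w hw, zero_sub, neg_eq_zero, Finset.sum_mul]
      rw [Finset.sum_comm]
      refine Finset.sum_eq_zero fun j _ => ?_
      have h1 := sum_mul_eq_zero_of_mem_kernelGeneric hw (u j)
      simp only [sum_logMatrix] at h1
      rw [← mul_zero (R j), ← h1, Finset.mul_sum]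
      refine Finset.sum_congr rfl fun j₀ _ => ?_
      rw [toCone_linForm_smul]
      ring
    have hy : ∀ j, y j = 0 := by
      intro j
      by_cases hj : j ∈ T
      · exact hyT j hj
      have hTc' : Tᶜ.card = n := by rw [Finset.card_compl, hTc, Fintype.card_fin]; omega
      let e : Fin n → Fin (n + k) := fun i => (Tᶜ.equivFinOfCardEq hTc').symm i
      have he : Function.Injective e :=
        Subtype.val_injective.comp (Tᶜ.equivFinOfCardEq hTc').symm.injective
      have hsurj : ∀ l ∉ T, ∃ i, e i = l := fun l hl =>
        ⟨Tᶜ.equivFinOfCardEq hTc' ⟨l, by simpa using hl⟩, by simp [e]⟩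
      obtain ⟨i, rfl⟩ := hsurj j hj
      obtain ⟨w, hw, hwe⟩ := exists_mem_kernelGeneric_logMatrix h he i
      have h1 := hyw w hw
      rw [Finset.sum_eq_single (e i)] at h1
      · simpa [hwe] using h1
      · intro l _ hl
        by_cases hlT : l ∈ T
        · rw [hyT l hlT, zero_mul]
        · obtain ⟨i', rfl⟩ := hsurj l hlT
          rw [hwe, if_neg (fun h => hl (by rw [h])), map_zero, mul_zero]
      · simp
    intro j₀
    rw [div_eq_iff (hf0 _)]
    exact sub_eq_zero.1 (hy j₀)
  -- at every point at least `k` of the `f j` do not vanish, and the `R j` for these are regular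
  have hreg : ∀ j p, RegAt 0 p (R j) := by
    intro j p
    have hcard : k ≤ (Finset.univ.filter fun j : Fin (n + k) =>
        f j.castSucc ⬝ᵥ p.rep ≠ 0).card := by
      have h1 := (h.genPos.comp_injective (Fin.castSucc_injective (n + k))).card_filter_le
        p.rep_nonzero
      have h2 := Finset.card_filter_add_card_filter_not (s := (Finset.univ : Finset (Fin (n + k))))
        (fun j => f j.castSucc ⬝ᵥ p.rep = 0)
      rw [Finset.card_univ, Fintype.card_fin] at h2
      simp only [Function.comp_apply] at h1
      simp only [ne_eq]
      omega
    obtain ⟨T, hTsub, hTc⟩ := Finset.exists_subset_card_eq hcard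
    obtain ⟨u, hu⟩ := hT T hTc
    rw [hu j]
    refine RegAt.sum fun j' hj' => ?_
    have := (RegAt.const p (∑ b, u j' b * μ b j.castSucc)).mul
      ((RegAt.linForm p (r j')).div_linForm (d := 0) (Finset.mem_filter.1 (hTsub hj')).2)
    simpa using this
  choose ρ hρ using fun j => exists_eq_const_of_regAt hn (hreg j)
  obtain ⟨T, -, hTc⟩ := Finset.exists_subset_card_eq (s := (Finset.univ : Finset (Fin (n + k))))
    (n := k) (by simp)
  obtain ⟨u, hu⟩ := hT T hTc
  refine ⟨fun b => ∑ j ∈ T, ρ j * u j b, fun j₀ => ?_⟩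
  have h1 : ρ j₀ = ∑ b, (∑ j ∈ T, ρ j * u j b) * μ b j₀.castSucc := by
    have h2 := hu j₀
    simp only [hρ] at h2
    have h3 : ρ j₀ = ∑ j ∈ T, (∑ b, u j b * μ b j₀.castSucc) * ρ j := by
      apply (algebraMap ℂ (ConeField n)).injective
      rw [h2]
      simp only [map_sum, map_mul]
    rw [h3]
    simp only [Finset.sum_mul]
    rw [Finset.sum_comm]
    refine Finset.sum_congr rfl fun b _ => Finset.sum_congr rfl fun j _ => ?_
    ring
  rw [sum_logMatrix, ← h1]
  apply linForm_injective
  apply toCone_injective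
  have h2 := hρ j₀
  rw [div_eq_iff (hf0 _)] at h2
  rw [h2, toCone_linForm_smul]

/-- The Steiner matrix of the bundle of logarithmic forms is unique up to equivalence: the
coordinates of the kernel are global sections of the bundle, hence constant combinations of the
standard ones, and the relations between these are constant combinations of the rows. -/
lemma matEquiv_of_isSteinerMatrix (h : IsGale f μ) (hℋ : IsEquations f ℋ) (hn : 1 ≤ n)
    (hk : 1 ≤ k) {A : LinMatrix n k} (hA : IsSteinerMatrix A (logForms ℋ)) :
    MatEquiv A (logMatrix f μ) := by
  classical
  obtain ⟨hnd, θ, hθ⟩ := hA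
  have hfin : FiniteDimensional (FunField n) (Ω[FunField n⁄ℂ]) :=
    Module.Finite.of_basis (lgBasisLast h.genPos)
  -- the coordinates of the kernel are global logarithmic forms
  have hcoord : ∀ l, ∃ q : Fin (n + k) → ℂ, ∀ φ,
      (θ φ).1 l = ∑ j, q j • (evalLg h φ).1 j := by
    intro l
    obtain ⟨ω, hω⟩ := (Module.evalEquiv (FunField n) (Ω[FunField n⁄ℂ])).surjective
      ((LinearMap.proj l).comp ((kernelGeneric A).subtype.comp θ.toLinearMap))
    have hω' : ∀ φ, φ ω = (θ φ).1 l := fun φ => LinearMap.congr_fun hω φ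
    have hmem : ∀ p, ω ∈ lgSpan f p := by
      intro p
      rw [← logForms_eq_lgSpan hℋ.exists_index hℋ.exists_hyperplane h.genPos.span_eq_top]
      refine mem_logForms_of_forall_dual h.genPos hℋ fun φ hφ => ?_
      rw [hω']
      exact (hθ p φ).1 hφ l
    obtain ⟨q, hq⟩ := exists_const_of_forall_mem_lgSpan h.genPos hn hk hmem
    refine ⟨q, fun φ => ?_⟩
    rw [← hω', hq, map_sum]
    exact Finset.sum_congr rfl fun j _ => φ.map_smul_of_tower _ _
  choose Q hQ using hcoord
  have hQmem : ∀ w ∈ kernelGeneric (logMatrix f μ),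
      (fun l => ∑ j, Q l j • w j) ∈ kernelGeneric A := by
    intro w hw
    obtain ⟨φ, hφ⟩ := (evalLg_bijective h).2 ⟨w, hw⟩
    have : (θ φ).1 = fun l => ∑ j, Q l j • w j := by
      ext l
      rw [hQ, hφ]
    rw [← this]
    exact (θ φ).2
  have hker : ∀ w ∈ kernelGeneric A, ∃ w' : Fin (n + k) → FunField n,
      w = fun l => ∑ j, Q l j • w' j := by
    intro w hw
    refine ⟨(evalLg h (θ.symm ⟨w, hw⟩)).1, ?_⟩
    ext l
    rw [← hQ, θ.apply_symm_apply]
  have hP : ∀ a, ∃ P : Fin k → ℂ, ∀ j, ∑ l, Q l j • A a l = ∑ b, P b • logMatrix f μ b j := by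
    intro a
    refine exists_comb_of_forall_kernelGeneric h hn fun w hw => ?_
    rw [← hQmem w hw a]
    have hl : ∀ j, toCone (linForm (∑ l, Q l j • A a l)) =
        ∑ l, algebraMap ℂ (ConeField n) (Q l j) * toCone (linForm (A a l)) := by
      intro j
      rw [linForm_sum, toCone, map_sum]
      exact Finset.sum_congr rfl fun l _ => toCone_linForm_smul _ _
    simp only [hl, map_sum, val_smul, Finset.sum_mul, Finset.mul_sum]
    rw [Finset.sum_comm]
    refine Finset.sum_congr rfl fun l _ => Finset.sum_congr rfl fun j _ => ?_
    ring
  choose P hP using hP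
  have hrel : ∀ i, slice A i * Matrix.of Q = Matrix.of P * slice (logMatrix f μ) i := by
    intro i
    ext a j
    have := congrFun (hP a j) i
    simp only [Finset.sum_apply, Pi.smul_apply, smul_eq_mul] at this
    simp only [Matrix.mul_apply, slice, Matrix.of_apply, ← this]
    exact Finset.sum_congr rfl fun l _ => mul_comm _ _
  have hQdet : (Matrix.of Q).det ≠ 0 := by
    intro h0
    obtain ⟨c, hc0, hc⟩ := Matrix.exists_vecMul_eq_zero_iff.2 h0
    refine hc0 (hnd.eq_zero_of_forall_kernelGeneric hn fun w hw => ?_)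
    obtain ⟨w', rfl⟩ := hker w hw
    simp only [Finset.smul_sum, smul_smul]
    rw [Finset.sum_comm]
    refine Finset.sum_eq_zero fun j _ => ?_
    have : ∑ l, c l * Q l j = 0 := congrFun hc j
    rw [← Finset.sum_smul, this, zero_smul]
  have hPdet : (Matrix.of P).det ≠ 0 := by
    intro h0
    obtain ⟨u, hu0, hu⟩ := Matrix.exists_vecMul_eq_zero_iff.2 h0
    have h1 : ∀ i, Matrix.vecMul u (slice A i) = 0 := by
      intro i
      refine Matrix.eq_zero_of_vecMul_eq_zero hQdet ?_
      rw [Matrix.vecMul_vecMul, hrel, ← Matrix.vecMul_vecMul, hu, Matrix.zero_vecMul]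
    refine hu0 (hnd.eq_zero_of_comb (v := Pi.single 0 1) (by simp) fun j => ?_)
    have : ∑ a, u a * A a j 0 = 0 := congrFun (h1 0) j
    simpa using this
  exact ⟨Matrix.of P, Matrix.of Q, isUnit_iff_ne_zero.2 hPdet, isUnit_iff_ne_zero.2 hQdet, hrel⟩

end SteinerUnique

/-! ### Unstable hyperplanes of a Steiner bundle -/

section IsoSections

variable {n : ℕ} {M M' : Type} [AddCommGroup M] [Module (FunField n) M] [AddCommGroup M']
  [Module (FunField n) M'] {E : SubSheaf n M} {E' : SubSheaf n M'}

lemma map_mem_idealMul {φ : M ≃ₗ[FunField n] M'} (h : ∀ p e, e ∈ E p ↔ φ e ∈ E' p)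
    {H : Hyperplane n} {p : Point n} {e : M} (he : e ∈ idealMul E H p) :
    φ e ∈ idealMul E' H p := by
  refine Submodule.smul_induction_on (p := fun e => φ e ∈ idealMul E' H p) he ?_ ?_
  · intro r hr e he
    have : φ (r • e) = r • φ e := φ.map_smul (r : FunField n) e
    rw [this]
    exact Submodule.smul_mem_smul hr ((h p e).1 he)
  · intro x y hx hy
    rw [map_add]
    exact add_mem hx hy

variable [Module ℂ M] [IsScalarTower ℂ (FunField n) M] [Module ℂ M']
  [IsScalarTower ℂ (FunField n) M']

lemma h0On_ne_zero_iff {H : Hyperplane n} : h0On E H ≠ 0 ↔ ∃ s ∈ sectionsOn E H, s ≠ 0 := by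
  rw [h0On, ne_eq, rank_zero_iff, not_subsingleton_iff_nontrivial, Submodule.nontrivial_iff_ne_bot,
    Submodule.ne_bot_iff]

lemma h0On_ne_zero_of_iso (hE : Iso E E') {H : Hyperplane n} (h0 : h0On E H ≠ 0) :
    h0On E' H ≠ 0 := by
  rw [h0On_ne_zero_iff] at h0 ⊢
  obtain ⟨φ, h⟩ := hE
  obtain ⟨s, hs, hs0⟩ := h0
  choose e he using fun q => Submodule.Quotient.mk_surjective _ (s q)
  have key : ∀ q e', s q = Submodule.Quotient.mk e' →
      (Submodule.Quotient.mk (φ (e q)) : M' ⧸ idealSMul E' H q.1) =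
        Submodule.Quotient.mk (φ e') := by
    intro q e' h'
    rw [← he, Submodule.Quotient.eq] at h'
    rw [Submodule.Quotient.eq, ← map_sub]
    exact map_mem_idealMul h h'
  refine ⟨fun q => Submodule.Quotient.mk (φ (e q)), fun p => ?_, fun h0 => hs0 ?_⟩
  · obtain ⟨d, g, e', hg, hp, h'⟩ := hs p
    exact ⟨d, g, φ e', hg, hp, fun q hq => ⟨(h _ _).1 (h' q hq).1, key q e' (h' q hq).2⟩⟩
  · ext q
    have h1 := congrFun h0 q
    rw [← he, Pi.zero_apply, Submodule.Quotient.mk_eq_zero]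
    rw [Pi.zero_apply, Submodule.Quotient.mk_eq_zero] at h1
    have h2 := map_mem_idealMul (φ := φ.symm) (E := E') (E' := E)
      (fun p e => by rw [h, φ.apply_symm_apply]) h1
    rw [φ.symm_apply_apply] at h2
    exact h2

end IsoSections

lemma unstableHyperplanes_eq_of_iso {n : ℕ} {M M' : Type} [AddCommGroup M] [Module (FunField n) M]
    [AddCommGroup M'] [Module (FunField n) M'] {E : SubSheaf n M} {E' : SubSheaf n M'}
    (hE : Iso E E') : unstableHyperplanes E = unstableHyperplanes E' :=
  Set.ext fun _ => ⟨h0On_ne_zero_of_iso hE.dual, h0On_ne_zero_of_iso hE.symm.dual⟩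

section UnstableCriterion

variable {n k : ℕ}

/-- A function on a linear space that is locally a quotient of homogeneous polynomials of the same
degree is constant away from the origin. -/
lemma exists_const_of_locally_fraction {U : Submodule ℂ (Fin (n + 1) → ℂ)}
    {F : (Fin (n + 1) → ℂ) → ℂ}
    (hF : ∀ x ∈ U, x ≠ 0 → ∃ (d : ℕ) (a b : Coord n), a.IsHomogeneous d ∧ b.IsHomogeneous d ∧
      MvPolynomial.eval x b ≠ 0 ∧ ∀ y ∈ U, y ≠ 0 → MvPolynomial.eval y b ≠ 0 →
        F y * MvPolynomial.eval y b = MvPolynomial.eval y a) :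
    ∃ c, ∀ x ∈ U, x ≠ 0 → F x = c := by
  have key : ∀ x ∈ U, ∀ y ∈ U, LinearIndependent ℂ ![x, y] → F x = F y := by
    intro x hx y hy hxy
    -- the restriction of `F` to the projective line through `x` and `y`
    have hlin : ∀ s t : ℂ, s • x + t • y ∈ U := fun s t =>
      U.add_mem (U.smul_mem _ hx) (U.smul_mem _ hy)
    have hne : ∀ v : Fin 2 → ℂ, v ≠ 0 → v 0 • x + v 1 • y ≠ 0 := by
      intro v hv h0
      rw [LinearIndependent.pair_iff] at hxy
      obtain ⟨h1, h2⟩ := hxy _ _ h0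
      refine hv (funext fun i => ?_)
      fin_cases i
      exacts [h1, h2]
    have hpull : ∀ (d : ℕ) (a : Coord n), a.IsHomogeneous d → ∃ a' : Coord 1,
        a'.IsHomogeneous d ∧ ∀ v : Fin 2 → ℂ,
          MvPolynomial.eval v a' = MvPolynomial.eval (v 0 • x + v 1 • y) a := by
      intro d a ha
      refine ⟨MvPolynomial.aeval (fun i => linForm (n := 1) ![x i, y i]) a, ?_, fun v => ?_⟩
      · have := ha.aeval (fun i => linForm (n := 1) ![x i, y i])
          (fun i => isHomogeneous_linForm _)
        simpa using this
      · rw [MvPolynomial.aeval_def, MvPolynomial.hom_eval₂]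
        have h1 : (MvPolynomial.eval v).comp (algebraMap ℂ (Coord 1)) = RingHom.id ℂ := by
          ext; simp
        rw [h1, MvPolynomial.eval₂_id]
        congr 1
        congr 1
        ext i
        simp [eval_linForm, dotProduct, Fin.sum_univ_two, mul_comm]
    have hF' : ∀ v : Fin 2 → ℂ, v ≠ 0 → ∃ (d : ℕ) (a b : Coord 1), a.IsHomogeneous d ∧
        b.IsHomogeneous d ∧ MvPolynomial.eval v b ≠ 0 ∧
        ∀ u : Fin 2 → ℂ, u ≠ 0 → MvPolynomial.eval u b ≠ 0 →
          F (u 0 • x + u 1 • y) * MvPolynomial.eval u b = MvPolynomial.eval u a := by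
      intro v hv
      obtain ⟨d, a, b, ha, hb, hb0, hab⟩ := hF _ (hlin (v 0) (v 1)) (hne v hv)
      obtain ⟨a', ha', haa⟩ := hpull d a ha
      obtain ⟨b', hb', hbb⟩ := hpull d b hb
      refine ⟨d, a', b', ha', hb', by rwa [hbb], fun u hu hub => ?_⟩
      rw [hbb] at hub
      rw [hbb, haa]
      exact hab _ (hlin _ _) (hne u hu) hub
    obtain ⟨d, a, b, -, hb, hb0, hab⟩ := hF' (Pi.single 0 1) (by simp)
    have hb0' := toCone_ne_zero (ne_zero_of_eval_ne_zero hb0)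
    have hcmp : ∀ (a₁ b₁ : Coord 1), b₁ ≠ 0 → (∀ u : Fin 2 → ℂ, u ≠ 0 →
        MvPolynomial.eval u b₁ ≠ 0 → F (u 0 • x + u 1 • y) * MvPolynomial.eval u b₁ =
          MvPolynomial.eval u a₁) → toCone a / toCone b = toCone a₁ / toCone b₁ := by
      intro a₁ b₁ hb₁ h₁
      have hb₁' := toCone_ne_zero hb₁
      rw [div_eq_div_iff hb0' hb₁']
      have h2 : (a * b₁ - a₁ * b) * (b * b₁ * MvPolynomial.X 0) = 0 := by
        refine MvPolynomial.funext fun u => ?_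
        rw [map_mul, map_zero]
        by_cases h3 : MvPolynomial.eval u (b * b₁ * MvPolynomial.X 0) = 0
        · rw [h3, mul_zero]
        rw [map_mul, map_mul] at h3
        have hu : u ≠ 0 := by
          rintro rfl
          simp at h3
        have e1 := hab u hu (left_ne_zero_of_mul (left_ne_zero_of_mul h3))
        have e2 := h₁ u hu (right_ne_zero_of_mul (left_ne_zero_of_mul h3))
        rw [map_sub, map_mul, map_mul, ← e1, ← e2]
        ring
      have h3 := (mul_eq_zero.1 h2).resolve_right (mul_ne_zero (mul_ne_zero
        (ne_zero_of_eval_ne_zero hb0) hb₁) (MvPolynomial.X_ne_zero _))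
      have h4 := congrArg toCone (sub_eq_zero.1 h3)
      simpa only [toCone, map_mul] using h4
    obtain ⟨c, hc⟩ := exists_eq_const_of_regAt le_rfl (x := toCone a / toCone b) fun p => by
      obtain ⟨d₁, a₁, b₁, ha₁, hb₁, hb₁0, h₁⟩ := hF' p.rep p.rep_nonzero
      exact ⟨d₁, a₁, b₁, ha₁, hb₁, hb₁0, hcmp a₁ b₁ (ne_zero_of_eval_ne_zero hb₁0) h₁⟩
    have hval : ∀ v : Fin 2 → ℂ, v ≠ 0 → F (v 0 • x + v 1 • y) = c := by
      intro v hv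
      obtain ⟨d₁, a₁, b₁, -, -, hb₁0, h₁⟩ := hF' v hv
      have h2 := hcmp a₁ b₁ (ne_zero_of_eval_ne_zero hb₁0) h₁
      have h3 := HasVal.of_div (a := a₁) hb₁0
      rw [← h2, hc] at h3
      rw [h3.unique (HasVal.const v c) |>.symm, eq_div_iff hb₁0]
      exact h₁ v hv hb₁0
    have h1 := hval (Pi.single 0 1) (by simp)
    have h2 := hval (Pi.single 1 1) (by simp)
    simp only [Pi.single_eq_same, ne_eq, Fin.isValue, one_ne_zero, zero_ne_one, not_false_eq_true,
      Pi.single_eq_of_ne, one_smul, zero_smul, zero_add, add_zero] at h1 h2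
    rw [h1, h2]
  have hscale : ∀ x ∈ U, x ≠ 0 → ∀ c : ℂ, c ≠ 0 → F (c • x) = F x := by
    intro x hx hx0 c hc
    obtain ⟨d, a, b, ha, hb, hb0, hab⟩ := hF x hx hx0
    have h1 := hab x hx hx0 hb0
    have hbc : MvPolynomial.eval (c • x) b ≠ 0 := by
      rw [eval_smul_of_isHomogeneous hb]
      exact mul_ne_zero (pow_ne_zero _ hc) hb0
    have h2 := hab (c • x) (U.smul_mem _ hx) (smul_ne_zero hc hx0) hbc
    rw [eval_smul_of_isHomogeneous ha, ← h1] at h2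
    refine mul_right_cancel₀ hbc (h2.trans ?_)
    rw [eval_smul_of_isHomogeneous hb]
    ring
  by_cases hU : ∃ x ∈ U, x ≠ 0
  · obtain ⟨x, hx, hx0⟩ := hU
    refine ⟨F x, fun y hy hy0 => ?_⟩
    by_cases hxy : LinearIndependent ℂ ![x, y]
    · exact (key x hx y hy hxy).symm
    · rw [LinearIndependent.pair_iff' hx0] at hxy
      push Not at hxy
      obtain ⟨c, rfl⟩ := hxy
      exact hscale x hx hx0 c (by rintro rfl; simp at hy0)
  · push Not at hU
    exact ⟨0, fun x hx hx0 => absurd (hU x hx) hx0⟩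

lemma exists_isHomogeneous_cofactor {l : Fin (n + 1) → ℂ} {a : Coord n} {d : ℕ}
    (ha : a.IsHomogeneous d) (h : linForm l ∣ a) :
    a = 0 ∨ ∃ (e : ℕ) (b : Coord n), d = e + 1 ∧ b.IsHomogeneous e ∧ a = linForm l * b := by
  obtain ⟨b, rfl⟩ := h
  have h1 : linForm l * b = ∑ i ∈ Finset.range (b.totalDegree + 1),
      MvPolynomial.homogeneousComponent d (linForm l * MvPolynomial.homogeneousComponent i b) := by
    rw [← map_sum, ← Finset.mul_sum, MvPolynomial.sum_homogeneousComponent,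
      MvPolynomial.homogeneousComponent_eq_self ha]
  have h2 : ∀ i, MvPolynomial.homogeneousComponent d
      (linForm l * MvPolynomial.homogeneousComponent i b) =
      if d = 1 + i then linForm l * MvPolynomial.homogeneousComponent i b else 0 := fun i =>
    MvPolynomial.homogeneousComponent_of_mem ((isHomogeneous_linForm l).mul
      (MvPolynomial.homogeneousComponent_isHomogeneous i b))
  simp only [h2] at h1
  by_cases h3 : linForm l * b = 0
  · exact Or.inl h3
  right
  obtain ⟨i, hi, h4⟩ := Finset.exists_ne_zero_of_sum_ne_zero (h1 ▸ h3)
  have hd : d = 1 + i := by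
    by_contra hd
    rw [if_neg hd] at h4
    exact h4 rfl
  refine ⟨i, MvPolynomial.homogeneousComponent i b, by omega,
    MvPolynomial.homogeneousComponent_isHomogeneous i b, ?_⟩
  rw [h1, Finset.sum_eq_single i, if_pos hd]
  · intro j _ hj
    rw [if_neg (by omega)]
  · exact fun h => absurd hi h

lemma RegAt.div_of_dvd {p : Point n} {l m : Fin (n + 1) → ℂ} (hl : l ≠ 0)
    {a b : Coord n} {d : ℕ}
    (ha : a.IsHomogeneous d) (hb : b.IsHomogeneous d) (hp : MvPolynomial.eval p.rep b ≠ 0)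
    (h : PnBundle.linForm l ∣ a) :
    RegAt 0 p (toCone a / toCone b * (toCone (PnBundle.linForm m) /
      toCone (PnBundle.linForm l))) := by
  have hb0 := toCone_ne_zero (ne_zero_of_eval_ne_zero hp)
  have hl0 := toCone_linForm_ne_zero hl
  rcases exists_isHomogeneous_cofactor ha h with rfl | ⟨e, c, rfl, hc, rfl⟩
  · simpa [toCone] using RegAt.zero p 0
  · refine ⟨e + 1, c * PnBundle.linForm m, b, hc.mul (isHomogeneous_linForm m), hb, hp, ?_⟩
    simp only [toCone, map_mul]
    field_simp

lemma exists_ne_zero_dotProduct_eq_zero (hn : 1 ≤ n) (l : Fin (n + 1) → ℂ) :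
    ∃ v : Fin (n + 1) → ℂ, v ≠ 0 ∧ l ⬝ᵥ v = 0 := by
  have h := LinearMap.ker_ne_bot_of_finrank_lt (f := dotProductBilin ℂ ℂ l) (by simp; omega)
  obtain ⟨v, hv, hv0⟩ := (Submodule.ne_bot_iff _).1 h
  exact ⟨v, hv0, by simpa using hv⟩

lemma exists_vec_dotProduct_ne_zero {v : Fin (n + 1) → ℂ} (hv : v ≠ 0) : ∃ m, m ⬝ᵥ v ≠ 0 := by
  by_contra! hcon
  refine hv (dotProduct_eq_zero v fun m => ?_)
  rw [dotProduct_comm, hcon]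

lemma linForm_dvd_of_forall_eval {l : Fin (n + 1) → ℂ} (hl : l ≠ 0) {a : Coord n}
    (h : ∀ v, l ⬝ᵥ v = 0 → MvPolynomial.eval v a = 0) : linForm l ∣ a := by
  obtain ⟨v, hv⟩ : ∃ v, l ⬝ᵥ v ≠ 0 := by
    by_contra! hcon
    exact hl (dotProduct_eq_zero l hcon)
  obtain ⟨B, hB⟩ := exists_eval_eq_mul (U := ⊤) ⟨v, trivial, hv⟩ fun v _ => h v
  refine ⟨B, MvPolynomial.funext fun v => ?_⟩
  rw [hB v trivial, map_mul, eval_linForm]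

variable {A : LinMatrix n k} {H : Hyperplane n} {q : Point n}

lemma hasVal_zero_of_mem_idealAt (hq : Lies q H) {f : localRing q} (hf : f ∈ idealAt H q) :
    HasVal q.rep (f : FunField n).val 0 := by
  refine Submodule.span_induction
    (p := fun (f : localRing q) _ => HasVal q.rep (f : FunField n).val 0) ?_ ?_ ?_ ?_ hf
  · rintro f ⟨m, hm, hf⟩
    have := HasVal.of_div (a := linForm H.rep) hm
    rw [← hf, eval_linForm, lies_iff.1 hq, zero_div] at this
    exact this
  · simpa using HasVal.zero q.rep
  · intro x y _ _ hx hy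
    have := hx.add hy
    rw [add_zero, ← map_add] at this
    exact this
  · intro a x _ hx
    obtain ⟨c, hc⟩ := RegAt.exists_hasVal (mem_localRing_iff.1 a.2)
    have := hc.mul hx
    rw [mul_zero, ← map_mul] at this
    exact this

lemma hasVal_zero_of_mem_idealMul (hq : Lies q H) {e : kernelGeneric A}
    (he : e ∈ idealMul (kernelSheaf A) H q) (j : Fin (n + k)) :
    HasVal q.rep (e.1 j).val 0 := by
  refine Submodule.smul_induction_on (p := fun e => HasVal q.rep (e.1 j).val 0) he ?_ ?_
  · intro r hr e he
    obtain ⟨c, hc⟩ := RegAt.exists_hasVal (mem_localRing_iff.1 (he j))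
    have := (hasVal_zero_of_mem_idealAt hq hr).mul hc
    rw [zero_mul, ← map_mul] at this
    exact this
  · intro x y hx hy
    have := hx.add hy
    rw [add_zero, ← map_add] at this
    exact this

lemma mem_idealMul_of_regAt {e : kernelGeneric A} {m : Fin (n + 1) → ℂ}
    (hm : m ⬝ᵥ q.rep ≠ 0) (he : ∀ j, RegAt 0 q ((e.1 j).val *
      (toCone (linForm m) / toCone (linForm H.rep)))) :
    e ∈ idealMul (kernelSheaf A) H q := by
  have hm0 : m ≠ 0 := by rintro rfl; simp at hm
  have hH0 := H.rep_nonzero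
  have hmem : lin H.rep m ∈ localRing q := lin_mem_localRing _ hm
  have h1 : (⟨lin H.rep m, hmem⟩ : localRing q) ∈ idealAt H q :=
    Ideal.subset_span ⟨m, by rwa [eval_linForm], val_lin _ _⟩
  have h2 : e = (⟨lin H.rep m, hmem⟩ : localRing q) • ((lin m H.rep) • e) := by
    change e = lin H.rep m • ((lin m H.rep) • e)
    rw [smul_smul, lin_mul_lin _ _ hm0, lin_self hH0, one_smul]
  rw [h2]
  refine Submodule.smul_mem_smul h1 fun j => ?_
  rw [mem_localRing_iff]
  have h3 : ((lin m H.rep • e).1 j).val = (e.1 j).val *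
      (toCone (linForm m) / toCone (linForm H.rep)) := by
    change (lin m H.rep * e.1 j).val = _
    rw [map_mul, val_lin, mul_comm]
  rw [h3]
  exact he j

/-- A section over a hyperplane of the kernel of a nondegenerate matrix has constant coordinates:
the value of a coordinate is a regular function on the hyperplane. -/
lemma exists_const_of_h0On_ne_zero (h0 : h0On (kernelSheaf A) H ≠ 0) :
    ∃ w : Fin (n + k) → ℂ, w ≠ 0 ∧ ∃ τ : Fin k → ℂ, ∀ a, ∑ j, w j • A a j = τ a • H.rep := by
  classical
  obtain ⟨s, hs, hs0⟩ := h0On_ne_zero_iff.1 h0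
  -- the values of the coordinates of the section
  have hv : ∀ q : {p : Point n // Lies p H}, ∃ v : Fin (n + k) → ℂ,
      ∀ e ∈ kernelSheaf A q.1, s q = Submodule.Quotient.mk e →
        ∀ j, HasVal q.1.rep (e.1 j).val (v j) := by
    intro q
    obtain ⟨d, g, e, hg, hq, he⟩ := hs q
    obtain ⟨heq, hse⟩ := he q hq
    choose v hv using fun j => RegAt.exists_hasVal (mem_localRing_iff.1 (heq j))
    refine ⟨v, fun e' he' hse' j => ?_⟩
    rw [hse, Eq.comm, Submodule.Quotient.eq] at hse'
    have h1 := (hasVal_zero_of_mem_idealMul q.2 hse' j).add (hv j)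
    rw [zero_add, ← map_add] at h1
    have h2 : (e' - e).1 j + e.1 j = e'.1 j := sub_add_cancel _ _
    rwa [h2] at h1
  choose v hv using hv
  let U : Submodule ℂ (Fin (n + 1) → ℂ) := LinearMap.ker (dotProductBilin ℂ ℂ H.rep)
  have hU : ∀ x, x ∈ U ↔ H.rep ⬝ᵥ x = 0 := fun x => by simp [U]
  have hpt : ∀ x ∈ U, x ≠ 0 → ∃ (q : {p : Point n // Lies p H}) (c : ℂ), c ≠ 0 ∧
      q.1.rep = c • x ∧ ∀ hx : x ≠ 0, Projectivization.mk ℂ x hx = q.1 := by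
    intro x hx hx0
    obtain ⟨a, ha⟩ := Projectivization.exists_smul_eq_mk_rep ℂ x hx0
    refine ⟨⟨Projectivization.mk ℂ x hx0, ?_⟩, a, a.ne_zero, ha.symm, fun _ => rfl⟩
    rw [lies_iff, ← ha]
    have : a • x = (a : ℂ) • x := rfl
    rw [this, dotProduct_smul, (hU x).1 hx, smul_zero]
  have hlocal : ∀ p : {p : Point n // Lies p H}, ∃ (e : kernelGeneric A) (d : Fin (n + k) → ℕ)
      (g : Coord n) (dg : ℕ) (a b : Fin (n + k) → Coord n), g.IsHomogeneous dg ∧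
      MvPolynomial.eval p.1.rep g ≠ 0 ∧ (∀ j, (a j).IsHomogeneous (d j)) ∧
      (∀ j, (b j).IsHomogeneous (d j)) ∧ (∀ j, MvPolynomial.eval p.1.rep (b j) ≠ 0) ∧
      (∀ j, (e.1 j).val = toCone (a j) / toCone (b j)) ∧ s p = Submodule.Quotient.mk e ∧
      ∀ q : {p : Point n // Lies p H}, ∀ j, MvPolynomial.eval q.1.rep (b j * g) ≠ 0 →
        v q j * MvPolynomial.eval q.1.rep (b j) = MvPolynomial.eval q.1.rep (a j) := by
    intro p
    obtain ⟨dg, g, e, hg, hp, he⟩ := hs p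
    choose d a b ha hb hb0 hab using fun j => mem_localRing_iff.1 ((he p hp).1 j)
    refine ⟨e, d, g, dg, a, b, hg, hp, fun j => ?_, hb, hb0, hab, (he p hp).2, fun q j hq => ?_⟩
    · simpa using ha j
    · rw [map_mul] at hq
      obtain ⟨h1, h2⟩ := he q (right_ne_zero_of_mul hq)
      have h3 := hv q e h1 h2 j
      have h4 := HasVal.of_div (a := a j) (left_ne_zero_of_mul hq)
      rw [← hab] at h4
      rw [h3.unique h4, div_mul_cancel₀ _ (left_ne_zero_of_mul hq)]
  -- a function on vectors that represents the values of a coordinate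
  let F : Fin (n + k) → (Fin (n + 1) → ℂ) → ℂ := fun j x =>
    if hx : ∃ h : x ≠ 0, Lies (Projectivization.mk ℂ x h) H then
      v ⟨Projectivization.mk ℂ x hx.1, hx.2⟩ j else 0
  have hF : ∀ (q : {p : Point n // Lies p H}) x (hx : x ≠ 0), Projectivization.mk ℂ x hx = q.1 →
      ∀ j, F j x = v q j := by
    intro q x hx hq j
    have h1 : ∃ h : x ≠ 0, Lies (Projectivization.mk ℂ x h) H := ⟨hx, by rw [hq]; exact q.2⟩
    simp only [F, dif_pos h1]
    congr
  have hconst : ∀ j, ∃ c, ∀ x ∈ U, x ≠ 0 → F j x = c := by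
    intro j
    refine exists_const_of_locally_fraction fun x hx hx0 => ?_
    obtain ⟨p, c, hc, hpx, hmk⟩ := hpt x hx hx0
    obtain ⟨e, d, g, dg, a, b, hg, hgp, ha, hb, hb0, hab, hsp, hval⟩ := hlocal p
    refine ⟨d j + dg, a j * g, b j * g, (ha j).mul hg, (hb j).mul hg, ?_, fun y hy hy0 hyb => ?_⟩
    · have h1 : MvPolynomial.eval p.1.rep (b j * g) ≠ 0 := by
        rw [map_mul]; exact mul_ne_zero (hb0 j) hgp
      rw [hpx, eval_smul_of_isHomogeneous ((hb j).mul hg)] at h1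
      exact right_ne_zero_of_mul h1
    · obtain ⟨q, c', hc', hqy, hmk'⟩ := hpt y hy hy0
      rw [hF q y hy0 (hmk' hy0)]
      have h1 : MvPolynomial.eval q.1.rep (b j * g) ≠ 0 := by
        rw [hqy, eval_smul_of_isHomogeneous ((hb j).mul hg)]
        exact mul_ne_zero (pow_ne_zero _ hc') hyb
      have h2 := hval q j h1
      rw [hqy, eval_smul_of_isHomogeneous (ha j), eval_smul_of_isHomogeneous (hb j)] at h2
      have h3 : v q j * MvPolynomial.eval y (b j) = MvPolynomial.eval y (a j) :=
        mul_left_cancel₀ (pow_ne_zero (d j) hc') (by linear_combination h2)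
      rw [map_mul, map_mul, ← h3]
      ring
  choose w hw using hconst
  have hwv : ∀ (q : {p : Point n // Lies p H}) j, v q j = w j := by
    intro q j
    rw [← hw j q.1.rep ((hU _).2 (lies_iff.1 q.2)) q.1.rep_nonzero,
      hF q q.1.rep q.1.rep_nonzero (Projectivization.mk_rep _)]
  refine ⟨w, ?_, ?_⟩
  · -- if all values vanish then the section vanishes
    rintro rfl
    refine hs0 (funext fun p => ?_)
    obtain ⟨e, d, g, dg, a, b, hg, hgp, ha, hb, hb0, hab, hsp, hval⟩ := hlocal p
    rw [hsp, Pi.zero_apply, Submodule.Quotient.mk_eq_zero]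
    obtain ⟨m, hm⟩ := exists_vec_dotProduct_ne_zero p.1.rep_nonzero
    refine mem_idealMul_of_regAt hm fun j => ?_
    rw [hab]
    refine RegAt.div_of_dvd H.rep_nonzero (ha j) (hb j) (hb0 j) ?_
    refine linForm_dvd_of_forall_eval H.rep_nonzero fun x hx => ?_
    refine eval_eq_zero_of_mul (U := U) (Q := b j * g) (fun y hy => ?_)
      (v₀ := p.1.rep) ((hU _).2 (lies_iff.1 p.2)) ?_ x ((hU x).2 hx)
    · by_cases hyb : MvPolynomial.eval y (b j * g) = 0
      · rw [hyb, mul_zero]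
      by_cases hy0 : y = 0
      · subst hy0
        have h1 := eval_smul_of_isHomogeneous (ha j) 0 p.1.rep
        rw [zero_smul] at h1
        have h2 := eval_smul_of_isHomogeneous (hb j) 0 p.1.rep
        rw [zero_smul] at h2
        have h3 := hval p j (by rw [map_mul]; exact mul_ne_zero (hb0 j) hgp)
        rw [hwv, Pi.zero_apply, zero_mul] at h3
        rw [h1, ← h3, mul_zero, zero_mul]
      obtain ⟨q, c', hc', hqy, hmk'⟩ := hpt y hy hy0
      have h1 : MvPolynomial.eval q.1.rep (b j * g) ≠ 0 := by
        rw [hqy, eval_smul_of_isHomogeneous ((hb j).mul hg)]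
        exact mul_ne_zero (pow_ne_zero _ hc') hyb
      have h2 := hval q j h1
      rw [hwv, Pi.zero_apply, zero_mul, hqy, eval_smul_of_isHomogeneous (ha j)] at h2
      rw [(mul_eq_zero.1 h2.symm).resolve_left (pow_ne_zero _ hc'), zero_mul]
    · rw [map_mul]; exact mul_ne_zero (hb0 j) hgp
  · -- the linear form `∑ j, w j • A a j` vanishes on `H`, so it is a multiple of the equation
    have hvan : ∀ a, ∀ x, H.rep ⬝ᵥ x = 0 → (∑ j, w j • A a j) ⬝ᵥ x = 0 := by
      intro a x hx
      by_cases hx0 : x = 0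
      · rw [hx0, dotProduct_zero]
      obtain ⟨q, c, hc, hqx, -⟩ := hpt x ((hU x).2 hx) hx0
      obtain ⟨d, g, e, hg, hgq, he⟩ := hs q
      obtain ⟨h1, h2⟩ := he q hgq
      have h3 := HasVal.sum (s := Finset.univ) fun j _ =>
        (HasVal.linForm q.1.rep (A a j)).mul (hv q e h1 h2 j)
      rw [e.2 a] at h3
      have h4 := h3.unique (HasVal.zero _)
      simp only [hwv, hqx, dotProduct_smul, smul_eq_mul] at h4
      refine (mul_eq_zero.1 (?_ : c * _ = 0)).resolve_left hc
      rw [← h4, sum_dotProduct, Finset.mul_sum]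
      refine Finset.sum_congr rfl fun j _ => ?_
      rw [smul_dotProduct, smul_eq_mul]
      ring
    obtain ⟨x₀, hx₀⟩ : ∃ x, H.rep ⬝ᵥ x ≠ 0 := by
      by_contra! hcon
      exact H.rep_nonzero (dotProduct_eq_zero _ hcon)
    refine ⟨fun a => (∑ j, w j • A a j) ⬝ᵥ x₀ / (H.rep ⬝ᵥ x₀), fun a => ?_⟩
    rw [← sub_eq_zero]
    refine dotProduct_eq_zero _ fun x => ?_
    have h1 := hvan a (x - (H.rep ⬝ᵥ x / (H.rep ⬝ᵥ x₀)) • x₀) (by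
      rw [dotProduct_sub, dotProduct_smul, smul_eq_mul, div_mul_cancel₀ _ hx₀, sub_self])
    rw [dotProduct_sub, dotProduct_smul, smul_eq_mul] at h1
    rw [sub_dotProduct, smul_dotProduct, smul_eq_mul, ← h1]
    ring

/-- If the constant vector `w` is mapped to a multiple of the equation of `H` then it is, modulo
this equation, a section of the kernel over `H`. -/
lemma h0On_ne_zero_of_const (hA : Nondegenerate A) (hn : 1 ≤ n) {w : Fin (n + k) → ℂ}
    (hw : w ≠ 0) {τ : Fin k → ℂ} (hτ : ∀ a, ∑ j, w j • A a j = τ a • H.rep) :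
    h0On (kernelSheaf A) H ≠ 0 := by
  classical
  have hH0 := toCone_linForm_ne_zero H.rep_nonzero
  -- correct the constant vector `w` by multiples of the equation of `H`
  have hcorr : ∀ J : Fin k → Fin (n + k), (minorMatrix A J).det ≠ 0 →
      ∃ e : kernelGeneric A, ∃ x : Fin (n + k) → ConeField n,
        (∀ j, (e.1 j).val = algebraMap ℂ (ConeField n) (w j) - toCone (linForm H.rep) * x j) ∧
        ∀ (q : Point n), MvPolynomial.eval q.rep (minorMatrix A J).det ≠ 0 → ∀ j m,
          RegAt 0 q (x j * toCone (linForm m)) := by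
    intro J hJ
    let r : Fin k → Coord n := fun a => MvPolynomial.C (τ a)
    have hr : (linForm H.rep • r) = fun a => linForm (τ a • H.rep) := by
      ext1 a
      rw [Pi.smul_apply, smul_eq_mul, linForm_smul, mul_comm]
    have hcr : ∀ b, (minorMatrix A J).cramer (fun a => linForm (τ a • H.rep)) b =
        linForm H.rep * (minorMatrix A J).cramer r b := by
      intro b
      rw [← hr, map_smul]
      rfl
    choose q hq using fun b => exists_val_eq_div (isHomogeneous_cramer
      (isHomogeneous_minorMatrix A J) (fun a => isHomogeneous_linForm (τ a • H.rep)) b)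
      (isHomogeneous_det (isHomogeneous_minorMatrix A J)) hJ
    have h1 := (cramer_solve hJ (fun a => linForm (τ a • H.rep)) fun b => (q b).val).2 hq
    let e : Fin (n + k) → FunField n :=
      fun j => algebraMap ℂ (FunField n) (w j) - ∑ b, if J b = j then q b else 0
    have hval : ∀ j, (e j).val = algebraMap ℂ (ConeField n) (w j) -
        ∑ b, if J b = j then (q b).val else 0 := by
      intro j
      simp only [e, map_sub, map_sum, AlgHom.commutes, apply_ite FunField.val, map_zero]
    have he : e ∈ kernelGeneric A := by
      intro a
      simp only [hval, mul_sub, Finset.sum_sub_distrib, Finset.mul_sum, mul_ite, mul_zero]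
      have h2 : ∀ y : Fin (n + k) → ConeField n,
          ∑ j, ∑ b, (if J b = j then y j * (q b).val else 0) = ∑ b, y (J b) * (q b).val := by
        intro y
        rw [Finset.sum_comm]
        simp
      refine sub_eq_zero.2 (Eq.trans ?_ ((h1 a).symm.trans
        (h2 fun j => toCone (linForm (A a j))).symm))
      rw [← hτ, linForm_sum, toCone, map_sum]
      refine Finset.sum_congr rfl fun j _ => ?_
      rw [mul_comm]
      exact (toCone_linForm_smul _ _).symm
    refine ⟨⟨e, he⟩, fun j => ∑ b, if J b = j then
      toCone ((minorMatrix A J).cramer r b) / toCone (minorMatrix A J).det else 0, fun j => ?_,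
      fun p hp j m => ?_⟩
    · rw [hval, Finset.mul_sum]
      congr 1
      refine Finset.sum_congr rfl fun b _ => ?_
      split_ifs
      · rw [hq, hcr, ← mul_div_assoc]
        simp only [toCone, map_mul]
      · rw [mul_zero]
    · rw [Finset.sum_mul]
      refine RegAt.sum fun b _ => ?_
      split_ifs
      · -- times `linForm m`, the numerator is the determinant of a matrix of linear forms
        have h2 : linForm m * (minorMatrix A J).cramer r b =
            (minorMatrix A J).cramer (fun a => linForm (τ a • m)) b := by
          have h3 : (fun a => linForm (τ a • m)) = linForm m • r := by
            ext1 a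
            rw [Pi.smul_apply, smul_eq_mul, linForm_smul, mul_comm]
          rw [h3, map_smul]
          rfl
        refine ⟨k, (minorMatrix A J).cramer (fun a => linForm (τ a • m)) b, _,
          isHomogeneous_cramer (isHomogeneous_minorMatrix A J)
            (fun a => isHomogeneous_linForm (τ a • m)) b,
          isHomogeneous_det (isHomogeneous_minorMatrix A J), hp, ?_⟩
        rw [← h2, div_mul_eq_mul_div]
        simp only [toCone, map_mul]
        rw [mul_comm]
      · rw [zero_mul]
        exact RegAt.zero _ _
  choose e x hex hxr using hcorr
  choose J hJ using fun q : Point n => hA.exists_minor q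
  have hJ0 : ∀ q, (minorMatrix A (J q)).det ≠ 0 := fun q => ne_zero_of_eval_ne_zero (hJ q)
  have hmem : ∀ (J : Fin k → Fin (n + k)) (h : (minorMatrix A J).det ≠ 0) (q : Point n),
      MvPolynomial.eval q.rep (minorMatrix A J).det ≠ 0 → e J h ∈ kernelSheaf A q := by
    intro J h q hq j
    rw [mem_localRing_iff, hex]
    have h1 : algebraMap ℂ (ConeField n) (w j) - toCone (linForm H.rep) * x J h j =
        algebraMap ℂ (ConeField n) (w j) +
          algebraMap ℂ (ConeField n) (-1) * (x J h j * toCone (linForm H.rep)) := by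
      rw [map_neg, map_one]; ring
    rw [h1]
    have h2 := (RegAt.const q (-1)).mul (hxr J h q hq j H.rep)
    exact (RegAt.const q _).add (by simpa using h2)
  rw [h0On_ne_zero_iff]
  refine ⟨fun q => Submodule.Quotient.mk (e (J q.1) (hJ0 q.1)), fun p => ?_, fun h0 => hw ?_⟩
  · refine ⟨k, (minorMatrix A (J p.1)).det, e (J p.1) (hJ0 p.1),
      isHomogeneous_det (isHomogeneous_minorMatrix A (J p.1)), hJ p.1,
      fun q hq => ⟨hmem _ _ _ hq, ?_⟩⟩
    rw [Submodule.Quotient.eq]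
    obtain ⟨m, hm⟩ := exists_vec_dotProduct_ne_zero q.1.rep_nonzero
    refine mem_idealMul_of_regAt hm fun j => ?_
    have h1 : ((e (J q.1) (hJ0 q.1) - e (J p.1) (hJ0 p.1)).1 j).val *
        (toCone (linForm m) / toCone (linForm H.rep)) =
        x (J p.1) (hJ0 p.1) j * toCone (linForm m) + algebraMap ℂ (ConeField n) (-1) *
          (x (J q.1) (hJ0 q.1) j * toCone (linForm m)) := by
      have h2 : ((e (J q.1) (hJ0 q.1) - e (J p.1) (hJ0 p.1)).1 j).val =
          ((e (J q.1) (hJ0 q.1)).1 j).val - ((e (J p.1) (hJ0 p.1)).1 j).val := map_sub _ _ _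
      rw [h2, hex, hex, map_neg, map_one]
      field_simp
      ring
    rw [h1]
    have h2 := (RegAt.const q.1 (-1)).mul (hxr (J q.1) (hJ0 q.1) q.1 (hJ q.1) j m)
    exact (hxr (J p.1) (hJ0 p.1) q.1 hq j m).add (by simpa using h2)
  · -- at a point of `H`, the section has the values `w j`
    obtain ⟨y, hy0, hy⟩ := exists_ne_zero_dotProduct_eq_zero hn H.rep
    obtain ⟨q, c, hc, hq⟩ := exists_smul_rep hy0
    have hqH : Lies q H := by rw [lies_iff, hq, dotProduct_smul, hy, smul_zero]
    have h1 := congrFun h0 ⟨q, hqH⟩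
    rw [Pi.zero_apply, Submodule.Quotient.mk_eq_zero] at h1
    ext j
    have h2 := hasVal_zero_of_mem_idealMul hqH h1 j
    obtain ⟨m, hm⟩ := exists_vec_dotProduct_ne_zero q.rep_nonzero
    obtain ⟨c', hc'⟩ := (hxr (J q) (hJ0 q) q (hJ q) j m).exists_hasVal
    have h3 := (h2.mul (HasVal.linForm q.rep m)).add ((HasVal.linForm q.rep H.rep).mul hc')
    rw [lies_iff.1 hqH, zero_mul, zero_mul, add_zero, hex] at h3
    have h4 := (HasVal.const q.rep (w j)).mul (HasVal.linForm q.rep m)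
    have h5 : algebraMap ℂ (ConeField n) (w j) * toCone (linForm m) =
        (algebraMap ℂ (ConeField n) (w j) - toCone (linForm H.rep) * x (J q) (hJ0 q) j) *
          toCone (linForm m) +
        toCone (linForm H.rep) * (x (J q) (hJ0 q) j * toCone (linForm m)) := by ring
    rw [h5] at h4
    exact (mul_eq_zero.1 (h4.unique h3)).resolve_right hm

/-- A hyperplane is unstable if and only if a constant vector is mapped to a multiple of its
equation. -/
lemma mem_unstableHyperplanes_iff {M : Type} [AddCommGroup M] [Module (FunField n) M]
    {S : SubSheaf n M} (hn : 1 ≤ n) (hA : Nondegenerate A) (hS : Iso (dual S) (kernelSheaf A)) :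
    H ∈ unstableHyperplanes S ↔ ∃ w : Fin (n + k) → ℂ, w ≠ 0 ∧ ∃ τ : Fin k → ℂ,
      ∀ a, ∑ j, w j • A a j = τ a • H.rep := by
  constructor
  · exact fun h => exists_const_of_h0On_ne_zero (h0On_ne_zero_of_iso hS h)
  · rintro ⟨w, hw, τ, hτ⟩
    exact h0On_ne_zero_of_iso hS.symm (h0On_ne_zero_of_const hA hn hw hτ)

end UnstableCriterion

/-! ### Rational normal curves in the dual space -/

section Curves

variable {n : ℕ}

/-- The point with parameter `[s : t]` of the curve with coefficient vectors `L`. -/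
def curvePoint (L : Fin (n + 1) → Fin (n + 1) → ℂ) (s t : ℂ) : Fin (n + 1) → ℂ :=
  ∑ i, (s ^ (n - i.1) * t ^ i.1) • L i

/-- The vector `v` represents a point of the curve with coefficient vectors `L`. -/
def OnCurve (L : Fin (n + 1) → Fin (n + 1) → ℂ) (v : Fin (n + 1) → ℂ) : Prop :=
  ∃ s t c : ℂ, (s ≠ 0 ∨ t ≠ 0) ∧ c ≠ 0 ∧ v = c • curvePoint L s t

/-- The curve with coefficient vectors `L` is the dual curve of `C`. -/
structure Parametrizes (L : Fin (n + 1) → Fin (n + 1) → ℂ) (C : RationalNormalCurve n) :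
    Prop where
  indep : LinearIndependent ℂ L
  mem_iff : ∀ H : Hyperplane n, H ∈ C.osculating ↔ OnCurve L H.rep

lemma linearIndependent_of_forall_dotProduct {L : Fin (n + 1) → Fin (n + 1) → ℂ}
    (h : ∀ d, (∀ i, L i ⬝ᵥ d = 0) → d = 0) : LinearIndependent ℂ L := by
  have h1 : IsUnit (Matrix.of L) := by
    rw [Matrix.isUnit_iff_isUnit_det, isUnit_iff_ne_zero]
    intro h0
    obtain ⟨d, hd0, hd⟩ := Matrix.exists_mulVec_eq_zero_iff.2 h0
    exact hd0 (h d fun i => congrFun hd i)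
  exact Matrix.linearIndependent_rows_iff_isUnit.2 h1

lemma eq_zero_of_forall_dotProduct {L : Fin (n + 1) → Fin (n + 1) → ℂ}
    (h : LinearIndependent ℂ L) {d : Fin (n + 1) → ℂ} (hd : ∀ i, L i ⬝ᵥ d = 0) : d = 0 := by
  have h1 : IsUnit (Matrix.of L) := Matrix.linearIndependent_rows_iff_isUnit.1 h
  rw [Matrix.isUnit_iff_isUnit_det] at h1
  exact Matrix.eq_zero_of_mulVec_eq_zero h1.ne_zero (funext hd)

lemma eq_zero_of_forall_sum_mono {y : Fin (n + 1) → ℂ}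
    (h : ∀ s t : ℂ, ∑ i, y i * (s ^ (n - i.1) * t ^ i.1) = 0) : y = 0 := by
  refine Matrix.eq_zero_of_forall_index_sum_pow_mul_eq_zero
    (f := fun i : Fin (n + 1) => (i.1 : ℂ)) (fun i j hij => Fin.ext (by simpa using hij)) ?_
  intro j
  rw [← h 1 (j.1 : ℂ)]
  refine Finset.sum_congr rfl fun i _ => ?_
  rw [one_pow, one_mul, mul_comm]

lemma curvePoint_dotProduct (L : Fin (n + 1) → Fin (n + 1) → ℂ) (s t : ℂ)
    (d : Fin (n + 1) → ℂ) :
    curvePoint L s t ⬝ᵥ d = ∑ i, (L i ⬝ᵥ d) * (s ^ (n - i.1) * t ^ i.1) := by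
  rw [curvePoint, sum_dotProduct]
  refine Finset.sum_congr rfl fun i _ => ?_
  rw [smul_dotProduct, smul_eq_mul, mul_comm]

lemma dotProduct_eq_zero_of_curvePoint {L : Fin (n + 1) → Fin (n + 1) → ℂ}
    {d : Fin (n + 1) → ℂ} (h : ∀ s t, curvePoint L s t ⬝ᵥ d = 0) (i : Fin (n + 1)) :
    L i ⬝ᵥ d = 0 := by
  have := eq_zero_of_forall_sum_mono (y := fun i => L i ⬝ᵥ d) fun s t => by
    rw [← curvePoint_dotProduct, h]
  exact congrFun this i

lemma curvePoint_one_zero (L : Fin (n + 1) → Fin (n + 1) → ℂ) : curvePoint L 1 0 = L 0 := by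
  rw [curvePoint, Finset.sum_eq_single 0]
  · simp
  · intro i _ hi
    rw [zero_pow (fun h => hi (Fin.ext h)), mul_zero, zero_smul]
  · simp

lemma det_diagonal_choose_ne_zero (n : ℕ) :
    (Matrix.diagonal fun i : Fin (n + 1) => (n.choose i.1 : ℂ)).det ≠ 0 := by
  rw [Matrix.det_diagonal]
  refine Finset.prod_ne_zero_iff.2 fun i _ => ?_
  exact_mod_cast (Nat.choose_pos (Nat.lt_succ_iff.1 i.2)).ne'

/-- The dual curve of `C` is again a rational normal curve; its coefficient vectors are the rows of
the inverse of the frame of `C`, up to binomial coefficients. -/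
lemma parametrizes_of_mul {L : Fin (n + 1) → Fin (n + 1) → ℂ} {C : RationalNormalCurve n}
    (h : Matrix.of L * (C.frame : Matrix (Fin (n + 1)) (Fin (n + 1)) ℂ) =
      Matrix.diagonal fun i => (n.choose i.1 : ℂ)) : Parametrizes L C := by
  have hdet := det_diagonal_choose_ne_zero n
  have hLC : ∀ i j, L i ⬝ᵥ (fun l => (C.frame : Matrix (Fin (n + 1)) (Fin (n + 1)) ℂ) l j) =
      if i = j then (n.choose i.1 : ℂ) else 0 := by
    intro i j
    have := congrFun (congrFun h i) j
    rw [Matrix.mul_apply, Matrix.diagonal_apply] at this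
    exact this
  -- the equation of the osculating hyperplane at `[s₀ : t₀]` is the curve point `[t₀ : -s₀]`
  have hpow : ∀ s₀ t₀ s t : ℂ,
      ∑ i, curvePoint L t₀ (-s₀) i * C.param s t i = (t₀ * s - s₀ * t) ^ n := by
    intro s₀ t₀ s t
    have h1 : ∑ i, curvePoint L t₀ (-s₀) i * C.param s t i =
        curvePoint L t₀ (-s₀) ⬝ᵥ C.param s t := rfl
    have h2 : C.param s t = ∑ j : Fin (n + 1), (s ^ (n - j.1) * t ^ j.1) •
        (fun l => (C.frame : Matrix (Fin (n + 1)) (Fin (n + 1)) ℂ) l j) := by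
      ext l
      simp only [RationalNormalCurve.param, Matrix.mulVec, dotProduct, Finset.sum_apply,
        Pi.smul_apply, smul_eq_mul]
      exact Finset.sum_congr rfl fun j _ => mul_comm _ _
    rw [h1, h2, dotProduct_sum]
    have h3 : (t₀ * s - s₀ * t) ^ n = ∑ j : Fin (n + 1),
        (t₀ * s) ^ (n - j.1) * (-s₀ * t) ^ j.1 * (n.choose j.1 : ℂ) := by
      rw [sub_eq_neg_add, ← neg_mul, add_pow, Finset.sum_range]
      refine Finset.sum_congr rfl fun j _ => ?_
      ring
    rw [h3]
    refine Finset.sum_congr rfl fun j _ => ?_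
    rw [dotProduct_smul, curvePoint_dotProduct, Finset.sum_eq_single j, hLC, if_pos rfl,
      smul_eq_mul, mul_pow, mul_pow]
    · ring
    · intro i _ hi
      rw [hLC, if_neg hi, zero_mul]
    · simp
  have hLI : LinearIndependent ℂ L := by
    have h1 : (Matrix.of L).det ≠ 0 := by
      rw [← h, Matrix.det_mul] at hdet
      exact left_ne_zero_of_mul hdet
    exact Matrix.linearIndependent_rows_iff_isUnit.2
      ((Matrix.isUnit_iff_isUnit_det _).2 (isUnit_iff_ne_zero.2 h1))
  refine ⟨hLI, fun H => ⟨?_, ?_⟩⟩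
  · rintro ⟨s₀, t₀, c, h0, hc, hH⟩
    refine ⟨t₀, -s₀, c, by simpa [or_comm] using h0, hc, ?_⟩
    rw [← sub_eq_zero]
    have hz : ∀ s t, ∑ j : Fin (n + 1), ((H.rep - c • curvePoint L t₀ (-s₀)) ⬝ᵥ
        fun l => (C.frame : Matrix (Fin (n + 1)) (Fin (n + 1)) ℂ) l j) *
          (s ^ (n - j.1) * t ^ j.1) = 0 := by
      intro s t
      have h1 : ∑ i, (H.rep - c • curvePoint L t₀ (-s₀)) i * C.param s t i = 0 := by
        simp only [Pi.sub_apply, Pi.smul_apply, smul_eq_mul, sub_mul, Finset.sum_sub_distrib, hH,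
          mul_assoc, ← Finset.mul_sum, hpow, sub_self]
      rw [← h1]
      simp only [RationalNormalCurve.param, Matrix.mulVec, dotProduct, Finset.sum_mul,
        Finset.mul_sum]
      rw [Finset.sum_comm]
      exact Finset.sum_congr rfl fun i _ => Finset.sum_congr rfl fun j _ => mul_assoc _ _ _
    have h1 := eq_zero_of_forall_sum_mono hz
    have h2 : (C.frame : Matrix (Fin (n + 1)) (Fin (n + 1)) ℂ).det ≠ 0 := by
      rw [← h, Matrix.det_mul] at hdet
      exact right_ne_zero_of_mul hdet
    exact Matrix.eq_zero_of_vecMul_eq_zero h2 h1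
  · rintro ⟨s, t, c, h0, hc, hH⟩
    refine ⟨-t, s, c, by simpa [or_comm] using h0, hc, fun s' t' => ?_⟩
    rw [← hpow, neg_neg, hH]
    simp only [Pi.smul_apply, smul_eq_mul, mul_assoc, Finset.mul_sum]

lemma exists_parametrizes (C : RationalNormalCurve n) : ∃ L, Parametrizes L C := by
  refine ⟨Matrix.of.symm ((Matrix.diagonal fun i => (n.choose i.1 : ℂ)) *
    (C.frame : Matrix (Fin (n + 1)) (Fin (n + 1)) ℂ)⁻¹), parametrizes_of_mul ?_⟩
  rw [Equiv.apply_symm_apply, Matrix.nonsing_inv_mul_cancel_right]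
  exact (Matrix.isUnit_iff_isUnit_det _).1 C.frame.isUnit

lemma exists_curve_of_linearIndependent {L : Fin (n + 1) → Fin (n + 1) → ℂ}
    (hL : LinearIndependent ℂ L) : ∃ C : RationalNormalCurve n, Parametrizes L C := by
  have h1 : IsUnit (Matrix.of L).det :=
    (Matrix.isUnit_iff_isUnit_det _).1 (Matrix.linearIndependent_rows_iff_isUnit.1 hL)
  refine ⟨⟨Matrix.GeneralLinearGroup.mkOfDetNeZero
    ((Matrix.of L)⁻¹ * Matrix.diagonal fun i => (n.choose i.1 : ℂ)) ?_⟩, parametrizes_of_mul ?_⟩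
  · rw [Matrix.det_mul]
    exact mul_ne_zero ((Matrix.isUnit_nonsing_inv_det_iff.2 h1).ne_zero)
      (det_diagonal_choose_ne_zero n)
  · exact Matrix.mul_nonsing_inv_cancel_left _ _ h1

/-- A product of `m` binary linear forms is a combination of the monomials of degree `m`. -/
lemma exists_coeff_prod {ι : Type*} (S : Finset ι) (α β : ι → ℂ) : ∃ q : ℕ → ℂ, ∀ s t : ℂ,
    ∏ i ∈ S, (α i * s + β i * t) =
      ∑ i ∈ Finset.range (S.card + 1), q i * (s ^ (S.card - i) * t ^ i) := by
  classical
  induction S using Finset.induction_on with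
  | empty => exact ⟨fun _ => 1, fun s t => by simp⟩
  | insert j S hj ih =>
    obtain ⟨q, hq⟩ := ih
    refine ⟨fun i => (if i < S.card + 1 then α j * q i else 0) +
      (if i = 0 then 0 else β j * q (i - 1)), fun s t => ?_⟩
    rw [Finset.prod_insert hj, hq, Finset.card_insert_of_notMem hj, add_mul]
    simp only [add_mul, Finset.sum_add_distrib]
    congr 1
    · rw [Finset.sum_range_succ _ (S.card + 1), if_neg (lt_irrefl _), zero_mul, add_zero,
        Finset.mul_sum]
      refine Finset.sum_congr rfl fun i hi => ?_
      have hi' := Finset.mem_range.1 hi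
      rw [if_pos hi', show S.card + 1 - i = (S.card - i) + 1 by omega, pow_succ]
      ring
    · rw [Finset.sum_range_succ' _ (S.card + 1), if_pos rfl, zero_mul, add_zero, Finset.mul_sum]
      refine Finset.sum_congr rfl fun i hi => ?_
      rw [if_neg (Nat.succ_ne_zero i), Nat.add_sub_cancel, Nat.add_sub_add_right, pow_succ]
      ring

/-- The curve through the points `x j` of a basis, with prescribed parameters `[p j : q j]`. -/
lemma exists_lagrange {x : Fin (n + 1) → Fin (n + 1) → ℂ} (hx : LinearIndependent ℂ x)
    {p q g : Fin (n + 1) → ℂ} (hpq : ∀ i j, i ≠ j → p i * q j - q i * p j ≠ 0)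
    (hg : ∀ j, g j ≠ 0) :
    ∃ L, LinearIndependent ℂ L ∧ ∀ s t, curvePoint L s t =
      ∑ j, (g j * ∏ i ∈ Finset.univ.erase j, (s * q i - t * p i)) • x j := by
  have h1 : ∀ j, ∃ E : ℕ → ℂ, ∀ s t : ℂ, ∏ i ∈ Finset.univ.erase j, (s * q i - t * p i) =
      ∑ i : Fin (n + 1), E i * (s ^ (n - i.1) * t ^ i.1) := by
    intro j
    obtain ⟨E, hE⟩ := exists_coeff_prod (Finset.univ.erase j) q (fun i => - p i)
    have hc : (Finset.univ.erase j).card = n := by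
      rw [Finset.card_erase_of_mem (Finset.mem_univ _), Finset.card_univ, Fintype.card_fin,
        Nat.add_sub_cancel]
    refine ⟨E, fun s t => ?_⟩
    have h2 := hE s t
    rw [hc, Finset.sum_range] at h2
    rw [← h2]
    refine Finset.prod_congr rfl fun i _ => ?_
    ring
  choose E hE using h1
  have hcurve : ∀ s t, curvePoint (fun i => ∑ j, (g j * E j i.1) • x j) s t =
      ∑ j, (g j * ∏ i ∈ Finset.univ.erase j, (s * q i - t * p i)) • x j := by
    intro s t
    simp only [curvePoint, hE, Finset.smul_sum, Finset.mul_sum, Finset.sum_smul, smul_smul]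
    rw [Finset.sum_comm]
    refine Finset.sum_congr rfl fun j _ => Finset.sum_congr rfl fun i _ => ?_
    congr 1
    ring
  refine ⟨_, linearIndependent_of_forall_dotProduct fun d hd => ?_, hcurve⟩
  refine eq_zero_of_forall_dotProduct hx fun j => ?_
  have h2 : curvePoint (fun i => ∑ j, (g j * E j i.1) • x j) (p j) (q j) ⬝ᵥ d = 0 := by
    rw [curvePoint_dotProduct]
    refine Finset.sum_eq_zero fun i _ => ?_
    rw [hd i, zero_mul]
  rw [hcurve, Finset.sum_eq_single j, smul_dotProduct, smul_eq_mul] at h2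
  · refine (mul_eq_zero.1 h2).resolve_left (mul_ne_zero (hg j) ?_)
    refine Finset.prod_ne_zero_iff.2 fun i hi => ?_
    have := hpq j i (Finset.ne_of_mem_erase hi).symm
    exact this
  · intro i _ hi
    rw [Finset.prod_eq_zero (Finset.mem_erase.2 ⟨hi.symm, Finset.mem_univ j⟩), mul_zero, zero_smul]
    ring
  · simp

/-- A linear change of the parameters of a curve. -/
lemma exists_reparam (L : Fin (n + 1) → Fin (n + 1) → ℂ) (α β γ δ : ℂ) :
    ∃ L' : Fin (n + 1) → Fin (n + 1) → ℂ,
      ∀ s t, curvePoint L' s t = curvePoint L (α * s + β * t) (γ * s + δ * t) := by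
  have h1 : ∀ j : Fin (n + 1), ∃ E : ℕ → ℂ, ∀ s t : ℂ,
      (α * s + β * t) ^ (n - j.1) * (γ * s + δ * t) ^ j.1 =
        ∑ i : Fin (n + 1), E i * (s ^ (n - i.1) * t ^ i.1) := by
    intro j
    obtain ⟨E, hE⟩ := exists_coeff_prod (Finset.univ : Finset (Fin (n - j.1) ⊕ Fin j.1))
      (Sum.elim (fun _ => α) fun _ => γ) (Sum.elim (fun _ => β) fun _ => δ)
    have hc : (Finset.univ : Finset (Fin (n - j.1) ⊕ Fin j.1)).card = n := by
      rw [Finset.card_univ, Fintype.card_sum, Fintype.card_fin, Fintype.card_fin]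
      have := j.2
      omega
    refine ⟨E, fun s t => ?_⟩
    have h2 := hE s t
    rw [hc, Finset.sum_range] at h2
    rw [← h2, Fintype.prod_sum_type]
    simp
  choose E hE using h1
  refine ⟨fun i => ∑ j, E j i.1 • L j, fun s t => ?_⟩
  simp only [curvePoint, hE, Finset.smul_sum, Finset.sum_smul, smul_smul]
  rw [Finset.sum_comm]
  refine Finset.sum_congr rfl fun j _ => Finset.sum_congr rfl fun i _ => ?_
  congr 1
  ring

/-- The parametrization can be chosen such that a given point of the curve is the first
coefficient vector. -/
lemma Parametrizes.exists_first {L : Fin (n + 1) → Fin (n + 1) → ℂ} {C : RationalNormalCurve n}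
    (h : Parametrizes L C) {v : Fin (n + 1) → ℂ} (hv : OnCurve L v) :
    ∃ L', Parametrizes L' C ∧ ∃ c : ℂ, c ≠ 0 ∧ v = c • L' 0 := by
  obtain ⟨s₀, t₀, c, h0, hc, rfl⟩ := hv
  obtain ⟨β, δ, hD⟩ : ∃ β δ : ℂ, s₀ * δ - β * t₀ ≠ 0 := by
    rcases h0 with h0 | h0
    · exact ⟨0, 1, by simpa using h0⟩
    · exact ⟨1, 0, by simpa using h0⟩
  -- move the parameter `[1 : 0]` to `[s₀ : t₀]`
  obtain ⟨L', hL'⟩ := exists_reparam L s₀ β t₀ δ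
  have hinv : ∀ s t, curvePoint L s t =
      curvePoint L' ((δ * s - β * t) / (s₀ * δ - β * t₀))
        ((s₀ * t - t₀ * s) / (s₀ * δ - β * t₀)) := by
    intro s t
    rw [hL']
    congr 1
    · rw [mul_div_assoc', mul_div_assoc', ← add_div, eq_div_iff hD]
      ring
    · rw [mul_div_assoc', mul_div_assoc', ← add_div, eq_div_iff hD]
      ring
  refine ⟨L', ⟨?_, fun H => ?_⟩, c, hc, ?_⟩
  · refine linearIndependent_of_forall_dotProduct fun d hd => ?_
    refine eq_zero_of_forall_dotProduct h.indep fun i => ?_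
    refine dotProduct_eq_zero_of_curvePoint (fun s t => ?_) i
    rw [hinv, curvePoint_dotProduct]
    refine Finset.sum_eq_zero fun i _ => ?_
    rw [hd i, zero_mul]
  · rw [h.mem_iff]
    constructor
    · rintro ⟨s, t, c, hst, hc, hH⟩
      refine ⟨_, _, c, ?_, hc, hH.trans (by rw [hinv])⟩
      by_contra! hcon
      obtain ⟨h1, h2⟩ := hcon
      rw [div_eq_zero_iff, or_iff_left hD] at h1 h2
      have h3 : (s₀ * δ - β * t₀) * s = 0 := by linear_combination s₀ * h1 + β * h2
      have h4 : (s₀ * δ - β * t₀) * t = 0 := by linear_combination t₀ * h1 + δ * h2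
      rcases hst with hst | hst
      · exact hst ((mul_eq_zero.1 h3).resolve_left hD)
      · exact hst ((mul_eq_zero.1 h4).resolve_left hD)
    · rintro ⟨s, t, c, hst, hc, hH⟩
      refine ⟨_, _, c, ?_, hc, hH.trans (by rw [hL'])⟩
      by_contra! hcon
      obtain ⟨h1, h2⟩ := hcon
      have h3 : (s₀ * δ - β * t₀) * s = 0 := by linear_combination δ * h1 - β * h2
      have h4 : (s₀ * δ - β * t₀) * t = 0 := by linear_combination s₀ * h2 - t₀ * h1
      rcases hst with hst | hst
      · exact hst ((mul_eq_zero.1 h3).resolve_left hD)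
      · exact hst ((mul_eq_zero.1 h4).resolve_left hD)
  · rw [← curvePoint_one_zero L', hL']
    simp

end Curves

/-! ### Tensors of rank one in the space of relations -/

section Cauchy

variable {n k : ℕ} {f : Fin (n + k + 1) → Fin (n + 1) → ℂ} {μ : Fin k → Fin (n + k + 1) → ℂ}

lemma exists_sum_equiv (n k : ℕ) (i₀ : Fin (n + k + 1)) :
    ∃ ε : Fin (n + 1) ⊕ Fin k ≃ Fin (n + k + 1), ε (Sum.inl 0) = i₀ := by
  let e : Fin (n + 1) ⊕ Fin k ≃ Fin (n + k + 1) :=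
    finSumFinEquiv.trans (finCongr (by omega))
  exact ⟨e.trans (Equiv.swap (e (Sum.inl 0)) i₀), by simp⟩

/-- In general position, the entries and the `2 × 2` minors of the matrix that expresses the
remaining vectors in terms of `n + 1` of them are nonzero. -/
lemma GenPos.exists_matrix (hf : GenPos f) (ε : Fin (n + 1) ⊕ Fin k ≃ Fin (n + k + 1)) :
    LinearIndependent ℂ (fun i => f (ε (Sum.inl i))) ∧ ∃ B : Fin k → Fin (n + 1) → ℂ,
      (∀ a, f (ε (Sum.inr a)) = ∑ i, B a i • f (ε (Sum.inl i))) ∧ (∀ a i, B a i ≠ 0) ∧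
      ∀ a b i j, a ≠ b → i ≠ j → B a i * B b j ≠ B a j * B b i := by
  classical
  have hLI : LinearIndependent ℂ (fun i => f (ε (Sum.inl i))) :=
    hf.linearIndependent le_rfl (b := fun i => ε (Sum.inl i))
      (ε.injective.comp Sum.inl_injective)
  have hspan := span_range_eq_top hLI
  have hB : ∀ a, ∃ B : Fin (n + 1) → ℂ, ∑ i, B i • f (ε (Sum.inl i)) = f (ε (Sum.inr a)) := by
    intro a
    have : f (ε (Sum.inr a)) ∈ Submodule.span ℂ (Set.range fun i => f (ε (Sum.inl i))) := by
      rw [hspan]; trivial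
    exact (Submodule.mem_span_range_iff_exists_fun ℂ).1 this
  choose B hB using hB
  -- a relation among the vectors, written in the two groups of indices
  have hrel : ∀ (p : Fin (n + 1) → ℂ) (r : Fin k → ℂ),
      ∑ i, p i • f (ε (Sum.inl i)) + ∑ a, r a • f (ε (Sum.inr a)) = 0 →
      ∀ s : Finset (Fin (n + 1) ⊕ Fin k), s.card ≤ n + 1 →
        (∀ i, Sum.inl i ∉ s → p i = 0) → (∀ a, Sum.inr a ∉ s → r a = 0) → r = 0 := by
    intro p r h s hs hp hr
    have h1 := hf (fun j => Sum.elim p r (ε.symm j)) ?_ (s.map ε.toEmbedding) (by simpa) ?_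
    · ext a
      simpa using h1 (ε (Sum.inr a))
    · rw [← ε.sum_comp, Fintype.sum_sum_type]
      simpa using h
    · intro j hj
      obtain ⟨x, rfl⟩ := ε.surjective j
      have hx : x ∉ s := by simpa using hj
      rw [ε.symm_apply_apply]
      rcases x with i | a
      exacts [hp i hx, hr a hx]
  refine ⟨hLI, B, fun a => (hB a).symm, fun a i h0 => ?_, fun a b i j hab hij h0 => ?_⟩
  · have h1 := hrel (B a) (Pi.single a (-1)) ?_
      (insert (Sum.inr a) ((Finset.univ.erase i).map Function.Embedding.inl)) ?_ ?_ ?_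
    · simpa using congrFun h1 a
    · rw [hB, Finset.sum_eq_single a]
      · simp
      · intro b _ hb
        rw [Pi.single_eq_of_ne hb, zero_smul]
      · simp
    · refine (Finset.card_insert_le _ _).trans ?_
      rw [Finset.card_map, Finset.card_erase_of_mem (Finset.mem_univ _), Finset.card_univ,
        Fintype.card_fin]
      omega
    · intro i' hi'
      have : i' = i := by simpa using hi'
      rw [this, h0]
    · intro b hb
      have : b ≠ a := by
        rintro rfl
        simp at hb
      rw [Pi.single_eq_of_ne this]
  · -- the combination of the two vectors in which the coordinates `i` and `j` vanish
    have key : ∀ x y : ℂ, x * B a i + y * B b i = 0 → x * B a j + y * B b j = 0 →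
        x = 0 ∧ y = 0 := by
      intro x y hi hj
      have h1 := hrel (fun l => -(x * B a l + y * B b l)) (Pi.single a x + Pi.single b y) ?_
        (insert (Sum.inr a) (insert (Sum.inr b)
          (((Finset.univ.erase i).erase j).map Function.Embedding.inl))) ?_ ?_ ?_
      · have ha := congrFun h1 a
        have hb := congrFun h1 b
        simp [hab, hab.symm] at ha hb
        exact ⟨ha, hb⟩
      · simp only [Pi.add_apply, add_smul, Finset.sum_add_distrib, neg_smul,
          Finset.sum_neg_distrib, mul_smul]
        rw [← Finset.smul_sum, ← Finset.smul_sum, hB, hB]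
        rw [Finset.sum_eq_single a, Finset.sum_eq_single b]
        · simp
        · intro c _ hc
          rw [Pi.single_eq_of_ne hc, zero_smul]
        · simp
        · intro c _ hc
          rw [Pi.single_eq_of_ne hc, zero_smul]
        · simp
      · refine (Finset.card_insert_le _ _).trans ?_
        refine (Nat.succ_le_succ (Finset.card_insert_le _ _)).trans ?_
        rw [Finset.card_map, Finset.card_erase_of_mem, Finset.card_erase_of_mem (Finset.mem_univ _),
          Finset.card_univ, Fintype.card_fin]
        · have : n ≠ 0 := by
            rintro rfl
            exact hij (Fin.ext (by omega))
          omega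
        · exact Finset.mem_erase.2 ⟨hij.symm, Finset.mem_univ _⟩
      · intro l hl
        simp only [Finset.mem_insert, reduceCtorEq, Finset.mem_map, Finset.mem_erase, ne_eq,
          Finset.mem_univ, and_true, Function.Embedding.inl_apply, Sum.inl.injEq, exists_eq_right,
          false_or, not_and, not_not] at hl
        by_cases hlj : l = j
        · rw [hlj, hj, neg_zero]
        · rw [hl hlj, hi, neg_zero]
      · intro c hc
        have h1 : c ≠ a := by rintro rfl; simp at hc
        have h2 : c ≠ b := by rintro rfl; simp at hc
        rw [Pi.add_apply, Pi.single_eq_of_ne h1, Pi.single_eq_of_ne h2, add_zero]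
    have h1 := key (B b i) (-B a i) (by ring) (by linear_combination -h0)
    have h2 := key (B b j) (-B a j) (by linear_combination h0) (by ring)
    have h3 := key 1 0 (by simpa using neg_eq_zero.1 h1.2) (by simpa using neg_eq_zero.1 h2.2)
    exact one_ne_zero h3.1

/-- The multiples by weights `w` of the relations between the vectors `f j`, in coordinates. -/
lemma IsGale.exists_coord (h : IsGale f μ) {ε : Fin (n + 1) ⊕ Fin k ≃ Fin (n + k + 1)}
    {B : Fin k → Fin (n + 1) → ℂ}
    (hB : ∀ a, f (ε (Sum.inr a)) = ∑ i, B a i • f (ε (Sum.inl i)))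
    {w : Fin (n + k + 1) → ℂ} {T : Fin k → Fin (n + 1) → ℂ}
    (hw : ∀ b, ∑ j, (w j * μ b j) • f j = T b) :
    ∃ u : Fin k → Fin k → ℂ,
      (∀ a, ∑ i, (B a i * (w (ε (Sum.inr a)) - w (ε (Sum.inl i)))) • f (ε (Sum.inl i)) =
        ∑ b, u a b • T b) ∧
      ∀ a i, ∑ b, u a b * μ b (ε (Sum.inl i)) = - B a i := by
  classical
  have h1 : ∀ a, ∃ u : Fin k → ℂ, ∀ x, Sum.elim (fun i => - B a i) (Pi.single a 1) x =
      ∑ b, u b * μ b (ε x) := by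
    intro a
    obtain ⟨u, hu⟩ := h.exists_eq_comb
      (c := fun j => Sum.elim (fun i => - B a i) (Pi.single a 1) (ε.symm j)) (by
        rw [← ε.sum_comp, Fintype.sum_sum_type]
        simp only [Equiv.symm_apply_apply, Sum.elim_inl, Sum.elim_inr, neg_smul,
          Finset.sum_neg_distrib]
        rw [Finset.sum_eq_single a, Pi.single_eq_same, one_smul, hB, neg_add_cancel]
        · intro c _ hc
          rw [Pi.single_eq_of_ne hc, zero_smul]
        · simp)
    exact ⟨u, fun x => by simpa using hu (ε x)⟩
  choose u hu using h1
  refine ⟨u, fun a => ?_, fun a i => (hu a (Sum.inl i)).symm⟩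
  simp only [← hw, Finset.smul_sum, smul_smul]
  rw [Finset.sum_comm, ← ε.sum_comp, Fintype.sum_sum_type]
  have h2 : ∀ x, ∑ b, (u a b * (w (ε x) * μ b (ε x))) • f (ε x) =
      (w (ε x) * Sum.elim (fun i => - B a i) (Pi.single a 1) x) • f (ε x) := by
    intro x
    rw [hu, ← Finset.sum_smul, Finset.mul_sum]
    congr 1
    exact Finset.sum_congr rfl fun b _ => by ring
  simp only [h2, Sum.elim_inl, Sum.elim_inr]
  rw [Finset.sum_eq_single (s := (Finset.univ : Finset (Fin k))) a, Pi.single_eq_same, mul_one, hB,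
    Finset.smul_sum, ← Finset.sum_add_distrib]
  · refine Finset.sum_congr rfl fun i _ => ?_
    rw [smul_smul, ← add_smul]
    congr 1
    ring
  · intro c _ hc
    rw [Pi.single_eq_of_ne hc, mul_zero, zero_smul]
  · simp

/-- Vectors whose coordinates form a Cauchy matrix lie on a rational normal curve, which passes
through the points of the basis. -/
lemma exists_onCurve_of_cauchy (hn : 1 ≤ n) {x : Fin (n + 1) → Fin (n + 1) → ℂ}
    (hx : LinearIndependent ℂ x)
    {p q g : Fin (n + 1) → ℂ} (hpq : ∀ i j, i ≠ j → p i * q j - q i * p j ≠ 0)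
    (hg : ∀ j, g j ≠ 0) :
    ∃ L, LinearIndependent ℂ L ∧ (∀ i, OnCurve L (x i)) ∧
      ∀ (s t c : ℂ) (y : Fin (n + 1) → ℂ), (∀ i, s * q i - t * p i ≠ 0) → c ≠ 0 →
        y = ∑ i, (c * (g i / (s * q i - t * p i))) • x i → OnCurve L y := by
  obtain ⟨L, hL, hcurve⟩ := exists_lagrange hx hpq hg
  refine ⟨L, hL, fun j => ?_, fun s t c y hst hc hy => ?_⟩
  · have h1 : g j * ∏ i ∈ Finset.univ.erase j, (p j * q i - q j * p i) ≠ 0 :=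
      mul_ne_zero (hg j) (Finset.prod_ne_zero_iff.2 fun i hi =>
        hpq j i (Finset.ne_of_mem_erase hi).symm)
    have h2 : curvePoint L (p j) (q j) =
        (g j * ∏ i ∈ Finset.univ.erase j, (p j * q i - q j * p i)) • x j := by
      rw [hcurve, Finset.sum_eq_single j]
      · intro i _ hi
        rw [Finset.prod_eq_zero (Finset.mem_erase.2 ⟨hi.symm, Finset.mem_univ j⟩), mul_zero,
          zero_smul]
        ring
      · simp
    refine ⟨p j, q j, _, ?_, inv_ne_zero h1, ?_⟩
    · have : Nontrivial (Fin (n + 1)) := Fin.nontrivial_iff_two_le.2 (by omega)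
      obtain ⟨i, hi⟩ := exists_ne j
      by_contra! h0
      have := hpq j i hi.symm
      rw [h0.1, h0.2] at this
      simp at this
    · rw [h2, smul_smul, inv_mul_cancel₀ h1, one_smul]
  · have hP : ∏ i, (s * q i - t * p i) ≠ 0 := Finset.prod_ne_zero_iff.2 fun i _ => hst i
    refine ⟨s, t, c / ∏ i, (s * q i - t * p i), ?_, div_ne_zero hc hP, ?_⟩
    · by_contra! h0
      have := hst 0
      rw [h0.1, h0.2] at this
      simp at this
    · rw [hy, hcurve, Finset.smul_sum]
      refine Finset.sum_congr rfl fun i _ => ?_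
      rw [smul_smul, ← Finset.mul_prod_erase Finset.univ _ (Finset.mem_univ i)]
      congr 1
      have h1 := hst i
      have h2 : ∏ i' ∈ Finset.univ.erase i, (s * q i' - t * p i') ≠ 0 :=
        Finset.prod_ne_zero_iff.2 fun i _ => hst i
      field_simp

lemma coeff_eq_of_sum_smul_eq {x : Fin (n + 1) → Fin (n + 1) → ℂ} (hx : LinearIndependent ℂ x)
    {c d : Fin (n + 1) → ℂ} (h : ∑ i, c i • x i = ∑ i, d i • x i) (i : Fin (n + 1)) :
    c i = d i := by
  refine sub_eq_zero.1 (Fintype.linearIndependent_iff.1 hx (fun i => c i - d i) ?_ i)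
  simp only [sub_smul, Finset.sum_sub_distrib, h, sub_self]

lemma exists_coeff_of_linearIndependent {x : Fin (n + 1) → Fin (n + 1) → ℂ}
    (hx : LinearIndependent ℂ x) (v : Fin (n + 1) → ℂ) : ∃ c : Fin (n + 1) → ℂ,
      v = ∑ i, c i • x i := by
  have : v ∈ Submodule.span ℂ (Set.range x) := by rw [span_range_eq_top hx]; trivial
  obtain ⟨c, hc⟩ := (Submodule.mem_span_range_iff_exists_fun ℂ).1 this
  exact ⟨c, hc.symm⟩

/-- If a tensor `τ ⊗ v` of rank one is a combination of the `μ j ⊗ f j`, then either it is a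
multiple of one of them, or all the `f j` lie on a rational normal curve. -/
lemma IsGale.exists_eq_smul_or_exists_onCurve (h : IsGale f μ) (hn : 1 ≤ n) (hk : 2 ≤ k)
    {w : Fin (n + k + 1) → ℂ} (hw : ∃ i j, w i ≠ w j) {v : Fin (n + 1) → ℂ} (hv : v ≠ 0)
    {τ : Fin k → ℂ}
    (hτ : ∀ b, ∑ j, (w j * μ b j) • f j = τ b • v) :
    (∃ j, ∃ c : ℂ, v = c • f j) ∨ ∃ L, LinearIndependent ℂ L ∧ ∀ j, OnCurve L (f j) := by
  classical
  by_cases hprop : ∃ j, ∃ c : ℂ, v = c • f j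
  · exact Or.inl hprop
  right
  push Not at hprop
  obtain ⟨ε, -⟩ := exists_sum_equiv n k 0
  obtain ⟨hx, B, hB, hB0, hBB⟩ := h.genPos.exists_matrix ε
  obtain ⟨u, hu, -⟩ := h.exists_coord hB hτ
  obtain ⟨z, hz⟩ := exists_coeff_of_linearIndependent hx v
  obtain ⟨T, hT⟩ : ∃ T : Fin k → ℂ, ∀ a, T a = ∑ b, u a b * τ b := ⟨_, fun _ => rfl⟩
  -- so `B a i` is `T a * z i` divided by `w a - w i`: a Cauchy matrix, once nothing vanishes
  have hEq : ∀ a i, B a i * (w (ε (Sum.inr a)) - w (ε (Sum.inl i))) = T a * z i := by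
    intro a
    refine coeff_eq_of_sum_smul_eq hx ?_
    rw [hu a]
    simp only [mul_smul]
    rw [← Finset.smul_sum, ← hz, hT, Finset.sum_smul]
    simp only [mul_smul]
  -- otherwise `w` is constant, or `v` is a multiple of one of the last `k` vectors
  have hT0 : ∀ a, T a ≠ 0 := by
    intro a ha
    have h1 : ∀ i, w (ε (Sum.inl i)) = w (ε (Sum.inr a)) := by
      intro i
      have := hEq a i
      rw [ha, zero_mul] at this
      exact (sub_eq_zero.1 ((mul_eq_zero.1 this).resolve_left (hB0 a i))).symm
    have h2 : ∀ b, w (ε (Sum.inr b)) = w (ε (Sum.inr a)) := by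
      intro b
      by_contra hb
      have hd := sub_ne_zero.2 hb
      have h3 : (w (ε (Sum.inr b)) - w (ε (Sum.inr a))) • f (ε (Sum.inr b)) = T b • v := by
        rw [hB, hz, Finset.smul_sum, Finset.smul_sum]
        refine Finset.sum_congr rfl fun i _ => ?_
        rw [smul_smul, smul_smul, ← hEq b i, h1, mul_comm]
      have hTb : T b ≠ 0 := by
        intro h0
        rw [h0, zero_smul] at h3
        exact smul_ne_zero hd (h.genPos.ne_zero _) h3
      refine hprop (ε (Sum.inr b)) ((T b)⁻¹ * (w (ε (Sum.inr b)) - w (ε (Sum.inr a)))) ?_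
      rw [mul_smul, h3, smul_smul, inv_mul_cancel₀ hTb, one_smul]
    have h3 : ∀ j, w j = w (ε (Sum.inr a)) := by
      intro j
      obtain ⟨y, rfl⟩ := ε.surjective j
      rcases y with i | b
      exacts [h1 i, h2 b]
    obtain ⟨i, j, hij⟩ := hw
    exact hij ((h3 i).trans (h3 j).symm)
  obtain ⟨a₀, a₁, ha⟩ : ∃ a₀ a₁ : Fin k, a₀ ≠ a₁ :=
    ⟨⟨0, by omega⟩, ⟨1, by omega⟩, by simp [Fin.ext_iff]⟩
  -- otherwise `v` is a multiple of one of the first `n + 1` vectors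
  have hz0 : ∀ i, z i ≠ 0 := by
    intro i hi
    have h1 : ∀ a, w (ε (Sum.inr a)) = w (ε (Sum.inl i)) := by
      intro a
      have := hEq a i
      rw [hi, mul_zero] at this
      exact sub_eq_zero.1 ((mul_eq_zero.1 this).resolve_left (hB0 a i))
    have h2 : ∀ i' j, i' ≠ j → z i' ≠ 0 → z j = 0 := by
      intro i' j hij hi'
      by_contra hj
      have e1 := hEq a₀ i'
      have e2 := hEq a₀ j
      have e3 := hEq a₁ i'
      have e4 := hEq a₁ j
      rw [h1] at e1 e2 e3 e4
      have hd1 : w (ε (Sum.inl i)) - w (ε (Sum.inl i')) ≠ 0 :=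
        right_ne_zero_of_mul (e1.trans_ne (mul_ne_zero (hT0 _) hi'))
      have hd2 : w (ε (Sum.inl i)) - w (ε (Sum.inl j)) ≠ 0 :=
        right_ne_zero_of_mul (e2.trans_ne (mul_ne_zero (hT0 _) hj))
      refine hBB a₀ a₁ i' j ha hij (mul_right_cancel₀ (mul_ne_zero hd1 hd2) ?_)
      have h5 := congrArg₂ (· * ·) e1 e4
      have h6 := congrArg₂ (· * ·) e2 e3
      linear_combination h5 - h6
    obtain ⟨i', hi'⟩ : ∃ i', z i' ≠ 0 := by
      by_contra! hcon
      exact hv (by rw [hz]; simp [hcon])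
    refine hprop (ε (Sum.inl i')) (z i') ?_
    rw [hz, Finset.sum_eq_single i']
    · intro j _ hj
      rw [h2 i' j hj.symm hi', zero_smul]
    · simp
  have hd : ∀ a i, w (ε (Sum.inr a)) - w (ε (Sum.inl i)) ≠ 0 := fun a i =>
    right_ne_zero_of_mul ((hEq a i).trans_ne (mul_ne_zero (hT0 a) (hz0 i)))
  -- equal parameters would give a vanishing minor of `B`
  have hinj : ∀ i j, i ≠ j → w (ε (Sum.inl i)) - w (ε (Sum.inl j)) ≠ 0 := by
    intro i j hij h0
    have h1 := sub_eq_zero.1 h0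
    have e1 := hEq a₀ i
    have e2 := hEq a₀ j
    have e3 := hEq a₁ i
    have e4 := hEq a₁ j
    have h2 := hd a₀ i
    have h3 := hd a₁ i
    rw [← h1] at e2 e4
    refine hBB a₀ a₁ i j ha hij (mul_right_cancel₀ (mul_ne_zero h2 h3) ?_)
    have h5 := congrArg₂ (· * ·) e1 e4
    have h6 := congrArg₂ (· * ·) e2 e3
    linear_combination h5 - h6
  obtain ⟨L, hL, hLx, hLy⟩ := exists_onCurve_of_cauchy hn hx
    (p := fun i => w (ε (Sum.inl i))) (q := fun _ => 1) (g := z)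
    (fun i j hij => by simpa using hinj i j hij) hz0
  refine ⟨L, hL, fun j => ?_⟩
  obtain ⟨y, rfl⟩ := ε.surjective j
  rcases y with i | a
  · exact hLx i
  · refine hLy (w (ε (Sum.inr a))) 1 (T a) _ (fun i => by simpa using hd a i) (hT0 a) ?_
    rw [hB]
    refine Finset.sum_congr rfl fun i _ => ?_
    congr 1
    rw [mul_one, one_mul, mul_div_assoc', eq_div_iff (hd a i)]
    exact hEq a i

/-- If a combination of the `μ j ⊗ f j` is of the form `μ i ⊗ v + τ ⊗ f i`, then either `v` is a
multiple of `f i`, or all the `f j` lie on a rational normal curve. The tensors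
`μ i ⊗ v + τ ⊗ f i` are the tangent vectors at `μ i ⊗ f i` to the variety of tensors of rank one. -/
lemma IsGale.exists_eq_smul_or_exists_onCurve_of_tangent (h : IsGale f μ) (hn : 1 ≤ n) (hk : 2 ≤ k)
    {w : Fin (n + k + 1) → ℂ} {i₀ : Fin (n + k + 1)} {v : Fin (n + 1) → ℂ} {τ : Fin k → ℂ}
    (hτ : ∀ b, ∑ j, (w j * μ b j) • f j = μ b i₀ • v + τ b • f i₀) :
    (∃ c : ℂ, v = c • f i₀) ∨ ∃ L, LinearIndependent ℂ L ∧ ∀ j, OnCurve L (f j) := by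
  classical
  by_cases hprop : ∃ c : ℂ, v = c • f i₀
  · exact Or.inl hprop
  right
  push Not at hprop
  obtain ⟨ε, rfl⟩ := exists_sum_equiv n k i₀
  obtain ⟨hx, B, hB, hB0, hBB⟩ := h.genPos.exists_matrix ε
  obtain ⟨u, hu, hu'⟩ := h.exists_coord hB hτ
  obtain ⟨z, hz⟩ := exists_coeff_of_linearIndependent hx v
  have hEq : ∀ a i, i ≠ 0 →
      B a i * (w (ε (Sum.inr a)) - w (ε (Sum.inl i))) = - B a 0 * z i := by
    intro a i hi
    have h1 := coeff_eq_of_sum_smul_eq hx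
      (d := fun i => - B a 0 * z i + if i = 0 then ∑ b, u a b * τ b else 0) ((hu a).trans ?_) i
    · rw [h1, if_neg hi, add_zero]
    · simp only [add_smul, Finset.sum_add_distrib, mul_smul, ← hu', smul_add, ite_smul, zero_smul,
        Finset.sum_ite_eq', Finset.mem_univ, if_true]
      rw [← Finset.smul_sum, ← hz, Finset.sum_smul, Finset.sum_smul]
      simp only [mul_smul]
  obtain ⟨a₀, a₁, ha⟩ : ∃ a₀ a₁ : Fin k, a₀ ≠ a₁ :=
    ⟨⟨0, by omega⟩, ⟨1, by omega⟩, by simp [Fin.ext_iff]⟩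
  obtain ⟨i₁, hi₁, hzi₁⟩ : ∃ i, i ≠ 0 ∧ z i ≠ 0 := by
    by_contra! hcon
    refine hprop (z 0) ?_
    rw [hz, Finset.sum_eq_single 0]
    · intro j _ hj
      rw [hcon j hj, zero_smul]
    · simp
  have hz0 : ∀ i, i ≠ 0 → z i ≠ 0 := by
    intro i hi0 hi
    have h1 : ∀ a, w (ε (Sum.inr a)) = w (ε (Sum.inl i)) := by
      intro a
      have := hEq a i hi0
      rw [hi, mul_zero] at this
      exact sub_eq_zero.1 ((mul_eq_zero.1 this).resolve_left (hB0 a i))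
    have e1 := hEq a₀ i₁ hi₁
    have e2 := hEq a₁ i₁ hi₁
    rw [h1] at e1 e2
    refine hBB a₀ a₁ i₁ 0 ha hi₁ (mul_right_cancel₀ hzi₁ ?_)
    linear_combination B a₀ i₁ * e2 - B a₁ i₁ * e1
  have hd : ∀ a i, i ≠ 0 → w (ε (Sum.inr a)) - w (ε (Sum.inl i)) ≠ 0 := fun a i hi =>
    right_ne_zero_of_mul ((hEq a i hi).trans_ne
      (mul_ne_zero (neg_ne_zero.2 (hB0 a 0)) (hz0 i hi)))
  have hinj : ∀ i j, i ≠ 0 → j ≠ 0 → i ≠ j → w (ε (Sum.inl i)) - w (ε (Sum.inl j)) ≠ 0 := by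
    intro i j hi hj hij h0
    have h1 := sub_eq_zero.1 h0
    have e1 := hEq a₀ i hi
    have e2 := hEq a₀ j hj
    have e3 := hEq a₁ i hi
    have e4 := hEq a₁ j hj
    have h2 := hd a₀ i hi
    have h3 := hd a₁ i hi
    rw [← h1] at e2 e4
    refine hBB a₀ a₁ i j ha hij (mul_right_cancel₀ (mul_ne_zero h2 h3) ?_)
    have h5 := congrArg₂ (· * ·) e1 e4
    have h6 := congrArg₂ (· * ·) e2 e3
    linear_combination h5 - h6
  -- the parameter of `f i₀` is the point at infinity
  obtain ⟨L, hL, hLx, hLy⟩ := exists_onCurve_of_cauchy hn hx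
    (p := fun i => if i = 0 then 1 else w (ε (Sum.inl i))) (q := fun i => if i = 0 then 0 else 1)
    (g := fun i => if i = 0 then 1 else z i) (fun i j hij => by
      by_cases hi : i = 0
      · have hj : j ≠ 0 := fun hj => hij (hi.trans hj.symm)
        simp [hi, hj]
      · by_cases hj : j = 0
        · simp [hi, hj]
        · simpa [hi, hj] using hinj i j hi hj hij) (fun j => by
      by_cases hj : j = 0
      · simp [hj]
      · simpa [hj] using hz0 j hj)
  refine ⟨L, hL, fun j => ?_⟩
  obtain ⟨y, rfl⟩ := ε.surjective j
  rcases y with i | a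
  · exact hLx i
  · refine hLy (w (ε (Sum.inr a))) 1 (- B a 0) _ (fun i => ?_) (neg_ne_zero.2 (hB0 a 0)) ?_
    · by_cases hi : i = 0
      · simp [hi]
      · simpa [hi] using hd a i hi
    · rw [hB]
      refine Finset.sum_congr rfl fun i _ => ?_
      congr 1
      by_cases hi : i = 0
      · simp [hi]
      · simp only [hi, if_false, mul_one, one_mul]
        rw [mul_div_assoc', eq_div_iff (hd a i hi)]
        exact hEq a i hi

/-- If `τ ⊗ f i` is a combination of the `μ j ⊗ f j`, then it is a multiple of `μ i ⊗ f i`. -/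
lemma IsGale.exists_eq_mul (h : IsGale f μ) (hn : 1 ≤ n) (hk : 1 ≤ k) {w : Fin (n + k + 1) → ℂ}
    {i₀ : Fin (n + k + 1)} {τ : Fin k → ℂ} (hτ : ∀ b, ∑ j, (w j * μ b j) • f j = τ b • f i₀) :
    ∃ c : ℂ, ∀ b, τ b = c * μ b i₀ := by
  classical
  obtain ⟨ε, rfl⟩ := exists_sum_equiv n k i₀
  obtain ⟨hx, B, hB, hB0, -⟩ := h.genPos.exists_matrix ε
  obtain ⟨u, hu, -⟩ := h.exists_coord hB hτ
  have hEq : ∀ a i, i ≠ 0 → w (ε (Sum.inr a)) = w (ε (Sum.inl i)) := by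
    intro a i hi
    have h1 := coeff_eq_of_sum_smul_eq hx
      (d := fun i => if i = 0 then ∑ b, u a b * τ b else 0) ((hu a).trans ?_) i
    · rw [if_neg hi] at h1
      exact sub_eq_zero.1 ((mul_eq_zero.1 h1).resolve_left (hB0 a i))
    · simp only [ite_smul, zero_smul, Finset.sum_ite_eq', Finset.mem_univ, if_true,
        Finset.sum_smul, mul_smul]
  have hlast : Fin.last n ≠ 0 := by
    intro h
    have := congrArg Fin.val h
    simp at this
    omega
  obtain ⟨ω, hω⟩ : ∃ ω, ω = w (ε (Sum.inl (Fin.last n))) := ⟨_, rfl⟩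
  have h1 : ∀ a, w (ε (Sum.inr a)) = ω := fun a => (hEq a _ hlast).trans hω.symm
  have h2 : ∀ i, i ≠ 0 → w (ε (Sum.inl i)) = ω := fun i hi =>
    (hEq ⟨0, hk⟩ i hi).symm.trans (h1 _)
  refine ⟨w (ε (Sum.inl 0)) - ω, fun b => ?_⟩
  have h3 : ∑ j, (w j * μ b j) • f j =
      ((w (ε (Sum.inl 0)) - ω) * μ b (ε (Sum.inl 0))) • f (ε (Sum.inl 0)) := by
    have h4 : ∑ j, (w j * μ b j) • f j = ∑ j, ((w j - ω) * μ b j) • f j := by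
      simp only [sub_mul, sub_smul, Finset.sum_sub_distrib, mul_smul ω]
      rw [← Finset.smul_sum, h.rel, smul_zero, sub_zero]
    rw [h4, Finset.sum_eq_single (ε (Sum.inl 0))]
    · intro j _ hj
      obtain ⟨y, rfl⟩ := ε.surjective j
      rcases y with i | a
      · rw [h2 i (by rintro rfl; exact hj rfl), sub_self, zero_mul, zero_smul]
      · rw [h1, sub_self, zero_mul, zero_smul]
    · simp
  rw [hτ] at h3
  exact smul_left_injective ℂ (h.genPos.ne_zero _) h3

end Cauchy

/-! ### Schwarzenberger matrices -/

section Schwarzenberger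

variable {n k : ℕ} {L : Fin (n + 1) → Fin (n + 1) → ℂ}

/-- The index `a + i` of a column of a Schwarzenberger matrix. -/
def addIndex (a : Fin k) (i : Fin (n + 1)) : Fin (n + k) := ⟨a.1 + i.1, by omega⟩

lemma schwarzenbergerMatrix_apply (a : Fin k) (j : Fin (n + k)) :
    schwarzenbergerMatrix k L a j = ∑ i, if j = addIndex a i then L i else 0 := by
  simp only [schwarzenbergerMatrix, Matrix.of_apply]
  split_ifs with h
  · rw [Finset.sum_eq_single ⟨j.1 - a.1, h.2⟩, if_pos]
    · simp only [addIndex, Fin.ext_iff]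
      omega
    · intro i _ hi
      rw [if_neg]
      simp only [addIndex, Fin.ext_iff, ne_eq] at hi ⊢
      omega
    · simp
  · refine (Finset.sum_eq_zero fun i _ => ?_).symm
    rw [if_neg]
    simp only [addIndex, Fin.ext_iff]
    have := i.2
    omega

lemma sum_smul_schwarzenbergerMatrix (c : Fin (n + k) → ℂ) (a : Fin k) :
    ∑ j, c j • schwarzenbergerMatrix k L a j = ∑ i, c (addIndex a i) • L i := by
  simp only [schwarzenbergerMatrix_apply, Finset.smul_sum, smul_ite, smul_zero]
  rw [Finset.sum_comm]
  simp

lemma nondegenerate_schwarzenbergerMatrix (hL : LinearIndependent ℂ L) :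
    Nondegenerate (schwarzenbergerMatrix k L) := by
  classical
  intro p
  rw [LinearIndependent.rank_matrix, Fintype.card_fin]
  rw [Fintype.linearIndependent_iff]
  intro u hu
  by_contra! hcon
  -- compare the products of the first nonzero coefficients
  obtain ⟨a, ha, hamin⟩ := WellFounded.has_min (wellFounded_lt (α := Fin k)) {a | u a ≠ 0} hcon
  have hy : ∃ i, L i ⬝ᵥ p.rep ≠ 0 := by
    by_contra! h0
    exact p.rep_nonzero (eq_zero_of_forall_dotProduct hL h0)
  obtain ⟨i, hi, himin⟩ :=
    WellFounded.has_min (wellFounded_lt (α := Fin (n + 1))) {i | L i ⬝ᵥ p.rep ≠ 0} hy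
  have h1 : ∑ b, u b * (schwarzenbergerMatrix k L b (addIndex a i) ⬝ᵥ p.rep) = 0 := by
    have := congrFun hu (addIndex a i)
    simpa [Finset.sum_apply, dotProduct] using this
  rw [Finset.sum_eq_single a, schwarzenbergerMatrix_apply, Finset.sum_eq_single i, if_pos rfl] at h1
  · exact mul_ne_zero ha hi h1
  · intro j _ hj
    rw [if_neg]
    simp only [addIndex, Fin.ext_iff, ne_eq] at hj ⊢
    omega
  · simp
  · intro b _ hb
    by_cases hub : u b = 0
    · rw [hub, zero_mul]
    have hab : a < b := lt_of_le_of_ne (not_lt.1 (hamin b hub)) (Ne.symm hb)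
    rw [schwarzenbergerMatrix_apply, sum_dotProduct, Finset.sum_eq_zero, mul_zero]
    intro j _
    split_ifs with hj
    · by_contra hLj
      have hij : i ≤ j := not_lt.1 (himin j hLj)
      simp only [addIndex, Fin.ext_iff] at hj
      rw [Fin.lt_def] at hab
      rw [Fin.le_def] at hij
      omega
    · exact zero_dotProduct _
  · simp

lemma curvePoint_zero_one : curvePoint L 0 1 = L (Fin.last n) := by
  rw [curvePoint, Finset.sum_eq_single (Fin.last n)]
  · simp
  · intro i _ hi
    have h1 : i.1 ≠ n := fun h => hi (Fin.ext h)
    rw [zero_pow (by omega), zero_mul, zero_smul]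
  · simp

/-- If a tensor `τ ⊗ v` of rank one is a combination of the columns of a Schwarzenberger matrix
then, by the proportionality of the rows of a Hankel matrix of rank one, `v` lies on the curve. -/
lemma onCurve_of_sum_smul_schwarzenbergerMatrix (hL : LinearIndependent ℂ L) (hk : 2 ≤ k)
    {c : Fin (n + k) → ℂ} (hc : c ≠ 0) {τ : Fin k → ℂ} {v : Fin (n + 1) → ℂ}
    (h : ∀ a, ∑ j, c j • schwarzenbergerMatrix k L a j = τ a • v) : OnCurve L v := by
  obtain ⟨z, hz⟩ := exists_coeff_of_linearIndependent hL v
  have hcz : ∀ a i, c (addIndex a i) = τ a * z i := by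
    intro a
    refine coeff_eq_of_sum_smul_eq hL ?_
    rw [← sum_smul_schwarzenbergerMatrix, h, hz, Finset.smul_sum]
    simp only [smul_smul]
  obtain ⟨l, hl⟩ := Function.ne_iff.1 hc
  obtain ⟨a, i, hai⟩ : ∃ (a : Fin k) (i : Fin (n + 1)), l = addIndex a i := by
    by_cases hln : l.1 < n
    · exact ⟨⟨0, by omega⟩, ⟨l.1, by omega⟩, by simp [addIndex]⟩
    · exact ⟨⟨l.1 - n, by omega⟩, Fin.last n, by simp [addIndex, Fin.ext_iff]; omega⟩
  rw [hai, hcz, Pi.zero_apply] at hl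
  have hz0 : z ≠ 0 := by
    rintro rfl
    simp at hl
  -- two consecutive entries of `τ`, not both zero
  obtain ⟨b, b', hbb', hb⟩ : ∃ b b' : Fin k, b'.1 = b.1 + 1 ∧ (τ b ≠ 0 ∨ τ b' ≠ 0) := by
    by_cases hak : a.1 + 1 < k
    · exact ⟨a, ⟨a.1 + 1, hak⟩, rfl, Or.inl (left_ne_zero_of_mul hl)⟩
    · exact ⟨⟨a.1 - 1, by omega⟩, a, by simp; omega, Or.inr (left_ne_zero_of_mul hl)⟩
  have hrec : ∀ i : Fin n, τ b * z i.succ = τ b' * z i.castSucc := by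
    intro i
    rw [← hcz, ← hcz]
    congr 1
    simp only [addIndex, Fin.ext_iff, Fin.val_succ, Fin.val_castSucc]
    omega
  by_cases hτ : τ b = 0
  · have h0 : ∀ i : Fin n, z i.castSucc = 0 := by
      intro i
      have := hrec i
      rw [hτ, zero_mul] at this
      exact (mul_eq_zero.1 this.symm).resolve_left (hb.resolve_left (not_not.2 hτ))
    have hv : v = z (Fin.last n) • L (Fin.last n) := by
      rw [hz, Fin.sum_univ_castSucc]
      simp [h0]
    refine ⟨0, 1, z (Fin.last n), Or.inr one_ne_zero, ?_, by rw [curvePoint_zero_one, hv]⟩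
    intro h1
    refine hz0 (funext fun i => ?_)
    induction i using Fin.lastCases with
    | last => exact h1
    | cast i => exact h0 i
  · have h1 : ∀ i : Fin (n + 1), z i = z 0 * (τ b' / τ b) ^ i.1 := by
      intro i
      induction i using Fin.induction with
      | zero => simp
      | succ i ih =>
        have := hrec i
        rw [ih, Fin.val_castSucc] at this
        refine mul_left_cancel₀ hτ (this.trans ?_)
        rw [Fin.val_succ, pow_succ]
        field_simp
    refine ⟨1, τ b' / τ b, z 0, Or.inl one_ne_zero, fun h0 => hz0 (funext fun i => ?_), ?_⟩
    · rw [h1, h0, zero_mul, Pi.zero_apply]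
    · rw [hz, curvePoint, Finset.smul_sum]
      refine Finset.sum_congr rfl fun i _ => ?_
      rw [smul_smul, h1 i, one_pow, one_mul]

/-- The monomial with index `l` among the `m` binary monomials of degree `m - 1`. -/
def binMonomial {m : ℕ} (s t : ℂ) (l : Fin m) : ℂ := t ^ l.1 * s ^ (Fin.rev l).1

lemma sum_binMonomial_smul (s t : ℂ) (a : Fin k) :
    ∑ j : Fin (n + k), binMonomial s t j • schwarzenbergerMatrix k L a j =
      binMonomial s t a • curvePoint L s t := by
  rw [sum_smul_schwarzenbergerMatrix, curvePoint, Finset.smul_sum]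
  refine Finset.sum_congr rfl fun i _ => ?_
  rw [smul_smul]
  congr 1
  simp only [binMonomial, addIndex, Fin.val_rev, pow_add]
  have h1 : n + k - (a.1 + i.1 + 1) = (k - (a.1 + 1)) + (n - i.1) := by omega
  rw [h1, pow_add]
  ring

lemma det_binMonomial_ne_zero {m : ℕ} {p q : Fin m → ℂ}
    (hpq : ∀ i j, i ≠ j → p i * q j - q i * p j ≠ 0) :
    (Matrix.of fun i l => binMonomial (p i) (q i) l : Matrix (Fin m) (Fin m) ℂ).det ≠ 0 := by
  have : (Matrix.of fun i l => binMonomial (p i) (q i) l : Matrix (Fin m) (Fin m) ℂ) =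
      Matrix.projVandermonde q p := rfl
  rw [this, Matrix.det_projVandermonde]
  refine Finset.prod_ne_zero_iff.2 fun i _ => Finset.prod_ne_zero_iff.2 fun j hj h0 => ?_
  refine hpq i j (Finset.mem_Ioi.1 hj).ne ?_
  rw [← h0]
  ring

lemma curvePoint_smul (L : Fin (n + 1) → Fin (n + 1) → ℂ) (r s t : ℂ) :
    curvePoint L (r * s) (r * t) = r ^ n • curvePoint L s t := by
  rw [curvePoint, curvePoint, Finset.smul_sum]
  refine Finset.sum_congr rfl fun i _ => ?_
  rw [smul_smul]
  congr 1
  have h1 : r ^ n = r ^ (n - i.1) * r ^ i.1 := by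
    rw [← pow_add]
    congr 1
    omega
  rw [h1, mul_pow, mul_pow]
  ring

variable {f : Fin (n + k + 1) → Fin (n + 1) → ℂ}

/-- If the vectors `f j` lie on the curve given by `L` then their Steiner matrix is equivalent to
the Schwarzenberger matrix: the columns of the base change are points of the rational normal curve
of degree `n + k - 1`. -/
lemma exists_matEquiv_schwarzenbergerMatrix (hf : GenPos f) (hn : 1 ≤ n)
    (hfL : ∀ j, OnCurve L (f j)) :
    ∃ μ, IsGale f μ ∧ MatEquiv (schwarzenbergerMatrix k L) (logMatrix f μ) := by
  choose s t c hst hc hfst using hfL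
  have hpq : ∀ i j, i ≠ j → s i * t j - t i * s j ≠ 0 := by
    intro i j hij h0
    have hLI := hf.linearIndependent (m := 2) (by omega) (b := ![i, j]) (by
      intro x y hxy
      fin_cases x <;> fin_cases y <;> simp_all [eq_comm])
    obtain ⟨r, hr1, hr2⟩ : ∃ r : ℂ, s j = r * s i ∧ t j = r * t i := by
      rcases hst i with h1 | h1
      · refine ⟨s j / s i, by field_simp, ?_⟩
        field_simp
        linear_combination h0
      · refine ⟨t j / t i, ?_, by field_simp⟩
        field_simp
        linear_combination -h0
    have h1 : f j = (c j * r ^ n * (c i)⁻¹) • f i := by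
      rw [hfst j, hr1, hr2, curvePoint_smul, hfst i, smul_smul, smul_smul]
      congr 1
      rw [inv_mul_cancel_right₀ (hc i)]
    have h2 := Fintype.linearIndependent_iff.1 hLI ![-(c j * r ^ n * (c i)⁻¹), 1] (by
      simp [Fin.sum_univ_two, h1]) 1
    simp at h2
  -- the relation between the points of the rational normal curve of degree `n + k - 1`
  obtain ⟨κ, hκ0, hκ⟩ : ∃ κ : Fin (n + k + 1) → ℂ, κ ≠ 0 ∧
      ∀ l : Fin (n + k), ∑ j, κ j * binMonomial (s j) (t j) l = 0 := by
    have h := LinearMap.ker_ne_bot_of_finrank_lt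
      (f := Matrix.vecMulLinear (Matrix.of fun (j : Fin (n + k + 1)) (l : Fin (n + k)) =>
        binMonomial (s j) (t j) l)) (by simp)
    obtain ⟨κ, hκ, hκ0⟩ := (Submodule.ne_bot_iff _).1 h
    exact ⟨κ, hκ0, fun l => congrFun (LinearMap.mem_ker.1 hκ) l⟩
  have hκne : ∀ j, κ j ≠ 0 := by
    intro j hj
    refine hκ0 (funext fun i => ?_)
    have hdet := det_binMonomial_ne_zero (p := s ∘ j.succAbove) (q := t ∘ j.succAbove)
      fun i i' hi => hpq _ _ fun h => hi (Fin.succAbove_right_injective h)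
    have h1 := Matrix.eq_zero_of_vecMul_eq_zero hdet (v := κ ∘ j.succAbove) (by
      ext l
      have := hκ l
      rw [Fin.sum_univ_succAbove _ j, hj, zero_mul, zero_add] at this
      exact this)
    rcases Fin.eq_self_or_eq_succAbove j i with rfl | ⟨i', rfl⟩
    · exact hj
    · exact congrFun h1 i'
  let μ : Fin k → Fin (n + k + 1) → ℂ := fun a j => κ j * (c j)⁻¹ * binMonomial (s j) (t j) a
  have hμ : ∀ a j, μ a j • f j = κ j • ∑ l : Fin (n + k),
      binMonomial (s j) (t j) l • schwarzenbergerMatrix k L a l := by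
    intro a j
    rw [sum_binMonomial_smul, hfst j, smul_smul, smul_smul]
    congr 1
    simp only [μ]
    rw [mul_right_comm, inv_mul_cancel_right₀ (hc j)]
  refine ⟨μ, ⟨hf, fun a => ?_, ?_⟩, 1, Matrix.of fun l j =>
    κ j.castSucc * binMonomial (s j.castSucc) (t j.castSucc) l, by simp, ?_, fun i => ?_⟩
  · simp only [hμ, Finset.smul_sum, smul_smul]
    rw [Finset.sum_comm]
    refine Finset.sum_eq_zero fun l _ => ?_
    rw [← Finset.sum_smul, hκ, zero_smul]
  · rw [Fintype.linearIndependent_iff]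
    intro u hu
    have hinj : Function.Injective fun a : Fin k => (Fin.natAdd n a).castSucc := by
      intro a b hab
      simpa [Fin.ext_iff] using hab
    have hdet := det_binMonomial_ne_zero (p := fun a : Fin k => s (Fin.natAdd n a).castSucc)
      (q := fun a : Fin k => t (Fin.natAdd n a).castSucc) fun i i' hi => hpq _ _ (hinj.ne hi)
    refine congrFun (Matrix.eq_zero_of_mulVec_eq_zero hdet (v := u) ?_)
    ext a
    have h1 := congrFun hu (Fin.natAdd n a).castSucc
    rw [Finset.sum_apply, Pi.zero_apply] at h1
    refine (mul_eq_zero.1 (Eq.trans ?_ h1)).resolve_left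
      (mul_ne_zero (hκne (Fin.natAdd n a).castSucc) (inv_ne_zero (hc (Fin.natAdd n a).castSucc)))
    simp only [Matrix.mulVec, dotProduct, Matrix.of_apply, Finset.mul_sum, Pi.smul_apply,
      smul_eq_mul, μ]
    exact Finset.sum_congr rfl fun b _ => by ring
  · rw [isUnit_iff_ne_zero]
    intro h0
    obtain ⟨x, hx0, hx⟩ := Matrix.exists_mulVec_eq_zero_iff.2 h0
    have hdet := det_binMonomial_ne_zero (p := fun j : Fin (n + k) => s j.castSucc)
      (q := fun j : Fin (n + k) => t j.castSucc)
      fun i i' hi => hpq _ _ ((Fin.castSucc_injective _).ne hi)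
    have h1 := Matrix.eq_zero_of_vecMul_eq_zero hdet (v := fun j => κ j.castSucc * x j) (by
      ext l
      refine Eq.trans ?_ (congrFun hx l)
      simp only [Matrix.vecMul, Matrix.mulVec, dotProduct, Matrix.of_apply]
      exact Finset.sum_congr rfl fun j _ => by ring)
    refine hx0 (funext fun j => ?_)
    exact (mul_eq_zero.1 (congrFun h1 j)).resolve_left (hκne _)
  · ext a j
    have h1 := congrFun (hμ a j.castSucc) i
    rw [Finset.smul_sum, Finset.sum_apply] at h1
    rw [Matrix.one_mul, Matrix.mul_apply]
    refine Eq.trans ?_ h1.symm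
    refine Finset.sum_congr rfl fun l _ => ?_
    simp only [slice, Matrix.of_apply, Pi.smul_apply, smul_eq_mul]
    ring

end Schwarzenberger

/-! ### The degeneracy scheme, locally -/

section Local

variable {n k : ℕ}

/-- The polynomials that do not vanish at `v`. -/
def nonvanishing (v : Fin (n + 1) → ℂ) : Submonoid (Coord n) :=
  (nonZeroDivisors ℂ).comap (MvPolynomial.eval v)

lemma mem_nonvanishing {v : Fin (n + 1) → ℂ} {g : Coord n} :
    g ∈ nonvanishing v ↔ MvPolynomial.eval v g ≠ 0 := by
  rw [nonvanishing, Submonoid.mem_comap, mem_nonZeroDivisors_iff_ne_zero]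

/-- The local ring of functions near `v` on the zero scheme of an ideal. -/
lemma exists_local_ring (D : Ideal (Coord n)) (v : Fin (n + 1) → ℂ) :
    ∃ (R : Type) (_ : CommRing R) (φ : Coord n →+* R),
      (∀ g, MvPolynomial.eval v g ≠ 0 → IsUnit (φ g)) ∧
      ∀ f, φ f = 0 ↔ ∃ g, MvPolynomial.eval v g ≠ 0 ∧ g * f ∈ D := by
  let R := Localization (nonvanishing v)
  let J : Ideal R := D.map (algebraMap (Coord n) R)
  refine ⟨R ⧸ J, inferInstance, (Ideal.Quotient.mk J).comp (algebraMap (Coord n) R),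
    fun g hg => ?_, fun f => ?_⟩
  · exact (IsLocalization.map_units R (⟨g, mem_nonvanishing.2 hg⟩ : nonvanishing v)).map
      (Ideal.Quotient.mk J)
  · rw [RingHom.comp_apply, Ideal.Quotient.eq_zero_iff_mem,
      IsLocalization.algebraMap_mem_map_algebraMap_iff (nonvanishing v)]
    simp only [mem_nonvanishing]

/-- If `I` is contained in `D` locally at every point other than the origin, then it is so after
multiplication with a power of the irrelevant ideal. -/
lemma exists_pow_mul_le {I D : Ideal (Coord n)}
    (h : ∀ f ∈ I, ∀ v : Fin (n + 1) → ℂ, v ≠ 0 →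
      ∃ g, MvPolynomial.eval v g ≠ 0 ∧ g * f ∈ D) :
    ∃ N : ℕ, Ideal.span (Set.range MvPolynomial.X) ^ N * I ≤ D := by
  classical
  obtain ⟨s, hs⟩ := (isNoetherianRing_iff_ideal_fg (Coord n)).1 inferInstance I
  -- the conductor, whose only possible zero is the origin
  let J : Ideal (Coord n) :=
    { carrier := {g | ∀ f ∈ s, g * f ∈ D}
      add_mem' := fun {a b} ha hb f hf => by rw [add_mul]; exact D.add_mem (ha f hf) (hb f hf)
      zero_mem' := fun f _ => by rw [zero_mul]; exact D.zero_mem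
      smul_mem' := fun c g hg f hf => by
        rw [smul_eq_mul, mul_assoc]; exact D.mul_mem_left _ (hg f hf) }
  have hJ : ∀ v ∈ MvPolynomial.zeroLocus ℂ J, v = 0 := by
    intro v hv
    by_contra hv0
    have h1 : ∀ f : Coord n, ∃ g : Coord n, MvPolynomial.eval v g ≠ 0 ∧ (f ∈ s → g * f ∈ D) := by
      intro f
      by_cases hf : f ∈ s
      · obtain ⟨g, hg, hgf⟩ := h f (hs ▸ Ideal.subset_span hf) v hv0
        exact ⟨g, hg, fun _ => hgf⟩
      · exact ⟨1, by simp, fun h => absurd h hf⟩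
    choose g hg hgf using h1
    have h2 : ∏ f ∈ s, g f ∈ J := by
      intro f hf
      rw [← Finset.mul_prod_erase s g hf, mul_right_comm]
      exact D.mul_mem_right _ (hgf f hf)
    have h3 := hv _ h2
    rw [MvPolynomial.aeval_eq_eval] at h3
    replace h3 := (map_prod (MvPolynomial.eval v) g s).symm.trans h3
    exact Finset.prod_ne_zero_iff.2 (fun f _ => hg f) h3
  have hrad : Ideal.span (Set.range MvPolynomial.X) ≤ J.radical := by
    rw [← MvPolynomial.vanishingIdeal_zeroLocus_eq_radical (K := ℂ), Ideal.span_le]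
    rintro _ ⟨i, rfl⟩ v hv
    rw [hJ v hv]
    simp
  obtain ⟨N, hN⟩ := Ideal.exists_pow_le_of_le_radical_of_fg hrad
    ((isNoetherianRing_iff_ideal_fg (Coord n)).1 inferInstance _)
  refine ⟨N, Ideal.mul_le.2 fun g hg f hf => ?_⟩
  have h1 := hN hg
  rw [← hs] at hf
  refine Submodule.span_induction (p := fun f _ => g * f ∈ D) (fun f hf => h1 f hf) ?_ ?_ ?_ hf
  · rw [mul_zero]; exact D.zero_mem
  · intro x y _ _ hx hy
    rw [mul_add]
    exact D.add_mem hx hy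
  · intro a x _ hx
    rw [smul_eq_mul, mul_left_comm]
    exact D.mul_mem_left _ hx

variable {R : Type} [CommRing R] {φ : Coord n →+* R} {v : Fin (n + 1) → ℂ}

/-- If a matrix with vanishing determinant maps some vector to a multiple `r` of a unit vector, and
the minor obtained by replacing the corresponding column by that unit vector is invertible, then
`r = 0`. -/
lemma eq_zero_of_mulVec_eq_single (hφ : ∀ g, MvPolynomial.eval v g ≠ 0 → IsUnit (φ g))
    {M : Matrix (Fin k) (Fin k) (Coord n)} (hM : φ M.det = 0) {u : Fin k → R} {a : Fin k}
    {r : R} (hr : ∀ c, ∑ b, φ (M c b) * u b = if c = a then r else 0)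
    (hminor : (Matrix.of fun c b => if b = a then (if c = a then 1 else 0) else
      MvPolynomial.eval v (M c b)).det ≠ 0) : r = 0 := by
  classical
  have h1 := Matrix.det_updateCol_sum (M.map φ) a u
  have h2 : (fun c => ∑ b, u b • (M.map φ) c b) = r • (Pi.single a 1 : Fin k → R) := by
    ext c
    simp only [smul_eq_mul, Matrix.map_apply, Pi.smul_apply, Pi.single_apply, mul_ite, mul_one,
      mul_zero]
    rw [← hr c]
    exact Finset.sum_congr rfl fun b _ => mul_comm _ _
  have h3 : (M.map φ).det = 0 := by
    rw [← RingHom.mapMatrix_apply, ← RingHom.map_det, hM]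
  rw [h2, Matrix.det_updateCol_smul, h3, smul_zero] at h1
  have h4 : (M.map φ).updateCol a (Pi.single a 1) =
      (M.updateCol a (Pi.single a 1)).map φ := by
    ext c b
    rw [Matrix.map_apply, Matrix.updateCol_apply, Matrix.updateCol_apply]
    split_ifs with hb
    · rw [Pi.single_apply, Pi.single_apply]
      split_ifs <;> simp
    · rfl
  rw [h4, ← RingHom.mapMatrix_apply, ← RingHom.map_det] at h1
  refine (IsUnit.mul_left_eq_zero (hφ _ ?_)).1 h1
  rw [eval_det]
  convert hminor using 3
  ext c b
  rw [Matrix.updateCol_apply]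
  split_ifs with hb hc
  · simp [hc]
  · simp [hc]
  · rfl

/-- A polynomial that vanishes on a parametrized variety is zero in a ring where the coordinate
functions are given by the parametrization. -/
lemma eq_zero_of_parametrization {m : ℕ} {Q : Fin (n + 1) → MvPolynomial (Fin (m + 1)) ℂ}
    {r : Fin (m + 1) → R}
    (hQ : ∀ l, φ (MvPolynomial.X l) = MvPolynomial.eval₂ (φ.comp MvPolynomial.C) r (Q l))
    {f : Coord n} (hf : ∀ ρ : Fin (m + 1) → ℂ, ρ 0 ≠ 0 →
      MvPolynomial.eval (fun l => MvPolynomial.eval ρ (Q l)) f = 0) : φ f = 0 := by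
  have h1 : MvPolynomial.aeval Q f = 0 := by
    have h2 : MvPolynomial.aeval Q f * MvPolynomial.X 0 = 0 := by
      refine MvPolynomial.funext fun ρ => ?_
      rw [map_mul, map_zero, MvPolynomial.eval_X]
      by_cases hρ : ρ 0 = 0
      · rw [hρ, mul_zero]
      · rw [← hf ρ hρ, MvPolynomial.aeval_def, MvPolynomial.hom_eval₂]
        have h3 : (MvPolynomial.eval ρ).comp (algebraMap ℂ (MvPolynomial (Fin (m + 1)) ℂ)) =
            RingHom.id ℂ := by
          ext; simp
        rw [h3, MvPolynomial.eval₂_id, hf ρ hρ]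
        rw [zero_mul]
    exact (mul_eq_zero.1 h2).resolve_right (MvPolynomial.X_ne_zero _)
  have h2 : φ = (MvPolynomial.eval₂Hom (φ.comp MvPolynomial.C) r).comp
      (MvPolynomial.aeval Q : Coord n →ₐ[ℂ] MvPolynomial (Fin (m + 1)) ℂ).toRingHom := by
    refine MvPolynomial.ringHom_ext (fun c => ?_) fun l => ?_
    · simp [MvPolynomial.algebraMap_eq]
    · simp [hQ]
  have h3 := congrArg (MvPolynomial.eval₂Hom (φ.comp MvPolynomial.C) r) h1
  rw [map_zero] at h3
  rw [h2]
  exact h3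

end Local

/-! ### Functionals that annihilate the columns -/

section DegeneracyIdeal

variable {n k : ℕ}

/-- A linear functional with prescribed values that annihilates the columns of `A` exists unless the
prescription contradicts a linear relation. -/
lemma exists_functional (A : LinMatrix n k) {E : Type*} [AddCommGroup E] [Module ℂ E]
    (T : E →ₗ[ℂ] (Fin k → Fin (n + 1) → ℂ)) (l : E →ₗ[ℂ] ℂ)
    (h : ∀ (w : Fin (n + k) → ℂ) (x : E), (∀ a, ∑ j, w j • A a j + T x a = 0) → l x = 0) :
    ∃ ψ : Fin k → Fin (n + 1) → ℂ, (∀ j, ∑ a, ∑ i, ψ a i * A a j i = 0) ∧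
      ∀ x, ∑ a, ∑ i, ψ a i * T x a i = l x := by
  let col : (Fin (n + k) → ℂ) →ₗ[ℂ] (Fin k → Fin (n + 1) → ℂ) :=
    Fintype.linearCombination ℂ fun j a => A a j
  have hcol : ∀ w a, col w a = ∑ j, w j • A a j := by
    intro w a
    simp only [col, Fintype.linearCombination_apply, Finset.sum_apply, Pi.smul_apply]
  have hmem : l.comp (LinearMap.snd ℂ (Fin (n + k) → ℂ) E) ∈
      LinearMap.range (LinearMap.dualMap (col.coprod T)) := by
    rw [LinearMap.range_dualMap_eq_dualAnnihilator_ker, Submodule.mem_dualAnnihilator]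
    rintro ⟨w, x⟩ hwx
    refine h w x fun a => ?_
    have := congrFun (LinearMap.mem_ker.1 hwx) a
    rw [LinearMap.coprod_apply, Pi.add_apply, hcol] at this
    exact this
  obtain ⟨Ψ, hΨ⟩ := hmem
  have hΨz : ∀ z : Fin k → Fin (n + 1) → ℂ,
      ∑ a, ∑ i, Ψ (Pi.single a (Pi.single i 1)) * z a i = Ψ z := by
    intro z
    have h1 : z = ∑ a, ∑ i, z a i • (Pi.single a (Pi.single i 1) : Fin k → Fin (n + 1) → ℂ) := by
      ext a i
      simp only [Finset.sum_apply, Pi.smul_apply, smul_eq_mul]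
      rw [Finset.sum_eq_single a, Finset.sum_eq_single i]
      · simp
      · intro j _ hj
        simp [hj.symm]
      · simp
      · intro b _ hb
        simp [hb.symm]
      · simp
    conv_rhs => rw [h1]
    simp only [map_sum, map_smul, smul_eq_mul]
    exact Finset.sum_congr rfl fun a _ => Finset.sum_congr rfl fun i _ => mul_comm _ _
  have hval : ∀ w x, Ψ (col w + T x) = l x := fun w x => LinearMap.congr_fun hΨ (w, x)
  refine ⟨fun a i => Ψ (Pi.single a (Pi.single i 1)), fun j => ?_, fun x => ?_⟩
  · have h1 := hval (Pi.single j 1) 0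
    rw [map_zero, map_zero, add_zero, ← hΨz] at h1
    simp only [hcol] at h1
    rw [← h1]
    refine Finset.sum_congr rfl fun a _ => Finset.sum_congr rfl fun i _ => ?_
    rw [Finset.sum_eq_single j]
    · simp
    · intro j' _ hj'
      rw [Pi.single_eq_of_ne hj', zero_smul]
    · simp
  · have h1 := hval 0 x
    rw [map_zero, zero_add] at h1
    rw [hΨz, h1]

lemma det_mem_degeneracyIdeal {A : LinMatrix n k} {ψ : Fin k → Fin k → Fin (n + 1) → ℂ}
    (hψ : ∀ c j, ∑ a, ∑ i, ψ c a i * A a j i = 0) :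
    (Matrix.of fun c a => linForm (ψ c a)).det ∈ degeneracyIdeal A :=
  Ideal.subset_span ⟨ψ, hψ, rfl⟩

/-- The degeneracy ideal has no zero at a vector that gives no tensor of rank one in the column
space. -/
lemma exists_mem_degeneracyIdeal {A : LinMatrix n k} {v : Fin (n + 1) → ℂ}
    (h : ∀ (w : Fin (n + k) → ℂ) (τ : Fin k → ℂ), (∀ a, ∑ j, w j • A a j = τ a • v) → τ = 0) :
    ∃ g ∈ degeneracyIdeal A, MvPolynomial.eval v g ≠ 0 := by
  have h1 : ∀ c : Fin k, ∃ ψ : Fin k → Fin (n + 1) → ℂ, (∀ j, ∑ a, ∑ i, ψ a i * A a j i = 0) ∧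
      ∀ τ : Fin k → ℂ, ∑ a, ∑ i, ψ a i * (τ a * v i) = τ c := by
    intro c
    let T : (Fin k → ℂ) →ₗ[ℂ] (Fin k → Fin (n + 1) → ℂ) :=
      { toFun := fun τ a => τ a • v
        map_add' := fun x y => by ext; simp [add_mul]
        map_smul' := fun r x => by ext; simp [mul_assoc] }
    exact exists_functional A T (LinearMap.proj c) fun w τ hwτ => by
      have h2 := h w (-τ) fun a => by
        rw [Pi.neg_apply, neg_smul]
        exact eq_neg_of_add_eq_zero_left (hwτ a)
      rw [neg_eq_zero.1 h2, map_zero]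
  choose ψ hψ hψv using h1
  refine ⟨_, det_mem_degeneracyIdeal hψ, ?_⟩
  rw [eval_det]
  have h2 : (Matrix.of fun c a => MvPolynomial.eval v
      ((Matrix.of fun c a => linForm (ψ c a)) c a)) = (1 : Matrix (Fin k) (Fin k) ℂ) := by
    ext c a
    have h3 := hψv c (Pi.single a 1)
    rw [Finset.sum_eq_single a] at h3
    · rw [Matrix.of_apply, Matrix.of_apply, eval_linForm, Matrix.one_apply]
      simp only [Pi.single_eq_same, one_mul] at h3
      rw [dotProduct, h3, Pi.single_apply]
    · intro b _ hb
      simp [hb]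
    · simp
  rw [h2, Matrix.det_one]
  exact one_ne_zero

/-- The degeneracy ideal vanishes at a vector that gives a tensor of rank one in the column
space. -/
lemma eval_eq_zero_of_mem_degeneracyIdeal {A : LinMatrix n k} {v : Fin (n + 1) → ℂ}
    {w : Fin (n + k) → ℂ} {τ : Fin k → ℂ} (hτ : τ ≠ 0) (h : ∀ a, ∑ j, w j • A a j = τ a • v)
    {g : Coord n} (hg : g ∈ degeneracyIdeal A) : MvPolynomial.eval v g = 0 := by
  have hle : degeneracyIdeal A ≤ RingHom.ker (MvPolynomial.eval v) := by
    refine Ideal.span_le.2 ?_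
    rintro _ ⟨ψ, hψ, rfl⟩
    rw [SetLike.mem_coe, RingHom.mem_ker, eval_det]
    refine Matrix.exists_mulVec_eq_zero_iff.1 ⟨τ, hτ, ?_⟩
    ext c
    simp only [Matrix.mulVec, dotProduct, Matrix.of_apply, eval_linForm, Pi.zero_apply]
    have h1 : ∀ a, (∑ i, ψ c a i * v i) * τ a = ∑ j, w j * ∑ i, ψ c a i * A a j i := by
      intro a
      have h2 : ∀ i, τ a * v i = ∑ j, w j * A a j i := by
        intro i
        have := congrFun (h a) i
        simpa [Finset.sum_apply] using this.symm
      rw [Finset.sum_mul]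
      have h3 : ∀ i, ψ c a i * v i * τ a = ∑ j, w j * (ψ c a i * A a j i) := by
        intro i
        rw [mul_assoc, mul_comm (v i), h2, Finset.mul_sum]
        exact Finset.sum_congr rfl fun j _ => by ring
      simp only [h3]
      rw [Finset.sum_comm]
      simp only [Finset.mul_sum]
    simp only [h1]
    rw [Finset.sum_comm]
    refine Finset.sum_eq_zero fun j _ => ?_
    rw [← Finset.mul_sum, hψ, mul_zero]
  exact hle hg

end DegeneracyIdeal

/-! ### The degeneracy scheme of a matrix of logarithmic forms -/

section Schemes

variable {n k : ℕ}

/-- A subscheme that contains `Z` and is locally contained in its reduced structure is equal to the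
latter. -/
lemma sameSubscheme_reducedIdeal {D : Ideal (Coord n)} {Z : Set (Hyperplane n)}
    (h1 : ∀ (v : Fin (n + 1) → ℂ) (hv : v ≠ 0), Projectivization.mk ℂ v hv ∈ Z →
      ∀ g ∈ D, MvPolynomial.eval v g = 0)
    (h2 : ∀ f ∈ reducedIdeal Z, ∀ v : Fin (n + 1) → ℂ, v ≠ 0 →
      ∃ g, MvPolynomial.eval v g ≠ 0 ∧ g * f ∈ D) : SameSubscheme D (reducedIdeal Z) := by
  obtain ⟨N, hN⟩ := exists_pow_mul_le h2
  refine ⟨N, Ideal.mul_le_right.trans fun g hg => ?_, hN⟩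
  rw [reducedIdeal, MvPolynomial.mem_vanishingIdeal_iff]
  rintro v ⟨hv, hvZ⟩
  exact h1 v hv hvZ g hg

lemma eval_eq_zero_of_mem_reducedIdeal {Z : Set (Hyperplane n)} {f : Coord n}
    (hf : f ∈ reducedIdeal Z) {v : Fin (n + 1) → ℂ} (hv : v ≠ 0)
    (hvZ : Projectivization.mk ℂ v hv ∈ Z) : MvPolynomial.eval v f = 0 := by
  rw [reducedIdeal, MvPolynomial.mem_vanishingIdeal_iff] at hf
  exact hf v ⟨hv, hvZ⟩

lemma eq_of_rep_eq_smul {H H' : Hyperplane n} {c : ℂ} (h : H.rep = c • H'.rep) : H = H' := by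
  rw [← H.mk_rep, ← H'.mk_rep, Projectivization.mk_eq_mk_iff']
  exact ⟨c, h.symm⟩

lemma exists_rep_mk_eq_smul {v : Fin (n + 1) → ℂ} (hv : v ≠ 0) :
    ∃ c : ℂ, c ≠ 0 ∧ (Projectivization.mk ℂ v hv).rep = c • v := by
  obtain ⟨a, ha⟩ := Projectivization.exists_smul_eq_mk_rep ℂ v hv
  exact ⟨a, a.ne_zero, ha.symm⟩

section Log

variable {f : Fin (n + k + 1) → Fin (n + 1) → ℂ} {μ : Fin k → Fin (n + k + 1) → ℂ}
  {ℋ : Finset (Hyperplane n)}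

lemma mk_mem_iff (hℋ : IsEquations f ℋ) {v : Fin (n + 1) → ℂ} (hv : v ≠ 0) :
    Projectivization.mk ℂ v hv ∈ ℋ ↔ ∃ j, ∃ c : ℂ, v = c • f j := by
  obtain ⟨c, hc, hcv⟩ := exists_rep_mk_eq_smul hv
  constructor
  · intro h
    obtain ⟨j, hj⟩ := hℋ.exists_index _ h
    refine ⟨j, c⁻¹, ?_⟩
    rw [← hj, hcv, smul_smul, inv_mul_cancel₀ hc, one_smul]
  · rintro ⟨j, d, hd⟩
    obtain ⟨H, hH, hHj⟩ := hℋ.exists_hyperplane j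
    have : Projectivization.mk ℂ v hv = H :=
      eq_of_rep_eq_smul (c := c * d) (by rw [hcv, hd, smul_smul, hHj])
    rwa [this]

/-- Adding a constant to the coefficients does not change the combination, since the `μ a` are
relations; so the last coefficient can be made zero. -/
lemma IsGale.sum_sub_smul_logMatrix (h : IsGale f μ) (w : Fin (n + k + 1) → ℂ) (a : Fin k) :
    ∑ j : Fin (n + k), (w j.castSucc - w (Fin.last _)) • logMatrix f μ a j =
      ∑ j, (w j * μ a j) • f j := by
  have h1 := h.rel a
  rw [Fin.sum_univ_castSucc] at h1 ⊢
  have h2 : ∀ j : Fin (n + k), (w j.castSucc - w (Fin.last _)) • logMatrix f μ a j =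
      (w j.castSucc * μ a j.castSucc) • f j.castSucc -
        w (Fin.last _) • (μ a j.castSucc • f j.castSucc) := by
    intro j
    rw [logMatrix, Matrix.of_apply, sub_smul, smul_smul]
  simp only [h2]
  rw [Finset.sum_sub_distrib, ← Finset.smul_sum, eq_neg_of_add_eq_zero_left h1, smul_neg,
    sub_neg_eq_add, smul_smul]

lemma sum_snoc_smul (w : Fin (n + k) → ℂ) (a : Fin k) :
    ∑ j, ((Fin.snoc w 0 : Fin (n + k + 1) → ℂ) j * μ a j) • f j =
      ∑ j, w j • logMatrix f μ a j := by
  rw [Fin.sum_univ_castSucc]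
  simp only [Fin.snoc_castSucc, Fin.snoc_last, zero_mul, zero_smul, add_zero]
  refine Finset.sum_congr rfl fun j _ => ?_
  rw [logMatrix, Matrix.of_apply, smul_smul]

/-- The points of `ℋ` give tensors of rank one in the column space. -/
lemma IsGale.exists_sum_smul_logMatrix (h : IsGale f μ) (hn : 1 ≤ n) (i₀ : Fin (n + k + 1)) :
    ∃ w : Fin (n + k) → ℂ, w ≠ 0 ∧ ∀ a, ∑ j, w j • logMatrix f μ a j = μ a i₀ • f i₀ := by
  classical
  refine ⟨_, ?_, fun a => (h.sum_sub_smul_logMatrix (Pi.single i₀ 1) a).trans ?_⟩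
  · intro h0
    obtain ⟨j, rfl⟩ | rfl := i₀.eq_castSucc_or_eq_last
    · have := congrFun h0 j
      simp only [Pi.single_eq_same, Pi.zero_apply,
        Pi.single_eq_of_ne (Fin.castSucc_ne_last j).symm] at this
      norm_num at this
    · have := congrFun h0 ⟨0, by omega⟩
      simp only [Pi.single_eq_same, Pi.zero_apply, Pi.single_eq_of_ne (Fin.castSucc_ne_last _)]
        at this
      norm_num at this
  · rw [Finset.sum_eq_single i₀]
    · simp
    · intro j _ hj
      simp [hj]
    · simp

lemma IsGale.exists_ne_zero (h : IsGale f μ) (i₀ : Fin (n + k + 1)) (hk : 1 ≤ k) :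
    ∃ a, μ a i₀ ≠ 0 := by
  by_contra! h0
  have hT' : ∃ T : Finset (Fin (n + k + 1)), T.card = k ∧ i₀ ∈ T := by
    obtain ⟨T, hT, hc⟩ := Finset.exists_superset_card_eq (s := {i₀}) (n := k)
      (by simpa using hk) (by simp; omega)
    exact ⟨T, hc, hT (Finset.mem_singleton_self _)⟩
  obtain ⟨T, hT, hi⟩ := hT'
  obtain ⟨u, hu⟩ := h.exists_comb hT fun _ => 1
  have := hu i₀ hi
  simp [h0] at this

/-- Unless there is a curve through all the `f j`, the only tensors of rank one in the column space
of the matrix of `ℋ` are those that come from the points of `ℋ`. -/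
lemma IsGale.exists_eq_smul_of_sum_smul_logMatrix (h : IsGale f μ) (hn : 1 ≤ n) (hk : 2 ≤ k)
    (hno : ¬ ∃ L, LinearIndependent ℂ L ∧ ∀ j, OnCurve L (f j)) {w : Fin (n + k) → ℂ} (hw : w ≠ 0)
    {v : Fin (n + 1) → ℂ} (hv : v ≠ 0) {τ : Fin k → ℂ}
    (hτ : ∀ a, ∑ j, w j • logMatrix f μ a j = τ a • v) : ∃ j, ∃ c : ℂ, v = c • f j := by
  obtain ⟨j, hj⟩ := Function.ne_iff.1 hw
  refine (h.exists_eq_smul_or_exists_onCurve hn hk (w := Fin.snoc w 0) (τ := τ)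
    ⟨j.castSucc, Fin.last _, ?_⟩ hv fun b => ?_).resolve_right hno
  · simpa [Fin.snoc_castSucc, Fin.snoc_last] using hj
  · rw [sum_snoc_smul, hτ]

/-- There are functionals on the tensors that annihilate the columns and have prescribed values on
the tangent space `τ ⊗ f i₀ + μ i₀ ⊗ y` to the variety of tensors of rank one: this space meets the
space of columns only in the multiples of `μ i₀ ⊗ f i₀`. -/
lemma IsGale.exists_functional (h : IsGale f μ) (hn : 1 ≤ n) (hk : 2 ≤ k)
    (hno : ¬ ∃ L, LinearIndependent ℂ L ∧ ∀ j, OnCurve L (f j)) {i₀ : Fin (n + k + 1)}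
    {α : Fin k → ℂ} (hα : ∑ a, α a * μ a i₀ = 0) {l : Fin (n + 1) → ℂ} (hl : l ⬝ᵥ f i₀ = 0) :
    ∃ ψ : Fin k → Fin (n + 1) → ℂ, (∀ j, ∑ a, ∑ i, ψ a i * logMatrix f μ a j i = 0) ∧
      (∀ a, ψ a ⬝ᵥ f i₀ = α a) ∧ ∑ a, μ a i₀ • ψ a = l := by
  classical
  -- `T` parametrizes the tangent space, and `lam` is the functional prescribed on it
  let T : ((Fin k → ℂ) × (Fin (n + 1) → ℂ)) →ₗ[ℂ] (Fin k → Fin (n + 1) → ℂ) :=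
    { toFun := fun x a => x.1 a • f i₀ + μ a i₀ • x.2
      map_add' := fun x y => by
        ext a i
        simp only [Prod.fst_add, Prod.snd_add, Pi.add_apply, Pi.smul_apply, smul_eq_mul]
        ring
      map_smul' := fun r x => by
        ext a i
        simp only [Prod.smul_fst, Prod.smul_snd, Pi.add_apply, Pi.smul_apply, smul_eq_mul,
          RingHom.id_apply]
        ring }
  let lam : ((Fin k → ℂ) × (Fin (n + 1) → ℂ)) →ₗ[ℂ] ℂ :=
    { toFun := fun x => α ⬝ᵥ x.1 + l ⬝ᵥ x.2
      map_add' := fun x y => by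
        simp only [Prod.fst_add, Prod.snd_add, dotProduct_add]
        ring
      map_smul' := fun r x => by
        simp only [Prod.smul_fst, Prod.smul_snd, dotProduct_smul, smul_eq_mul, RingHom.id_apply]
        ring }
  obtain ⟨ψ, hψ, hψT⟩ := PnBundle.exists_functional (logMatrix f μ) T lam (by
    rintro w ⟨τ, y⟩ hwx
    have h1 : ∀ b, ∑ j, ((Fin.snoc w 0 : Fin (n + k + 1) → ℂ) j * μ b j) • f j =
        μ b i₀ • (-y) + (-τ b) • f i₀ := by
      intro b
      rw [sum_snoc_smul, smul_neg, neg_smul, ← neg_add, add_comm (μ b i₀ • y)]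
      exact eq_neg_of_add_eq_zero_left (hwx b)
    obtain ⟨c, hc⟩ := (h.exists_eq_smul_or_exists_onCurve_of_tangent hn hk h1).resolve_right hno
    obtain ⟨d, hd⟩ := h.exists_eq_mul hn (by omega) (τ := fun b => c * μ b i₀ - τ b) fun b => by
      rw [h1, hc, smul_smul, ← add_smul]
      congr 1
      ring
    have hy : y = -(c • f i₀) := by rw [← hc, neg_neg]
    have hτ : ∀ b, α b * τ b = (c - d) * (α b * μ b i₀) := fun b => by
      linear_combination -α b * hd b
    change α ⬝ᵥ τ + l ⬝ᵥ y = 0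
    rw [hy, dotProduct_neg, dotProduct_smul, hl, smul_zero, neg_zero, add_zero, dotProduct]
    simp only [hτ]
    rw [← Finset.mul_sum, hα, mul_zero])
  have hT : ∀ (τ : Fin k → ℂ) (y : Fin (n + 1) → ℂ),
      ∑ a, ∑ i, ψ a i * (τ a * f i₀ i + μ a i₀ * y i) = α ⬝ᵥ τ + l ⬝ᵥ y := fun τ y => hψT (τ, y)
  refine ⟨ψ, hψ, fun a => ?_, ?_⟩
  · have h1 := hT (Pi.single a 1) 0
    rw [dotProduct_single, mul_one, dotProduct_zero, add_zero, Finset.sum_eq_single a] at h1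
    · rw [← h1]
      simp [dotProduct]
    · intro b _ hb
      simp [hb]
    · simp
  · ext i
    have h1 := hT 0 (Pi.single i 1)
    simp only [Pi.zero_apply, zero_mul, zero_add, dotProduct_zero, dotProduct_single, mul_one]
      at h1
    rw [← h1, Finset.sum_apply]
    refine Finset.sum_congr rfl fun a _ => ?_
    rw [Finset.sum_eq_single i]
    · rw [Pi.smul_apply, smul_eq_mul, Pi.single_eq_same, mul_one, mul_comm]
    · intro j _ hj
      simp [hj]
    · simp

variable {R : Type} [CommRing R] {φ : Coord n →+* R}

/-- Near the point `f i₀`, all linear forms that vanish at this point vanish on the degeneracy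
scheme. -/
lemma IsGale.map_linForm_eq_zero (h : IsGale f μ) (hn : 1 ≤ n) (hk : 2 ≤ k)
    (hno : ¬ ∃ L, LinearIndependent ℂ L ∧ ∀ j, OnCurve L (f j)) {i₀ : Fin (n + k + 1)}
    {c : ℂ} (hc : c ≠ 0) (hφ : ∀ g, MvPolynomial.eval (c • f i₀) g ≠ 0 → IsUnit (φ g))
    (hD : ∀ g ∈ degeneracyIdeal (logMatrix f μ), φ g = 0) {l : Fin (n + 1) → ℂ}
    (hl : l ⬝ᵥ f i₀ = 0) : φ (linForm l) = 0 := by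
  classical
  obtain ⟨a₀, ha₀⟩ := h.exists_ne_zero i₀ (by omega)
  -- functionals `ψ b` whose matrix of linear forms maps `μ i₀` to the multiple `l` of a unit vector
  have h1 : ∀ b, ∃ ψ : Fin k → Fin (n + 1) → ℂ,
      (∀ j, ∑ a, ∑ i, ψ a i * logMatrix f μ a j i = 0) ∧
      (∀ a, a ≠ a₀ → ψ a ⬝ᵥ f i₀ = if b = a₀ then 0 else if b = a then μ a₀ i₀ else 0) ∧
      ∑ a, μ a i₀ • ψ a = if b = a₀ then l else 0 := by
    intro b
    by_cases hb : b = a₀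
    · obtain ⟨ψ, hψ, hψ1, hψ2⟩ := h.exists_functional hn hk hno (i₀ := i₀) (α := 0) (by simp) hl
      exact ⟨ψ, hψ, fun a _ => by rw [hψ1, if_pos hb, Pi.zero_apply], by rw [hψ2, if_pos hb]⟩
    · obtain ⟨ψ, hψ, hψ1, hψ2⟩ := h.exists_functional hn hk hno (i₀ := i₀)
        (α := μ a₀ i₀ • Pi.single b 1 - μ b i₀ • Pi.single a₀ 1) (by
          simp only [Pi.sub_apply, Pi.smul_apply, smul_eq_mul, sub_mul, Finset.sum_sub_distrib,
            Pi.single_apply, mul_ite, mul_one, mul_zero, ite_mul, zero_mul, Finset.sum_ite_eq',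
            Finset.mem_univ, if_true]
          ring) (l := 0) (zero_dotProduct _)
      refine ⟨ψ, hψ, fun a ha => ?_, by rw [hψ2, if_neg hb]⟩
      rw [hψ1, if_neg hb]
      by_cases hba : b = a
      · subst hba
        simp [ha]
      · simp [hba, ha, Ne.symm hba]
  choose ψ hψ hψ1 hψ2 using h1
  refine eq_zero_of_mulVec_eq_single (a := a₀) hφ (hD _ (det_mem_degeneracyIdeal hψ))
    (u := fun b => φ (MvPolynomial.C (μ b i₀))) (fun b => ?_) ?_
  · have h2 : ∀ a, φ ((Matrix.of fun b a => linForm (ψ b a)) b a) * φ (MvPolynomial.C (μ a i₀)) =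
        φ (linForm (μ a i₀ • ψ b a)) := by
      intro a
      rw [Matrix.of_apply, linForm_smul, map_mul, mul_comm]
    simp only [h2]
    rw [← map_sum, ← linForm_sum, hψ2]
    split_ifs <;> simp
  · have h2 : (Matrix.of fun b a => if a = a₀ then (if b = a₀ then (1 : ℂ) else 0) else
        MvPolynomial.eval (c • f i₀) ((Matrix.of fun b a => linForm (ψ b a)) b a)) =
        Matrix.diagonal fun b => if b = a₀ then 1 else c * μ a₀ i₀ := by
      ext b a
      rw [Matrix.of_apply, Matrix.diagonal_apply]
      by_cases ha : a = a₀
      · subst ha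
        by_cases hb : b = a <;> simp [hb]
      · rw [if_neg ha, Matrix.of_apply, eval_linForm, dotProduct_smul, hψ1 b a ha]
        by_cases hb : b = a₀
        · subst hb
          simp [Ne.symm ha]
        · by_cases hba : b = a <;> simp [hba, hb, ha]
    rw [h2, Matrix.det_diagonal]
    refine Finset.prod_ne_zero_iff.2 fun b _ => ?_
    split_ifs
    · exact one_ne_zero
    · exact mul_ne_zero hc ha₀

/-- If the `f j` do not lie on a curve, the degeneracy scheme is the reduced scheme `ℋ`. -/
lemma IsGale.sameSubscheme (h : IsGale f μ) (hn : 1 ≤ n) (hk : 2 ≤ k) (hℋ : IsEquations f ℋ)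
    (hno : ¬ ∃ L, LinearIndependent ℂ L ∧ ∀ j, OnCurve L (f j)) :
    SameSubscheme (degeneracyIdeal (logMatrix f μ)) (reducedIdeal (ℋ : Set (Hyperplane n))) := by
  refine sameSubscheme_reducedIdeal (fun v hv hvZ g hg => ?_) fun g hg v hv => ?_
  · obtain ⟨j, c, hc⟩ := (mk_mem_iff hℋ hv).1 hvZ
    have hc0 : c ≠ 0 := by
      rintro rfl
      exact hv (by rw [hc, zero_smul])
    obtain ⟨w, -, hw⟩ := h.exists_sum_smul_logMatrix hn j
    obtain ⟨a, ha⟩ := h.exists_ne_zero j (by omega)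
    refine eval_eq_zero_of_mem_degeneracyIdeal (w := w) (τ := fun a => μ a j * c⁻¹)
      (fun h0 => mul_ne_zero ha (inv_ne_zero hc0) (congrFun h0 a)) (fun a => ?_) hg
    rw [hw, hc, smul_smul, mul_assoc, inv_mul_cancel₀ hc0, mul_one]
  by_cases hvZ : ∃ j, ∃ c : ℂ, v = c • f j
  · obtain ⟨j, c, rfl⟩ := hvZ
    have hc0 : c ≠ 0 := by
      rintro rfl
      exact hv (zero_smul _ _)
    obtain ⟨R, _, φ, hφ, hφD⟩ := exists_local_ring (degeneracyIdeal (logMatrix f μ)) (c • f j)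
    refine (hφD g).1 ?_
    have hfj := h.genPos.ne_zero j
    obtain ⟨x, hx⟩ := exists_vec_dotProduct_ne_zero hfj
    -- the parametrized variety is the line of the multiples of `f j`
    refine eq_zero_of_parametrization (m := 0)
      (Q := fun l => MvPolynomial.C (f j l * (x ⬝ᵥ f j)⁻¹) * MvPolynomial.X 0)
      (r := fun _ => φ (linForm x)) (fun l => ?_) fun ρ hρ => ?_
    · have h1 := h.map_linForm_eq_zero hn hk hno hc0 hφ
        (fun g hg => (hφD g).2 ⟨1, by simp, by simpa using hg⟩)
        (l := Pi.single l 1 - (f j l * (x ⬝ᵥ f j)⁻¹) • x) (by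
          rw [sub_dotProduct, smul_dotProduct, single_dotProduct, one_mul, smul_eq_mul,
            mul_assoc, inv_mul_cancel₀ hx, mul_one, sub_self])
      rw [sub_eq_add_neg, linForm_add, linForm_single, ← neg_smul, linForm_smul, map_add, map_mul,
        map_neg, map_neg, neg_mul, add_neg_eq_zero] at h1
      rw [h1]
      simp
    · have h1 : (fun l => MvPolynomial.eval ρ
          (MvPolynomial.C (f j l * (x ⬝ᵥ f j)⁻¹) * MvPolynomial.X 0)) =
          ((x ⬝ᵥ f j)⁻¹ * ρ 0) • f j := by
        ext l
        simp only [map_mul, MvPolynomial.eval_C, MvPolynomial.eval_X, Pi.smul_apply, smul_eq_mul]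
        ring
      have hne : ((x ⬝ᵥ f j)⁻¹ * ρ 0) • f j ≠ 0 :=
        smul_ne_zero (mul_ne_zero (inv_ne_zero hx) hρ) hfj
      rw [h1]
      exact eval_eq_zero_of_mem_reducedIdeal hg hne ((mk_mem_iff hℋ hne).2 ⟨j, _, rfl⟩)
  · obtain ⟨d, hd, hdv⟩ := exists_mem_degeneracyIdeal (A := logMatrix f μ) (v := v)
      fun w τ hw => by
        have hw0 : w = 0 := by
          by_contra hw0
          exact hvZ (h.exists_eq_smul_of_sum_smul_logMatrix hn hk hno hw0 hv hw)
        ext a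
        have h1 := hw a
        simp only [hw0, Pi.zero_apply, zero_smul, Finset.sum_const_zero] at h1
        exact (smul_eq_zero.1 h1.symm).resolve_right hv
    exact ⟨d, hdv, Ideal.mul_mem_right _ _ hd⟩

lemma IsGale.unstableHyperplanes_eq (h : IsGale f μ) (hn : 1 ≤ n) (hk : 2 ≤ k)
    (hℋ : IsEquations f ℋ) (hno : ¬ ∃ L, LinearIndependent ℂ L ∧ ∀ j, OnCurve L (f j)) :
    unstableHyperplanes (logForms ℋ) = (ℋ : Set (Hyperplane n)) := by
  ext H
  rw [mem_unstableHyperplanes_iff hn (nondegenerate_logMatrix h)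
    (iso_dual_logForms_kernelSheaf h hℋ)]
  constructor
  · rintro ⟨w, hw, τ, hτ⟩
    rw [← H.mk_rep]
    exact (mk_mem_iff hℋ _).2
      (h.exists_eq_smul_of_sum_smul_logMatrix hn hk hno hw H.rep_nonzero hτ)
  · intro hH
    obtain ⟨j, hj⟩ := hℋ.exists_index H hH
    obtain ⟨w, hw, hwj⟩ := h.exists_sum_smul_logMatrix hn j
    exact ⟨w, hw, fun a => μ a j, by rw [hj]; exact hwj⟩

lemma IsGale.unstableSchemeEq (h : IsGale f μ) (hn : 1 ≤ n) (hk : 2 ≤ k) (hℋ : IsEquations f ℋ)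
    (hno : ¬ ∃ L, LinearIndependent ℂ L ∧ ∀ j, OnCurve L (f j)) :
    UnstableSchemeEq k (logForms ℋ) (ℋ : Set (Hyperplane n)) := by
  refine ⟨h.unstableHyperplanes_eq hn hk hℋ hno, fun A hA => ?_⟩
  rw [degeneracyIdeal_eq_of_matEquiv (matEquiv_of_isSteinerMatrix h hℋ hn (by omega) hA)]
  exact h.sameSubscheme hn hk hℋ hno

end Log
end Schemes

/-! ### The degeneracy scheme of a Schwarzenberger matrix -/

section CurveScheme

variable {n k : ℕ} {L : Fin (n + 1) → Fin (n + 1) → ℂ}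

lemma OnCurve.smul {v : Fin (n + 1) → ℂ} (h : OnCurve L v) {c : ℂ} (hc : c ≠ 0) :
    OnCurve L (c • v) := by
  obtain ⟨s, t, d, hst, hd, rfl⟩ := h
  exact ⟨s, t, c * d, hst, mul_ne_zero hc hd, smul_smul _ _ _⟩

lemma Parametrizes.mk_mem_iff {C : RationalNormalCurve n} (h : Parametrizes L C)
    {v : Fin (n + 1) → ℂ} (hv : v ≠ 0) :
    Projectivization.mk ℂ v hv ∈ C.osculating ↔ OnCurve L v := by
  obtain ⟨c, hc, hcv⟩ := exists_rep_mk_eq_smul hv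
  rw [h.mem_iff, hcv]
  refine ⟨fun h1 => ?_, fun h1 => h1.smul hc⟩
  have h2 := h1.smul (inv_ne_zero hc)
  rwa [smul_smul, inv_mul_cancel₀ hc, one_smul] at h2

lemma binMonomial_ne_zero {m : ℕ} (hm : 1 ≤ m) {s t : ℂ} (hst : s ≠ 0 ∨ t ≠ 0) :
    (binMonomial s t : Fin m → ℂ) ≠ 0 := by
  intro h0
  rcases hst with hs | ht
  · have := congrFun h0 ⟨0, by omega⟩
    simp [binMonomial, hs] at this
  · have := congrFun h0 ⟨m - 1, by omega⟩
    simp only [binMonomial, Pi.zero_apply, Fin.val_rev] at this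
    rw [show m - (m - 1 + 1) = 0 by omega, pow_zero, mul_one] at this
    exact ht (eq_zero_of_pow_eq_zero this)

/-- The points of the curve give tensors of rank one in the column space. -/
lemma OnCurve.exists_sum_smul {v : Fin (n + 1) → ℂ} (h : OnCurve L v) (hk : 1 ≤ k) :
    ∃ w : Fin (n + k) → ℂ, w ≠ 0 ∧ ∃ τ : Fin k → ℂ, τ ≠ 0 ∧
      ∀ a, ∑ j, w j • schwarzenbergerMatrix k L a j = τ a • v := by
  obtain ⟨s, t, c, hst, hc, rfl⟩ := h
  refine ⟨binMonomial s t, binMonomial_ne_zero (by omega) hst, c⁻¹ • binMonomial s t,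
    smul_ne_zero (inv_ne_zero hc) (binMonomial_ne_zero hk hst), fun a => ?_⟩
  rw [sum_binMonomial_smul, smul_smul, Pi.smul_apply, smul_eq_mul, mul_right_comm,
    inv_mul_cancel₀ hc, one_mul]

variable {R : Type} [CommRing R] {φ : Coord n →+* R}

/-- Near the point `L 0` of the curve, the coordinate functions on the degeneracy scheme are those
of the point with parameter `z` of the curve: in coordinates dual to the `L i`, the functionals
that annihilate the columns contain the rows `(…, Y (i + 1), - Y i, …)` of a Hankel matrix. -/
lemma exists_map_linForm_eq_mul_pow (hk : 2 ≤ k) {Y : Fin (n + 1) → Fin (n + 1) → ℂ}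
    (hLY : ∀ i j, Y i ⬝ᵥ L j = if i = j then 1 else 0) {c : ℂ} (hc : c ≠ 0)
    (hφ : ∀ g, MvPolynomial.eval (c • L 0) g ≠ 0 → IsUnit (φ g))
    (hD : ∀ g ∈ degeneracyIdeal (schwarzenbergerMatrix k L), φ g = 0) :
    ∃ z : R, ∀ i, φ (linForm (Y i)) = φ (linForm (Y 0)) * z ^ i.1 := by
  classical
  obtain ⟨m, rfl⟩ : ∃ m, k = m + 1 + 1 := ⟨k - 2, by omega⟩
  have hY : ∀ i, MvPolynomial.eval (c • L 0) (linForm (Y i)) = if i = 0 then c else 0 := by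
    intro i
    rw [eval_linForm, dotProduct_smul, hLY]
    simp
  obtain ⟨y, hy⟩ := (hφ (linForm (Y 0)) (by rw [hY]; simpa using hc)).exists_right_inv
  by_cases hn : n = 0
  · subst hn
    refine ⟨0, fun i => ?_⟩
    obtain rfl : i = 0 := Fin.ext (by simp)
    simp
  obtain ⟨n, rfl⟩ := Nat.exists_eq_succ_of_ne_zero hn
  set z := φ (linForm (Y 1)) * y with hz
  have hz1 : φ (linForm (Y 1)) = z * φ (linForm (Y 0)) := by
    rw [hz, mul_assoc, mul_comm y, hy, mul_one]
  -- the rows of Hankel type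
  let row : Fin (m + 1) → Fin (n + 1) → Fin (m + 1 + 1) → Fin (n + 1 + 1) → ℂ :=
    fun a i b => if b = a.castSucc then Y i.succ else if b = a.succ then -Y i.castSucc else 0
  have hrow_sum : ∀ (a : Fin (m + 1)) (i : Fin (n + 1)) {S : Type} [AddCommGroup S]
      (F : Fin (m + 1 + 1) → (Fin (n + 1 + 1) → ℂ) → S) (_ : ∀ b, F b 0 = 0),
      ∑ b, F b (row a i b) = F a.castSucc (Y i.succ) + F a.succ (-Y i.castSucc) := by
    intro a i S _ F hF
    rw [Finset.sum_eq_add a.castSucc a.succ (Fin.castSucc_lt_succ).ne]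
    · simp [row, (Fin.castSucc_lt_succ (i := a)).ne']
    · rintro b - ⟨hb1, hb2⟩
      simp only [row, if_neg hb1, if_neg hb2, hF]
    · simp
    · simp
  have hrow : ∀ a i j,
      ∑ b, ∑ l, row a i b l * schwarzenbergerMatrix (m + 1 + 1) L b j l = 0 := by
    intro a i j
    have h1 : ∀ b, ∑ l, row a i b l * schwarzenbergerMatrix (m + 1 + 1) L b j l =
        row a i b ⬝ᵥ schwarzenbergerMatrix (m + 1 + 1) L b j := fun b => rfl
    simp only [h1]
    rw [hrow_sum a i (fun b x => x ⬝ᵥ schwarzenbergerMatrix (m + 1 + 1) L b j)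
      (fun b => zero_dotProduct _)]
    have h2 : ∀ (b : Fin (m + 1 + 1)) i', Y i' ⬝ᵥ schwarzenbergerMatrix (m + 1 + 1) L b j =
        if j = addIndex b i' then 1 else 0 := by
      intro b i'
      rw [schwarzenbergerMatrix_apply, dotProduct_sum, Finset.sum_eq_single i']
      · split_ifs <;> simp [hLY]
      · intro l _ hl
        split_ifs
        · rw [hLY, if_neg hl.symm]
        · exact dotProduct_zero _
      · simp
    have h3 : addIndex (n := n + 1) a.castSucc i.succ = addIndex a.succ i.castSucc := by
      simp only [addIndex, Fin.ext_iff, Fin.val_castSucc, Fin.val_succ]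
      omega
    rw [neg_dotProduct, h2, h2, h3, add_neg_cancel]
  have hstep : ∀ i : Fin (n + 1), φ (linForm (Y i.succ)) = φ (linForm (Y i.castSucc)) * z := by
    intro i
    by_cases hi : i = 0
    · subst hi
      rw [Fin.castSucc_zero, Fin.succ_zero_eq_one, hz1, mul_comm]
    let ψ : Fin (m + 1 + 1) → Fin (m + 1 + 1) → Fin (n + 1 + 1) → ℂ :=
      Fin.cons (row 0 i) fun a => row a 0
    have hψ : ∀ b j, ∑ a, ∑ l, ψ b a l * schwarzenbergerMatrix (m + 1 + 1) L a j l = 0 := by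
      intro b j
      refine Fin.cases ?_ (fun a => ?_) b
      · exact hrow 0 i j
      · exact hrow a 0 j
    have hsum : ∀ a i', ∑ b, φ (linForm (row a i' b)) * z ^ b.1 =
        (φ (linForm (Y i'.succ)) - φ (linForm (Y i'.castSucc)) * z) * z ^ a.1 := by
      intro a i'
      rw [hrow_sum a i' (fun b x => φ (linForm x) * z ^ b.1) (fun b => by simp)]
      rw [← neg_one_smul ℂ (Y i'.castSucc), linForm_smul]
      simp only [map_neg, map_one, map_mul, Fin.val_castSucc, Fin.val_succ, pow_succ]
      ring
    refine sub_eq_zero.1 (eq_zero_of_mulVec_eq_single (a := 0) hφ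
      (hD _ (det_mem_degeneracyIdeal hψ)) (u := fun b => z ^ b.1) (fun b => ?_) ?_)
    · refine Fin.cases ?_ (fun a => ?_) b
      · simpa [ψ] using hsum 0 i
      · have := hsum a 0
        rw [Fin.castSucc_zero, Fin.succ_zero_eq_one, hz1, mul_comm z, sub_self, zero_mul] at this
        simpa [ψ] using this
    · have h2 : (Matrix.of fun b a => if a = 0 then (if b = 0 then (1 : ℂ) else 0) else
          MvPolynomial.eval (c • L 0) ((Matrix.of fun b a => linForm (ψ b a)) b a)) =
          Matrix.diagonal (Fin.cons 1 fun _ : Fin (m + 1) => -c) := by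
        have hr : ∀ a i' b, MvPolynomial.eval (c • L 0) (linForm (row a i' b)) =
            if b = a.succ ∧ i' = 0 then -c else 0 := by
          intro a i' b
          by_cases hb1 : b = a.castSucc
          · have hb2 : b ≠ a.succ := by
              rw [hb1]; exact (Fin.castSucc_lt_succ).ne
            simp only [row, if_pos hb1, hY, if_neg (Fin.succ_ne_zero i'), hb2, false_and,
              if_false]
          · by_cases hb2 : b = a.succ
            · have h3 : row a i' b = (-1 : ℂ) • Y i'.castSucc := by
                simp only [row, if_neg hb1, if_pos hb2, neg_smul, one_smul]
              rw [h3, linForm_smul, map_mul, hY, MvPolynomial.eval_C]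
              simp only [hb2, true_and, Fin.castSucc_eq_zero_iff]
              split_ifs <;> simp
            · simp [row, hb1, hb2]
        ext b a
        rw [Matrix.of_apply, Matrix.diagonal_apply]
        refine Fin.cases ?_ (fun a' => ?_) a
        · rw [if_pos rfl]
          split_ifs with hb
          · rw [hb, Fin.cons_zero]
          · rfl
        · rw [if_neg (Fin.succ_ne_zero a'), Matrix.of_apply]
          refine Fin.cases ?_ (fun b' => ?_) b
          · simp only [ψ, Fin.cons_zero, hr, hi, and_false, if_false,
              if_neg (Fin.succ_ne_zero a').symm]
          · simp only [ψ, Fin.cons_succ, hr, and_true, Fin.succ_inj, eq_comm]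
      rw [h2, Matrix.det_diagonal, Fin.prod_univ_succ]
      simpa using hc
  refine ⟨z, fun i => ?_⟩
  induction i using Fin.induction with
  | zero => simp
  | succ i ih => rw [hstep, ih, Fin.val_succ, pow_succ, Fin.val_castSucc, mul_assoc]

/-- A vector that is not on the curve is not a zero of the degeneracy ideal. -/
lemma exists_mem_degeneracyIdeal_of_not_onCurve (hL : LinearIndependent ℂ L) (hk : 2 ≤ k)
    {v : Fin (n + 1) → ℂ} (hv : v ≠ 0) (hvL : ¬ OnCurve L v) :
    ∃ g ∈ degeneracyIdeal (schwarzenbergerMatrix k L), MvPolynomial.eval v g ≠ 0 := by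
  refine exists_mem_degeneracyIdeal fun w τ hw => ?_
  have hw0 : w = 0 := by
    by_contra hw0
    exact hvL (onCurve_of_sum_smul_schwarzenbergerMatrix hL hk hw0 hw)
  ext a
  have h1 := hw a
  simp only [hw0, Pi.zero_apply, zero_smul, Finset.sum_const_zero] at h1
  exact (smul_eq_zero.1 h1.symm).resolve_right hv

/-- Near the point `L 0`, the functions that vanish on the curve vanish on the degeneracy scheme. -/
lemma map_eq_zero_of_forall_onCurve (hL : LinearIndependent ℂ L) (hk : 2 ≤ k) {c : ℂ} (hc : c ≠ 0)
    (hφ : ∀ g, MvPolynomial.eval (c • L 0) g ≠ 0 → IsUnit (φ g))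
    (hD : ∀ g ∈ degeneracyIdeal (schwarzenbergerMatrix k L), φ g = 0) {g : Coord n}
    (hg : ∀ v, OnCurve L v → MvPolynomial.eval v g = 0) : φ g = 0 := by
  have hu : IsUnit (Matrix.of L).det :=
    (Matrix.isUnit_iff_isUnit_det _).1 (Matrix.linearIndependent_rows_iff_isUnit.1 hL)
  let Y : Fin (n + 1) → Fin (n + 1) → ℂ := fun i l => (Matrix.of L)⁻¹ l i
  have hLY : ∀ i j, Y i ⬝ᵥ L j = if i = j then 1 else 0 := by
    intro i j
    have h1 := congrFun (congrFun (Matrix.mul_nonsing_inv (Matrix.of L) hu) j) i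
    rw [Matrix.one_apply, Matrix.mul_apply'] at h1
    rw [dotProduct_comm]
    exact h1.trans (if_congr eq_comm rfl rfl)
  have hYL : ∀ l, ∑ i, L i l • Y i = Pi.single l 1 := by
    intro l
    ext l'
    have h1 := congrFun (congrFun (Matrix.nonsing_inv_mul (Matrix.of L) hu) l') l
    rw [Matrix.one_apply, Matrix.mul_apply] at h1
    rw [Finset.sum_apply, Pi.single_apply, ← h1]
    exact Finset.sum_congr rfl fun i _ => mul_comm _ _
  obtain ⟨z, hz⟩ := exists_map_linForm_eq_mul_pow hk hLY hc hφ hD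
  refine eq_zero_of_parametrization (m := 1)
    (Q := fun l => ∑ i, MvPolynomial.C (L i l) * (MvPolynomial.X 0 * MvPolynomial.X 1 ^ i.1))
    (r := ![φ (linForm (Y 0)), z]) (fun l => ?_) fun ρ hρ => ?_
  · rw [← linForm_single, ← hYL, linForm_sum, map_sum]
    rw [MvPolynomial.eval₂_sum]
    refine Finset.sum_congr rfl fun i _ => ?_
    rw [linForm_smul, map_mul, hz i]
    simp only [MvPolynomial.eval₂_mul, MvPolynomial.eval₂_C,
      MvPolynomial.eval₂_pow, MvPolynomial.eval₂_X, RingHom.comp_apply, Matrix.cons_val_zero,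
      Matrix.cons_val_one]
  · refine hg _ ⟨1, ρ 1, ρ 0, Or.inl one_ne_zero, hρ, ?_⟩
    ext l
    simp only [map_sum, map_mul, map_pow, MvPolynomial.eval_C, MvPolynomial.eval_X, curvePoint,
      Pi.smul_apply, Finset.sum_apply, smul_eq_mul, one_pow, one_mul, Finset.mul_sum]
    exact Finset.sum_congr rfl fun i _ => by ring

/-- A degeneracy scheme with the Schwarzenberger matrices of all the parametrizations of the dual
curve of `C` is this curve. -/
lemma sameSubscheme_osculating {C : RationalNormalCurve n} (hk : 2 ≤ k) {D : Ideal (Coord n)}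
    (hD : ∀ L, Parametrizes L C → D = degeneracyIdeal (schwarzenbergerMatrix k L)) :
    SameSubscheme D (reducedIdeal C.osculating) := by
  obtain ⟨L, hL⟩ := exists_parametrizes C
  refine sameSubscheme_reducedIdeal (fun v hv hvZ g hg => ?_) fun g hg v hv => ?_
  · obtain ⟨w, -, τ, hτ, hw⟩ := ((hL.mk_mem_iff hv).1 hvZ).exists_sum_smul (k := k) (by omega)
    rw [hD L hL] at hg
    exact eval_eq_zero_of_mem_degeneracyIdeal hτ hw hg
  by_cases hvL : OnCurve L v
  · obtain ⟨L', hL', c, hc, rfl⟩ := hL.exists_first hvL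
    rw [hD L' hL']
    obtain ⟨R, _, φ, hφ, hφD⟩ :=
      exists_local_ring (degeneracyIdeal (schwarzenbergerMatrix k L')) (c • L' 0)
    refine (hφD g).1 (map_eq_zero_of_forall_onCurve hL'.indep hk hc hφ
      (fun g hg => (hφD g).2 ⟨1, by simp, by simpa using hg⟩) fun x hx => ?_)
    have hx0 : x ≠ 0 := by
      rintro rfl
      obtain ⟨s, t, d, hst, hd, h0⟩ := hx
      have h1 := (smul_eq_zero.1 h0.symm).resolve_left hd
      rw [curvePoint] at h1
      have h2 := Fintype.linearIndependent_iff.1 hL'.indep _ h1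
      rcases hst with hs | ht
      · have := h2 0
        simp [hs] at this
      · have := h2 (Fin.last n)
        simp [ht] at this
    exact eval_eq_zero_of_mem_reducedIdeal hg hx0 ((hL'.mk_mem_iff hx0).2 hx)
  · obtain ⟨d, hd, hdv⟩ := exists_mem_degeneracyIdeal_of_not_onCurve hL.indep hk hv hvL
    rw [hD L hL]
    exact ⟨d, hdv, Ideal.mul_mem_right _ _ hd⟩

section Bundles

variable {M : Type} [AddCommGroup M] [Module (FunField n) M] {S : SubSheaf n M}

lemma mem_unstableHyperplanes_iff_onCurve (hn : 1 ≤ n) (hk : 2 ≤ k) (hL : LinearIndependent ℂ L)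
    (hS : Iso (dual S) (kernelSheaf (schwarzenbergerMatrix k L))) {H : Hyperplane n} :
    H ∈ unstableHyperplanes S ↔ OnCurve L H.rep := by
  rw [mem_unstableHyperplanes_iff hn (nondegenerate_schwarzenbergerMatrix hL) hS]
  constructor
  · rintro ⟨w, hw, τ, hτ⟩
    exact onCurve_of_sum_smul_schwarzenbergerMatrix hL hk hw hτ
  · intro h
    obtain ⟨w, hw, τ, -, hτ⟩ := h.exists_sum_smul (k := k) (by omega)
    exact ⟨w, hw, τ, hτ⟩

end Bundles

lemma curvePoint_one_injective (hn : 1 ≤ n) (hL : LinearIndependent ℂ L) {t t' c : ℂ}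
    (h : curvePoint L 1 t = c • curvePoint L 1 t') : t = t' := by
  rw [curvePoint, curvePoint, Finset.smul_sum] at h
  simp only [smul_smul] at h
  have h1 := coeff_eq_of_sum_smul_eq hL h
  have h2 := h1 0
  have h3 := h1 ⟨1, by omega⟩
  simp only [one_pow, Fin.val_zero, pow_zero, mul_one, one_mul, pow_one] at h2 h3
  rw [h3, ← h2, one_mul]

lemma curvePoint_one_ne_zero (hL : LinearIndependent ℂ L) (t : ℂ) : curvePoint L 1 t ≠ 0 := by
  intro h
  have := Fintype.linearIndependent_iff.1 hL _ h 0
  simp at this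

/-- A curve of positive dimension has infinitely many points. -/
lemma infinite_setOf_onCurve (hn : 1 ≤ n) (hL : LinearIndependent ℂ L) :
    {H : Hyperplane n | OnCurve L H.rep}.Infinite := by
  refine Set.infinite_of_injective_forall_mem
    (f := fun t : ℂ => Projectivization.mk ℂ (curvePoint L 1 t) (curvePoint_one_ne_zero hL t))
    (fun t t' htt' => ?_) fun t => ?_
  · obtain ⟨c, hc⟩ := (Projectivization.mk_eq_mk_iff' ℂ _ _ _ _).1 htt'
    exact curvePoint_one_injective hn hL hc.symm
  · obtain ⟨c, hc, hcv⟩ := exists_rep_mk_eq_smul (curvePoint_one_ne_zero hL t)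
    exact ⟨1, t, c, Or.inl one_ne_zero, hc, hcv⟩

/-! ### Logarithmic bundles of osculating hyperplanes -/

section Log

variable {f : Fin (n + k + 1) → Fin (n + 1) → ℂ} {μ : Fin k → Fin (n + k + 1) → ℂ}
  {ℋ : Finset (Hyperplane n)}

lemma osculates_iff (hℋ : IsEquations f ℋ) {C : RationalNormalCurve n} (hL : Parametrizes L C) :
    Osculates ℋ C ↔ ∀ j, OnCurve L (f j) := by
  constructor
  · intro h j
    obtain ⟨H, hH, hHj⟩ := hℋ.exists_hyperplane j
    rw [← hHj]
    exact (hL.mem_iff H).1 (h H hH)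
  · intro h H hH
    obtain ⟨j, hj⟩ := hℋ.exists_index H hH
    rw [hL.mem_iff, hj]
    exact h j

lemma exists_osculates_iff (hℋ : IsEquations f ℋ) :
    (∃ C, Osculates ℋ C) ↔ ∃ L, LinearIndependent ℂ L ∧ ∀ j, OnCurve L (f j) := by
  constructor
  · rintro ⟨C, hC⟩
    obtain ⟨L, hL⟩ := exists_parametrizes C
    exact ⟨L, hL.indep, (osculates_iff hℋ hL).1 hC⟩
  · rintro ⟨L, hL, h⟩
    obtain ⟨C, hC⟩ := exists_curve_of_linearIndependent hL
    exact ⟨C, (osculates_iff hℋ hC).2 h⟩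

lemma iso_dual_logForms_schwarzenberger (hf : GenPos f) (hℋ : IsEquations f ℋ) (hn : 1 ≤ n)
    (hfL : ∀ j, OnCurve L (f j)) :
    Iso (dual (logForms ℋ)) (kernelSheaf (schwarzenbergerMatrix k L)) := by
  obtain ⟨μ, hμ, hequiv⟩ := exists_matEquiv_schwarzenbergerMatrix hf hn hfL
  exact (iso_dual_logForms_kernelSheaf hμ hℋ).trans (iso_kernelSheaf_of_matEquiv hequiv.symm)

lemma unstableSchemeEq_osculating (hf : GenPos f) (hℋ : IsEquations f ℋ) (hn : 1 ≤ n) (hk : 2 ≤ k)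
    {C : RationalNormalCurve n} (hC : Osculates ℋ C) :
    UnstableSchemeEq k (logForms ℋ) C.osculating := by
  refine ⟨?_, fun A hA => sameSubscheme_osculating hk fun L hL => ?_⟩
  · obtain ⟨L, hL⟩ := exists_parametrizes C
    ext H
    rw [hL.mem_iff]
    exact mem_unstableHyperplanes_iff_onCurve hn hk hL.indep
      (iso_dual_logForms_schwarzenberger hf hℋ hn ((osculates_iff hℋ hL).1 hC))
  · obtain ⟨μ, hμ, hequiv⟩ :=
      exists_matEquiv_schwarzenbergerMatrix hf hn ((osculates_iff hℋ hL).1 hC)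
    rw [degeneracyIdeal_eq_of_matEquiv (matEquiv_of_isSteinerMatrix hμ hℋ hn (by omega) hA),
      degeneracyIdeal_eq_of_matEquiv hequiv]

lemma iso_dual_dual_logForms (hf : GenPos f) (hℋ : IsEquations f ℋ) :
    Iso (logForms ℋ) (dual (dual (logForms ℋ))) := by
  have := Module.Basis.finiteDimensional_of_finite (lgBasisLast hf)
  exact iso_dual_dual fun p ω hω => mem_logForms_of_forall_dual hf hℋ hω

/-- A Schwarzenberger bundle has infinitely many unstable hyperplanes, so it is not the bundle of
finitely many hyperplanes that do not osculate a curve. -/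
lemma isSchwarzenberger_iff (h : IsGale f μ) (hℋ : IsEquations f ℋ) (hn : 1 ≤ n) (hk : 2 ≤ k) :
    IsSchwarzenberger k (logForms ℋ) ↔
      ∃ L, LinearIndependent ℂ L ∧ ∀ j, OnCurve L (f j) := by
  constructor
  · rintro ⟨L, hL, hiso⟩
    by_contra hno
    have h1 := h.unstableHyperplanes_eq hn hk hℋ hno
    have h2 : unstableHyperplanes (logForms ℋ) = {H | OnCurve L H.rep} := by
      ext H
      exact mem_unstableHyperplanes_iff_onCurve hn hk hL
        (hiso.dual.trans (iso_dual_dual_kernelSheaf _).symm)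
    exact infinite_setOf_onCurve hn hL (h2 ▸ h1 ▸ ℋ.finite_toSet)
  · rintro ⟨L, hL, hfL⟩
    exact ⟨L, hL, (iso_dual_dual_logForms h.genPos hℋ).trans
      (iso_dual_logForms_schwarzenberger h.genPos hℋ hn hfL).dual⟩

lemma exists_isEquations (hcard : ℋ.card = n + k + 1) (hnc : NormalCrossing ℋ) :
    ∃ (f : Fin (n + k + 1) → Fin (n + 1) → ℂ) (μ : Fin k → Fin (n + k + 1) → ℂ),
      IsGale f μ ∧ IsEquations f ℋ := by
  let e : Fin (n + k + 1) ≃ ℋ := (Finset.equivFinOfCardEq hcard).symm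
  obtain ⟨μ, hμ⟩ := exists_isGale (genPos_of_normalCrossing hnc e)
  refine ⟨_, μ, hμ, fun H hH => ⟨e.symm ⟨H, hH⟩, ?_⟩, fun i => ⟨(e i).1, (e i).2, rfl⟩⟩
  rw [Equiv.apply_symm_apply]

end Log
end CurveScheme

end

end PnBundle

theorem corollary5p10 (n k : ℕ) (hn : 1 ≤ n) (hk : 2 ≤ k) (ℋ : Finset (Hyperplane n))
    (hcard : ℋ.card = n + k + 1) (hnc : NormalCrossing ℋ) :
    IsSteiner k (logForms ℋ) ∧
    ((¬ ∃ C : RationalNormalCurve n, Osculates ℋ C) →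
      UnstableSchemeEq k (logForms ℋ) (ℋ : Set (Hyperplane n))) ∧
    (∀ C : RationalNormalCurve n, Osculates ℋ C →
      UnstableSchemeEq k (logForms ℋ) C.osculating) ∧
    ((∃ C : RationalNormalCurve n, Osculates ℋ C) ↔ IsSchwarzenberger k (logForms ℋ)) ∧
    (∀ ℋ' : Finset (Hyperplane n), ℋ'.card = n + k + 1 → NormalCrossing ℋ' →
      (¬ ∃ C : RationalNormalCurve n, Osculates ℋ C) →
      (¬ ∃ C : RationalNormalCurve n, Osculates ℋ' C) →
      (ℋ = ℋ' ↔ Iso (logForms ℋ) (logForms ℋ'))) := by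
  obtain ⟨f, μ, hμ, hf⟩ := exists_isEquations hcard hnc
  refine ⟨isSteiner_logForms hμ hf, fun hno => ?_,
    fun C hC => unstableSchemeEq_osculating hμ.genPos hf hn hk hC,
    (exists_osculates_iff hf).trans (isSchwarzenberger_iff hμ hf hn hk).symm,
    fun ℋ' hcard' hnc' hno hno' => ⟨?_, fun hiso => ?_⟩⟩
  · rw [exists_osculates_iff hf] at hno
    exact hμ.unstableSchemeEq hn hk hf hno
  · rintro rfl
    exact Iso.refl _
  · obtain ⟨f', μ', hμ', hf'⟩ := exists_isEquations hcard' hnc'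
    rw [exists_osculates_iff hf] at hno
    rw [exists_osculates_iff hf'] at hno'
    rw [← Finset.coe_inj, ← hμ.unstableHyperplanes_eq hn hk hf hno,
      ← hμ'.unstableHyperplanes_eq hn hk hf' hno']
    exact unstableHyperplanes_eq_of_iso hiso
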